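/- Let $\mathbf k$ be an algebraically closed field of characteristic $0$ and let $U$ be an affine nonsingular surface over $\mathbf k$ with local coordinates $x_1,x_2$ (that is, $(x_1,x_2)\colon U\to\mathbb A^2$ is étale), small enough that $x_1,x_2$ have exactly one common zero $o\in U$ and that the ideals $(x_1),(x_2)$ of $\mathcal O(U)$ are prime; for example $U=\mathbb A^2$. **Monster tower.** $S(0)=U$, $\mathcal B(0)=TU$; $S(k+1)=\mathbb P\mathcal B(k)$ is the $\mathbb P^1$-bundle of lines in the rank 2 focal bundle $\mathcal B(k)\subset TS(k)$, and $\mathcal B(k+1)$ consists of the tangent vectors to $S(k+1)$ at a point $\ell$ whose image in $TS(k)$ lies on the line $\ell$. For each word $p_1\cdots p_k$ in the letters $1,2$ there is a chart $\mathcal C(p_1\cdots p_k)\cong U\times\mathbb A^k$ of $S(k)$ with two active coordinates $x_1(p_1\cdots p_k),x_2(p_1\cdots p_k)$: on $\mathcal C(\varnothing)=U$ they are $x_1,x_2$. With $\bar q$ the letter other than $q$, the chart $\mathcal C(p_1\cdots p_kq)$ consists of the lines on which $dx_q(p_1\cdots p_k)\ne0$; its new coordinate is $\mathbf n=x_{\bar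 q}(p_1\cdots p_kq)=dx_{\bar q}(p_1\cdots p_k)/dx_q(p_1\cdots p_k)$, its retained coordinate is $\mathbf r=x_q(p_1\cdots p_kq)=x_q(p_1\cdots p_k)$, and its deactivated coordinate is $\mathbf d=x_{\bar q}(p_1\cdots p_k)$. Its coordinate functions are $x_1,x_2$ and the coordinates introduced at levels $1,\dots,k+1$. Let $N(p_1\cdots p_k)$ be the origin of $\mathcal C(p_1\cdots p_k)$ (the point over $o$ at which all coordinates vanish). **Prolongation.** The prolongation of a reduced curve in $S(k)$ with focal tangent lines is the closure in $S(k+1)$ of the set of its tangent lines at nonsingular points. A vertical curve is a fibre of some $S(j)\to S(j-1)$. Let $T=\mathbb A^1$ with coordinate $t$. The family $\mathcal X(k)\subset S(k)\times T$ is the closure of the family over $T\setminus\{0\}$ whose member at $t$ is the $k$-th prolongation of the curve $x_1x_2=t$; let $X(k)_0$ be its scheme-theoretic fibre over $t=0$. **Node binomials.** $B(\varnothing)=x_1x_2$, $B(p_1)=\mathbf n\mathbf r+\mathbf d$, and, for $k\ge2$, if $B(p_1\cdots p_{k-1})$ has the form $\alpha\mathbf n\mathbf r+\beta\mathbf d$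 in the coordinates $\mathbf n,\mathbf r,\mathbf d$ of $\mathcal C(p_1\cdots p_{k-1})$, then, in the coordinates $\mathbf n,\mathbf r,\mathbf d$ of $\mathcal C(p_1\cdots p_k)$, $B(p_1\cdots p_k)$ is $\alpha\mathbf n\mathbf r+(\alpha+\beta)\mathbf d$ if $p_k=p_{k-1}$ and $(\alpha+\beta)\mathbf n\mathbf r+\alpha\mathbf d$ if $p_k\ne p_{k-1}$. **Theorem.** Let $k\ge0$. The family $\mathcal X(k)$ is flat over $T$, and its central member $X(k)_0$ is a chain of $2^k+1$ irreducible curves meeting at ordinary nodes. More precisely, $X(k)_0$ has exactly $2^k+1$ irreducible components (twigs) $T_0,\dots,T_{2^k}$, with the following properties. 1. If $w_0<w_1<\dots<w_{2^k-1}$ are the words of length $k$ in lexicographic order, then $T_i\cap T_{i+1}=\{N(w_i)\}$ for $0\le i<2^k$, and $T_i\cap T_j=\varnothing$ if $|i-j|\ge2$. 2. The end twigs $T_0$ and $T_{2^k}$ are the $k$-th prolongations of the curves $x_2=0$ and $x_1=0$. 3. Each interior twig $T_i$, $0<i<2^k$, taken with its reduced structure, is a vertical curve or is obtained from a vertical curve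 at a lower level by repeated prolongation, and it is isomorphic to $\mathbb P^1$. The chart $\mathcal C(w_i)$ meets exactly two twigs, $T_i$ and $T_{i+1}$, and they are the axes of its active coordinates $x_1(w_i)$ and $x_2(w_i)$: with reduced structure, the ideal of $T_i$ (resp. $T_{i+1}$) in $\mathcal C(w_i)$ is generated by all coordinate functions except $x_1(w_i)$ (resp. $x_2(w_i)$), and the ideal of their union, which is $X(k)_0$ with reduced structure, is generated by $x_1(w_i)x_2(w_i)$ and the coordinate functions that are not active. 4. In the chart $\mathcal C(p_1\cdots p_k)$ the ideal of the scheme $X(k)_0$ is generated by $B(\varnothing),B(p_1),B(p_1p_2),\dots,B(p_1\cdots p_k)$. -/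

import Mathlib

namespace Monster

universe u v w

/-- A string `p₁ p₂ ⋯ pₖ` in the two-letter alphabet; the letters `1, 2` are `0, 1 : Fin 2`,
and `p₁` is the entry with index `0`. -/
abbrev Word (k : ℕ) := Fin k → Fin 2

/-- The string with its last letter removed. -/
def Word.trunc {k : ℕ} (p : Word (k + 1)) : Word k := fun j => p j.castSucc

/-- The last letter. -/
def Word.final {k : ℕ} (p : Word (k + 1)) : Fin 2 := p (Fin.last k)

/-- The coordinate ring of a chart `U × 𝔸ᵏ` at level `k`, where `A` is the coordinate ring of `U`.
The variable `X j` is the affine coordinate introduced at level `j + 1`. -/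
abbrev ChartRing (A : Type v) [CommRing A] (k : ℕ) := MvPolynomial (Fin k) A

section Charts

variable {A : Type v} [CommRing A]

/-- Pullback of functions along the projection from a chart at level `k + 1` to the chart
below it. -/
noncomputable def pull (k : ℕ) : ChartRing A k →ₐ[A] ChartRing A (k + 1) :=
  MvPolynomial.rename Fin.castSucc

/-- The two active coordinates `x₁(p₁⋯pₖ)`, `x₂(p₁⋯pₖ)` of the chart `C(p₁⋯pₖ)`.
Passing from `p₁⋯pₖ` to `p₁⋯pₖq`, the coordinate with index `q` is retained, and the one with the
other index is replaced by the new coordinate. -/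
noncomputable def active (x : Fin 2 → A) : (k : ℕ) → Word k → Fin 2 → ChartRing A k
  | 0, _, i => MvPolynomial.C (x i)
  | k + 1, p, i =>
      if i = p.final then pull k (active x k p.trunc i) else MvPolynomial.X (Fin.last k)

/-- The `k + 2` coordinate functions of a chart at level `k`. -/
def coords (x : Fin 2 → A) (k : ℕ) : Set (ChartRing A k) :=
  Set.range (fun i : Fin 2 => MvPolynomial.C (x i)) ∪ Set.range (fun j : Fin k => MvPolynomial.X j)

/-- The pair `(α, β)` of coefficients of the node binomial `B(p₁⋯pₖ) = α n r + β d`.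
The choice at the last step is regular if the last two letters agree, critical otherwise. -/
def nodeCoeff : (k : ℕ) → Word k → ℕ × ℕ
  | 0, _ => (1, 0)
  | 1, _ => (1, 1)
  | k + 2, p =>
      let c := nodeCoeff (k + 1) p.trunc
      if p.final = p.trunc.final then (c.1, c.1 + c.2) else (c.1 + c.2, c.1)

/-- The node binomial `B(p₁⋯pₖ) = α n r + β d` (the monomial `x₁ x₂` for `k = 0`).
Here the new coordinate `n` represents `d(d)/d(r)`: the retained coordinate `r` is the active
coordinate one level below with index `pₖ`, and the deactivated coordinate `d` the other one. -/
noncomputable def nodeBinomial (x : Fin 2 → A) : (k : ℕ) → Word k → ChartRing A k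
  | 0, _ => MvPolynomial.C (x 0 * x 1)
  | k + 1, p =>
      ((nodeCoeff (k + 1) p).1 : ChartRing A (k + 1)) *
          (MvPolynomial.X (Fin.last k) * pull k (active x k p.trunc p.final)) +
        ((nodeCoeff (k + 1) p).2 : ChartRing A (k + 1)) *
          pull k (active x k p.trunc (Fin.rev p.final))

/-- The set `B(∅), B(p₁), …, B(p₁⋯pₖ)` of functions on the chart `C(p₁⋯pₖ)`. -/
def nodeBinomials (x : Fin 2 → A) : (k : ℕ) → Word k → Set (ChartRing A k)
  | 0, p => {nodeBinomial x 0 p}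
  | k + 1, p => insert (nodeBinomial x (k + 1) p) (pull k '' nodeBinomials x k p.trunc)

end Charts

section Tower

variable (𝕜 : Type u) [Field 𝕜] {A : Type v} [CommRing A] [Algebra 𝕜 A]

/-- The `R`-valued points of a chart `U × 𝔸ᵏ`. For `R = 𝕜` these are its ordinary points. An
`R[ε]`-valued point is a tangent vector at the `R`-valued point obtained by setting `ε = 0`. -/
abbrev ChartPt (A : Type v) [CommRing A] [Algebra 𝕜 A] (k : ℕ) (R : Type w) [CommRing R]
    [Algebra 𝕜 R] := ChartRing A k →ₐ[𝕜] R

variable {𝕜}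

/-- The projection `πₖ₊₁` in charts; on `R[ε]`-valued points this is its derivative. -/
noncomputable def ChartPt.proj {k : ℕ} {R : Type w} [CommRing R] [Algebra 𝕜 R]
    (q : ChartPt 𝕜 A (k + 1) R) : ChartPt 𝕜 A k R :=
  q.comp ((pull k).restrictScalars 𝕜)

/-- The point at which a tangent vector is attached. -/
noncomputable def ChartPt.foot {k : ℕ} {R : Type w} [CommRing R] [Algebra 𝕜 R]
    (τ : ChartPt 𝕜 A k (DualNumber R)) : ChartPt 𝕜 A k R :=
  (TrivSqZeroExt.fstHom 𝕜 R R).comp τ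

/-- `τ.diff f` is `df(τ)`. -/
noncomputable def ChartPt.diff {k : ℕ} {R : Type w} [CommRing R] [Algebra 𝕜 R]
    (τ : ChartPt 𝕜 A k (DualNumber R)) (f : ChartRing A k) : R :=
  TrivSqZeroExt.snd (τ f)

/-- `IsFocal x k p τ`: the tangent vector `τ` to the chart `C(p₁⋯pₖ)` lies in the focal bundle. At
level `0` the focal bundle is the whole tangent bundle. A tangent vector at a point `q` of level
`k + 1` is focal if its image one level below is focal and lies on the line represented by `q`; by
the meaning of the new coordinate `X (last k) = d(d)/d(r)` this line is given inside the focal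
bundle of level `k` by the equation `d(d) = X (last k) d(r)`. -/
def IsFocal (x : Fin 2 → A) : (k : ℕ) → Word k → {R : Type w} → [CommRing R] → [Algebra 𝕜 R] →
    ChartPt 𝕜 A k (DualNumber R) → Prop
  | 0, _, _, _, _, _ => True
  | k + 1, p, _, _, _, τ =>
      IsFocal x k p.trunc τ.proj ∧
        τ.proj.diff (active x k p.trunc (Fin.rev p.final)) =
          τ.foot (MvPolynomial.X (Fin.last k)) * τ.proj.diff (active x k p.trunc p.final)

/-- The line of focal tangent vectors at the point `q.proj` of `C(p₁⋯pₖ)` that is represented by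
the point `q` of `C(p₁⋯pₖ₊₁)`. -/
def line (x : Fin 2 → A) {k : ℕ} (p : Word (k + 1)) {R : Type w} [CommRing R] [Algebra 𝕜 R]
    (q : ChartPt 𝕜 A (k + 1) R) : Set (ChartPt 𝕜 A k (DualNumber R)) :=
  {τ | τ.foot = q.proj ∧ IsFocal x k p.trunc τ ∧
    τ.diff (active x k p.trunc (Fin.rev p.final)) =
      q (MvPolynomial.X (Fin.last k)) * τ.diff (active x k p.trunc p.final)}

/-- `SamePoint x k R p q p' q'`: the `R`-valued point `q` of the chart `C(p)` and the `R`-valued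
point `q'` of the chart `C(p')` are the same point of the `k`-th monster space (`R` a local ring).
Since `S(k + 1)` is the projectivization of the focal bundle of `S(k)`, two points of level `k + 1`
agree if and only if they lie over the same point of `S(k)` and represent the same line in the
focal bundle there, that is, a generator of one line is also a generator of the other. Equality of
tangent vectors to `S(k)` is equality of `R[ε]`-valued points of `S(k)`. -/
def SamePoint (x : Fin 2 → A) : (k : ℕ) → (R : Type w) → [CommRing R] → [Algebra 𝕜 R] →
    Word k → ChartPt 𝕜 A k R → Word k → ChartPt 𝕜 A k R → Prop
  | 0, _, _, _, _, q, _, q' => q = q'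
  | k + 1, R, _, _, p, q, p', q' =>
      SamePoint x k R p.trunc q.proj p'.trunc q'.proj ∧
        ∃ τ ∈ line x p q, ∃ τ' ∈ line x p' q',
          IsUnit (τ.diff (active x k p.trunc p.final)) ∧
          IsUnit (τ'.diff (active x k p'.trunc p'.final)) ∧
          SamePoint x k (DualNumber R) p.trunc τ p'.trunc τ'

variable (𝕜)

/-- The monster space `S(k)` over `U`: the charts `C(p) = U × 𝔸ᵏ`, glued along their common
points. -/
def Space (x : Fin 2 → A) (k : ℕ) : Type (max u v) :=
  Quot fun a b : Word k × ChartPt 𝕜 A k 𝕜 => SamePoint x k 𝕜 a.1 a.2 b.1 b.2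

variable {𝕜}

/-- The inclusion of the chart `C(p)` into `S(k)`. -/
def Space.mk (x : Fin 2 → A) {k : ℕ} (p : Word k) (q : ChartPt 𝕜 A k 𝕜) : Space 𝕜 x k :=
  Quot.mk _ (p, q)

/-- The projection `πₖ₊₁ : S(k + 1) → S(k)`. -/
noncomputable def Space.proj {x : Fin 2 → A} {k : ℕ} : Space 𝕜 x (k + 1) → Space 𝕜 x k :=
  Quot.lift (fun a => Space.mk x a.1.trunc a.2.proj) fun _ _ h => Quot.sound h.1

/-- The Zariski topology on the points of a chart. -/
noncomputable abbrev chartZariski (𝕜 : Type u) [Field 𝕜] (A : Type v) [CommRing A] [Algebra 𝕜 A] (k : ℕ) :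
    TopologicalSpace (ChartPt 𝕜 A k 𝕜) :=
  TopologicalSpace.induced
    (fun q => (⟨RingHom.ker q, RingHom.ker_isPrime q⟩ : PrimeSpectrum (ChartRing A k)))
    inferInstance

/-- The Zariski topology on `S(k)`: a set is closed if and only if its part in every chart is. -/
noncomputable instance Space.zariski (x : Fin 2 → A) (k : ℕ) : TopologicalSpace (Space 𝕜 x k) :=
  ⨆ p : Word k, TopologicalSpace.coinduced (Space.mk x p) (chartZariski 𝕜 A k)

/-- The part in the chart `C(p)` of a set of points of `S(k)`. -/
def inChart {x : Fin 2 → A} {k : ℕ} (p : Word k) (Z : Set (Space 𝕜 x k)) :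
    Set (ChartPt 𝕜 A k 𝕜) :=
  {q | Space.mk x p q ∈ Z}

/-- The ideal of all functions on the chart `C(p)` that vanish on `Z`. -/
noncomputable def idealOf {x : Fin 2 → A} {k : ℕ} (p : Word k) (Z : Set (Space 𝕜 x k)) :
    Ideal (ChartRing A k) :=
  ⨅ q ∈ inChart p Z, RingHom.ker q

/-- The Zariski tangent space, in the chart `C(p)`, of the reduced closed subscheme `Z` at `q`. -/
def tangentSpace {x : Fin 2 → A} {k : ℕ} (p : Word k) (Z : Set (Space 𝕜 x k))
    (q : ChartPt 𝕜 A k 𝕜) : Set (ChartPt 𝕜 A k (DualNumber 𝕜)) :=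
  {τ | τ.foot = q ∧ ∀ f ∈ idealOf p Z, τ f = 0}

/-- The prolongation of a curve `Z` in `S(k)` whose tangent lines are focal: the closure of the
set of the tangent lines of `Z` at its nonsingular points (the points at which the Zariski tangent
space is a line), regarded as points of `S(k + 1)`. -/
def prolong {x : Fin 2 → A} {k : ℕ} (Z : Set (Space 𝕜 x k)) : Set (Space 𝕜 x (k + 1)) :=
  closure {P | ∃ (p : Word (k + 1)) (q : ChartPt 𝕜 A (k + 1) 𝕜), P = Space.mk x p q ∧
    Space.mk x p.trunc q.proj ∈ Z ∧ tangentSpace p.trunc Z q.proj = line x p q}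

/-- The curve `f = 0` in `U = S(0)`. -/
def zeroLocus (x : Fin 2 → A) (f : A) : Set (Space 𝕜 x 0) :=
  {P | ∃ q : ChartPt 𝕜 A 0 𝕜, P = Space.mk x ![] q ∧ q (MvPolynomial.C f) = 0}

/-- The `k`-th prolongation of a curve in `U`. -/
def iterProlong {x : Fin 2 → A} (Z : Set (Space 𝕜 x 0)) : (k : ℕ) → Set (Space 𝕜 x k)
  | 0 => Z
  | k + 1 => prolong (iterProlong Z k)

/-- `IsProlongedVertical Z`: the set `Z` in `S(k)` is a vertical curve, i.e. a fibre of
`S(k) → S(k - 1)`, or is obtained from a vertical curve at a lower level by prolonging it one or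
several times. -/
inductive IsProlongedVertical {x : Fin 2 → A} : {k : ℕ} → Set (Space 𝕜 x k) → Prop
  | vertical {k : ℕ} (Q : Space 𝕜 x k) :
      IsProlongedVertical {P : Space 𝕜 x (k + 1) | P.proj = Q}
  | lift {k : ℕ} {Z : Set (Space 𝕜 x k)} :
      IsProlongedVertical Z → IsProlongedVertical (prolong Z)

/-- The origin of the chart `C(p₁⋯pₖ)`, where `o` is the point `x₁ = x₂ = 0` of `U`: this is the
node `N(p₁⋯pₖ)`. -/
noncomputable def node (x : Fin 2 → A) (o : A →ₐ[𝕜] 𝕜) {k : ℕ} (p : Word k) : Space 𝕜 x k :=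
  Space.mk x p (MvPolynomial.aevalTower o 0)

/-- The ideal of the family `𝒳(k)` of `k`-th prolongations of the curves `x₁ x₂ = t` in the
coordinate ring `𝒪(C(p))[t]` of `C(p) × T`, where `T` is the affine line. The family `𝒳(k)` is the
closure in `S(k) × T` of the family of the `k`-th prolongations of the members with `t ≠ 0`. This
is the only extension of the latter to a flat family over `T`. -/
noncomputable def familyIdeal (𝕜 : Type u) [Field 𝕜] {A : Type v} [CommRing A] [Algebra 𝕜 A]
    (x : Fin 2 → A) {k : ℕ} (p : Word k) : Ideal (Polynomial (ChartRing A k)) :=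
  ⨅ (t : 𝕜) (_ : t ≠ 0)
    (q : ChartPt 𝕜 A k 𝕜)
    (_ : q ∈ inChart p (iterProlong (zeroLocus x (x 0 * x 1 - algebraMap 𝕜 A t)) k)),
    RingHom.ker (Polynomial.eval₂RingHom q.toRingHom t)

/-- The map from `𝕜[t]` to the coordinate ring of the part of `𝒳(k)` in `C(p) × T`. -/
noncomputable def familyMap (𝕜 : Type u) [Field 𝕜] {A : Type v} [CommRing A] [Algebra 𝕜 A]
    (x : Fin 2 → A) {k : ℕ} (p : Word k) :
    Polynomial 𝕜 →+* Polynomial (ChartRing A k) ⧸ familyIdeal 𝕜 x p :=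
  (Ideal.Quotient.mk (familyIdeal 𝕜 x p)).comp
    (Polynomial.mapRingHom (algebraMap 𝕜 (ChartRing A k)))

/-- The ideal in the chart `C(p)` of the scheme `X(k)₀`, the member over `t = 0` of the
family `𝒳(k)`. -/
noncomputable def centralIdeal (𝕜 : Type u) [Field 𝕜] {A : Type v} [CommRing A] [Algebra 𝕜 A]
    (x : Fin 2 → A) {k : ℕ} (p : Word k) : Ideal (ChartRing A k) :=
  (familyIdeal 𝕜 x p).map (Polynomial.evalRingHom 0)

/-- The set of points of `X(k)₀`. -/
def centralFiber (𝕜 : Type u) [Field 𝕜] {A : Type v} [CommRing A] [Algebra 𝕜 A]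
    (x : Fin 2 → A) (k : ℕ) : Set (Space 𝕜 x k) :=
  {P | ∃ (p : Word k) (q : ChartPt 𝕜 A k 𝕜), P = Space.mk x p q ∧
    ∀ f ∈ centralIdeal 𝕜 x p, q f = 0}

/-- The restriction of `f` to the reduced closed subscheme `Z` of `S(k)` is a regular function
near the point `P`: in a chart around `P` it is a quotient of two functions from the coordinate
ring. -/
def IsRegularAt {x : Fin 2 → A} {k : ℕ} (Z : Set (Space 𝕜 x k)) (f : Space 𝕜 x k → 𝕜)
    (P : Space 𝕜 x k) : Prop :=
  ∃ (p : Word k) (q : ChartPt 𝕜 A k 𝕜) (g h : ChartRing A k), P = Space.mk x p q ∧ q h ≠ 0 ∧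
    ∀ q' ∈ inChart p Z, q' h ≠ 0 → f (Space.mk x p q') = q' g / q' h

/-- The function `f` on the projective line is regular near the point `P`: it is a quotient of
two forms of the same degree. -/
def IsRegularAtP1 (f : Projectivization 𝕜 (Fin 2 → 𝕜) → 𝕜)
    (P : Projectivization 𝕜 (Fin 2 → 𝕜)) : Prop :=
  ∃ (d : ℕ) (g h : MvPolynomial (Fin 2) 𝕜), g.IsHomogeneous d ∧ h.IsHomogeneous d ∧
    MvPolynomial.eval P.rep h ≠ 0 ∧
    ∀ P', MvPolynomial.eval P'.rep h ≠ 0 →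
      f P' = MvPolynomial.eval P'.rep g / MvPolynomial.eval P'.rep h

/-- The reduced closed subscheme `Z` of `S(k)` is isomorphic to the projective line: there is a
bijection that identifies the germs of regular functions at corresponding points (it is then a
homeomorphism: a set is a neighbourhood of a point in it if and only if its indicator function is
regular there). -/
def IsCopyOfP1 {x : Fin 2 → A} {k : ℕ} (Z : Set (Space 𝕜 x k)) : Prop :=
  ∃ φ : Projectivization 𝕜 (Fin 2 → 𝕜) → Space 𝕜 x k, Function.Injective φ ∧ Set.range φ = Z ∧
    ∀ (f : Space 𝕜 x k → 𝕜) (P : Projectivization 𝕜 (Fin 2 → 𝕜)),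
      IsRegularAt Z f (φ P) ↔ IsRegularAtP1 (f ∘ φ) P

end Tower

end Monster

namespace Monster

open MvPolynomial (X C)

universe u v w w'

/-! ### Tangent vectors to `U` and étale coordinates -/

section TangentLifts

variable {𝕜 : Type u} [Field 𝕜] {A : Type v} [CommRing A] [Algebra 𝕜 A]

/-! The vector field x₁∂₁ − x₂∂₂ generates a torus action that preserves every hyperbola x₁x₂ = t.
It lifts to the monster tower, and each active coordinate is an eigenfunction of it, of weight ± a
positive integer, the two signs being opposite. On a prolonged hyperbola the new coordinate is n =
dd/dr, and evaluating both differentials on this field gives w(r)·n·r + w(d)·d = 0. The recursion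
for the coefficients of the node binomials is the recursion for these weights (`nodeCoeff_succ`).
For t ≠ 0 the active coordinates are units in characteristic 0, so the node binomials of positive
level determine all the new coordinates, and the prolonged hyperbola is a graph over the hyperbola
(`OnHyperbola.unique`, `exists_onHyperbola`, `prolong_hyperbola`).

On the whole family t equals x₁x₂, so t can be eliminated and the family becomes the closure of one
surface, the graph over x₁x₂ ≠ 0. Its ideal is the kernel of the map from the chart ring to
A[1/(x₁x₂)]. That the positive node binomials generate this kernel (`mem_span_pos_of_eq_zero`) rests
on r, d being a regular sequence, in either order, modulo the earlier binomials
(`active_mul_mem_iff`): adjoining −w(d)d/(w(r)r) then costs only the one relation. Setting t = 0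
adds x₁x₂ to the generators (`centralIdeal_eq`), and flatness over the Dedekind ring 𝕜[t] is
torsion-freeness, which can be tested in A[1/(x₁x₂)].

The common zeros of all the node binomials in a chart are the two active axes, by induction: over an
axis n·r = 0, so either n = 0, which is the prolongation of the axis, or the point lies over the
origin and n is free, which is the vertical curve over the node (`forall_nodeBinomials_iff`).
Globally, twig m yields twig 2m by prolongation, and node m yields twig 2m + 1 as its fibre. The
n-th word in lexicographic order sees twigs n and n + 1 as its two axes (`twigCharts`). An interior
twig is seen in two charts whose coordinates on it are inverse to each other
(`samePoint_of_carries`), whence ℙ¹. The chain structure is then arithmetic of binary words.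

All points are taken with values in arbitrary algebras: a tangent vector is a point over R[ε], so an
induction on the level that compares lines must apply its hypothesis over the dual numbers. -/

/-- The map `a + bε ↦ φ a + c (φ b) ε` of dual numbers induced by `φ` and a scalar `c`. -/
noncomputable def dualMap {R : Type w} {R' : Type w'} [CommRing R] [Algebra 𝕜 R] [CommRing R']
    [Algebra 𝕜 R'] (φ : R →ₐ[𝕜] R') (c : R') : DualNumber R →ₐ[𝕜] DualNumber R' where
  toFun a := TrivSqZeroExt.inl (φ a.fst) + TrivSqZeroExt.inr (c * φ a.snd)
  map_one' := by ext <;> simp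
  map_zero' := by ext <;> simp
  map_add' a b := by ext <;> simp; ring
  map_mul' a b := by ext <;> simp; ring
  commutes' r := by
    have h : algebraMap 𝕜 (DualNumber R) r = TrivSqZeroExt.inl (algebraMap 𝕜 R r) := rfl
    have h' : algebraMap 𝕜 (DualNumber R') r = TrivSqZeroExt.inl (algebraMap 𝕜 R' r) := rfl
    rw [h, h']
    ext <;> simp

variable {R : Type w} [CommRing R] [Algebra 𝕜 R] {R' : Type w'} [CommRing R'] [Algebra 𝕜 R']

@[simp] theorem fst_dualMap (φ : R →ₐ[𝕜] R') (c : R') (a : DualNumber R) :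
    (dualMap φ c a).fst = φ a.fst := by simp [dualMap]

@[simp] theorem snd_dualMap (φ : R →ₐ[𝕜] R') (c : R') (a : DualNumber R) :
    (dualMap φ c a).snd = c * φ a.snd := by simp [dualMap]

theorem isNilpotent_ker {B C : Type*} [CommRing B] [CommRing C] (f : B →+* C)
    (h : ∀ a b, f a = 0 → f b = 0 → a * b = 0) : IsNilpotent (RingHom.ker f) := by
  refine ⟨2, ?_⟩
  rw [pow_two, Ideal.zero_eq_bot, eq_bot_iff, Ideal.mul_le]
  exact fun r hr s hs => h r s hr hs

theorem DualNumber.mul_eq_zero_of_fst {a b : DualNumber R} (ha : a.fst = 0) (hb : b.fst = 0) :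
    a * b = 0 := by
  ext <;> simp [ha, hb]

/-- Tangent vectors to `U` at a given point exist with prescribed values of `dx₁`, `dx₂`. -/
theorem exists_tangent {x : Fin 2 → A}
    (hx : (MvPolynomial.aeval x : MvPolynomial (Fin 2) 𝕜 →ₐ[𝕜] A).toRingHom.Etale)
    (b : A →ₐ[𝕜] R) (c : Fin 2 → R) :
    ∃ v : A →ₐ[𝕜] DualNumber R, (∀ a, (v a).fst = b a) ∧ ∀ i, (v (x i)).snd = c i := by
  let f : MvPolynomial (Fin 2) 𝕜 →ₐ[𝕜] A := MvPolynomial.aeval x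
  let : Algebra (MvPolynomial (Fin 2) 𝕜) A := f.toRingHom.toAlgebra
  have : Algebra.Etale (MvPolynomial (Fin 2) 𝕜) A := hx
  -- `g` encodes the prescribed differentials. The wanted vector is a lift of `b` along R[ε] → R
  -- over the polynomial ring, and formal smoothness supplies it because the kernel has square zero.
  let g : MvPolynomial (Fin 2) 𝕜 →ₐ[𝕜] DualNumber R :=
    MvPolynomial.aeval fun i => TrivSqZeroExt.inl (b (x i)) + TrivSqZeroExt.inr (c i)
  let h : MvPolynomial (Fin 2) 𝕜 →ₐ[𝕜] R := MvPolynomial.aeval fun i => b (x i)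
  let : Algebra (MvPolynomial (Fin 2) 𝕜) (DualNumber R) := g.toRingHom.toAlgebra
  let : Algebra (MvPolynomial (Fin 2) 𝕜) R := h.toRingHom.toAlgebra
  have hfb : b.comp f = h := by ext i; simp [f, h]
  have hgh : (TrivSqZeroExt.fstHom 𝕜 R R).comp g = h := by ext i; simp [g, h]
  let b' : A →ₐ[MvPolynomial (Fin 2) 𝕜] R :=
    { b with commutes' := fun r => AlgHom.congr_fun hfb r }
  let p' : DualNumber R →ₐ[MvPolynomial (Fin 2) 𝕜] R :=
    { TrivSqZeroExt.fstHom 𝕜 R R with commutes' := fun r => AlgHom.congr_fun hgh r }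
  have hsurj : Function.Surjective p' := fun r => ⟨TrivSqZeroExt.inl r, rfl⟩
  have hnil : IsNilpotent (RingHom.ker p') :=
    isNilpotent_ker p'.toRingHom fun a b => DualNumber.mul_eq_zero_of_fst
  let l := Algebra.FormallySmooth.liftOfSurjective b' p' hsurj hnil
  have hl : ∀ a, p' (l a) = b' a := Algebra.FormallySmooth.liftOfSurjective_apply b' p' hsurj hnil
  have hlf : ∀ r, l (f r) = g r := fun r => l.commutes r
  refine ⟨{ l.toRingHom with commutes' := fun r => ?_ }, hl, fun i => ?_⟩
  · have := hlf (algebraMap 𝕜 _ r)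
    rw [AlgHom.commutes, AlgHom.commutes] at this
    exact this
  · have := hlf (MvPolynomial.X i)
    simp only [f, g, MvPolynomial.aeval_X] at this
    change (l (x i)).snd = c i
    simp [this]

/-- A tangent vector to `U` is determined by its foot and the values of `dx₁`, `dx₂`. -/
theorem tangent_unique {x : Fin 2 → A}
    (hx : (MvPolynomial.aeval x : MvPolynomial (Fin 2) 𝕜 →ₐ[𝕜] A).toRingHom.Etale)
    {v v' : A →ₐ[𝕜] DualNumber R} (h : ∀ a, (v a).fst = (v' a).fst)
    (hs : ∀ i, (v (x i)).snd = (v' (x i)).snd) : v = v' := by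
  let f : MvPolynomial (Fin 2) 𝕜 →ₐ[𝕜] A := MvPolynomial.aeval x
  let : Algebra (MvPolynomial (Fin 2) 𝕜) A := f.toRingHom.toAlgebra
  have : Algebra.Etale (MvPolynomial (Fin 2) 𝕜) A := hx
  -- Agreement on the polynomial subring makes both vectors lifts of one point; formal
  -- unramifiedness leaves at most one lift.
  have hvv : v.comp f = v'.comp f := by
    ext i
    · simpa [f] using h (x i)
    · simpa [f] using hs i
  let : Algebra (MvPolynomial (Fin 2) 𝕜) (DualNumber R) := (v.comp f).toRingHom.toAlgebra
  let v₁ : A →ₐ[MvPolynomial (Fin 2) 𝕜] DualNumber R := { v with commutes' := fun r => rfl }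
  let v₂ : A →ₐ[MvPolynomial (Fin 2) 𝕜] DualNumber R :=
    { v' with commutes' := fun r => (AlgHom.congr_fun hvv r).symm }
  have hnil := isNilpotent_ker (TrivSqZeroExt.fstHom 𝕜 R R).toRingHom
    fun a b => DualNumber.mul_eq_zero_of_fst
  have := Algebra.FormallyUnramified.ext' (TrivSqZeroExt.fstHom 𝕜 R R).toRingHom hnil v₁ v₂ h
  exact AlgHom.ext fun a => AlgHom.congr_fun this a

end TangentLifts

/-! ### Points of charts and the focal bundle -/

section ChartPoints

variable {𝕜 : Type u} [Field 𝕜] {A : Type v} [CommRing A] [Algebra 𝕜 A]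
  {R : Type w} [CommRing R] [Algebra 𝕜 R] {R' : Type w'} [CommRing R'] [Algebra 𝕜 R'] {k : ℕ}

@[simp] theorem pull_C (a : A) : pull k (MvPolynomial.C a) = MvPolynomial.C a := by simp [pull]

@[simp] theorem pull_X (j : Fin k) :
    pull (A := A) k (MvPolynomial.X j) = MvPolynomial.X j.castSucc := by simp [pull]

theorem pull_injective : Function.Injective (pull (A := A) k) :=
  MvPolynomial.rename_injective _ (Fin.castSucc_injective k)

theorem ChartPt.proj_apply (q : ChartPt 𝕜 A (k + 1) R) (f : ChartRing A k) :
    q.proj f = q (pull k f) := rfl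

theorem ChartPt.foot_apply (τ : ChartPt 𝕜 A k (DualNumber R)) (f : ChartRing A k) :
    τ.foot f = (τ f).fst := rfl

theorem ChartPt.diff_def (τ : ChartPt 𝕜 A k (DualNumber R)) (f : ChartRing A k) :
    τ.diff f = (τ f).snd := rfl

theorem ChartPt.ext_coords {q q' : ChartPt 𝕜 A k R}
    (hC : ∀ a, q (MvPolynomial.C a) = q' (MvPolynomial.C a))
    (hX : ∀ j, q (MvPolynomial.X j) = q' (MvPolynomial.X j)) : q = q' := by
  refine AlgHom.ext fun f => ?_
  induction f using MvPolynomial.induction_on with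
  | C a => exact hC a
  | add p q hp hq => simp [hp, hq]
  | mul_X p i hp => simp [hp, hX]

theorem ChartPt.ext_succ {q q' : ChartPt 𝕜 A (k + 1) R} (h : q.proj = q'.proj)
    (hX : q (MvPolynomial.X (Fin.last k)) = q' (MvPolynomial.X (Fin.last k))) : q = q' := by
  refine ChartPt.ext_coords (fun a => ?_) (fun j => ?_)
  · simpa [ChartPt.proj_apply] using AlgHom.congr_fun h (MvPolynomial.C a)
  · refine Fin.lastCases hX (fun j => ?_) j
    simpa [ChartPt.proj_apply] using AlgHom.congr_fun h (MvPolynomial.X j)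

/-- The image in `U` of a point of a chart. -/
noncomputable def ChartPt.base (q : ChartPt 𝕜 A k R) : A →ₐ[𝕜] R :=
  q.comp (IsScalarTower.toAlgHom 𝕜 A (ChartRing A k))

@[simp] theorem ChartPt.base_apply (q : ChartPt 𝕜 A k R) (a : A) :
    q.base a = q (MvPolynomial.C a) := rfl

/-- The point of a chart at level `k + 1` over a given point with a given new coordinate. -/
noncomputable def ChartPt.extend (z : ChartPt 𝕜 A k R) (n : R) : ChartPt 𝕜 A (k + 1) R :=
  MvPolynomial.aevalTower z.base (Fin.snoc (α := fun _ => R) (fun j => z (MvPolynomial.X j)) n)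

@[simp] theorem ChartPt.extend_last (z : ChartPt 𝕜 A k R) (n : R) :
    z.extend n (MvPolynomial.X (Fin.last k)) = n := by simp [ChartPt.extend]

@[simp] theorem ChartPt.proj_extend (z : ChartPt 𝕜 A k R) (n : R) : (z.extend n).proj = z := by
  refine ChartPt.ext_coords (fun a => ?_) (fun j => ?_)
  · simp [ChartPt.proj_apply, ChartPt.extend]
  · simp [ChartPt.proj_apply, ChartPt.extend]

theorem ChartPt.extend_pull (z : ChartPt 𝕜 A k R) (n : R) (f : ChartRing A k) :
    z.extend n (pull k f) = z f := AlgHom.congr_fun (z.proj_extend n) f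

/-- A point of `U` as a point of the chart at level `0`. -/
noncomputable def ChartPt.ofBase (b : A →ₐ[𝕜] R) : ChartPt 𝕜 A 0 R :=
  MvPolynomial.aevalTower b Fin.elim0

@[simp] theorem ChartPt.ofBase_C (b : A →ₐ[𝕜] R) (a : A) :
    ChartPt.ofBase b (MvPolynomial.C a) = b a := by simp [ChartPt.ofBase]

theorem ChartPt.ext_zero {q q' : ChartPt 𝕜 A 0 R} (h : q.base = q'.base) : q = q' :=
  ChartPt.ext_coords (fun a => AlgHom.congr_fun h a) fun j => j.elim0

theorem eq_or_eq_rev (i s : Fin 2) : i = s ∨ i = Fin.rev s := by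
  revert i s; decide

theorem rev_ne (s : Fin 2) : Fin.rev s ≠ s := by
  revert s; decide

theorem active_final (x : Fin 2 → A) (p : Word (k + 1)) :
    active x (k + 1) p p.final = pull k (active x k p.trunc p.final) := by simp [active]

theorem active_rev_final (x : Fin 2 → A) (p : Word (k + 1)) :
    active x (k + 1) p (Fin.rev p.final) = MvPolynomial.X (Fin.last k) := by
  simp [active, rev_ne]

/-- Used with `s` the last letter, so that the cases are the retained and the new coordinate. -/
theorem forall_fin_two_iff {P : Fin 2 → Prop} (s : Fin 2) : (∀ i, P i) ↔ P s ∧ P (Fin.rev s) :=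
  ⟨fun h => ⟨h _, h _⟩, fun h i => by rcases eq_or_eq_rev i s with rfl | rfl; exacts [h.1, h.2]⟩

theorem isFocal_zero (x : Fin 2 → A) (p : Word 0) (τ : ChartPt 𝕜 A 0 (DualNumber R)) :
    IsFocal x 0 p τ := by simp [IsFocal]

theorem isFocal_succ {x : Fin 2 → A} {p : Word (k + 1)}
    {τ : ChartPt 𝕜 A (k + 1) (DualNumber R)} :
    IsFocal x (k + 1) p τ ↔ IsFocal x k p.trunc τ.proj ∧
        τ.proj.diff (active x k p.trunc (Fin.rev p.final)) =
          τ.foot (MvPolynomial.X (Fin.last k)) * τ.proj.diff (active x k p.trunc p.final) := by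
  rw [IsFocal]

/-- The image of a tangent vector under a change of the base ring combined with a scaling. -/
noncomputable def ChartPt.tmap (τ : ChartPt 𝕜 A k (DualNumber R)) (φ : R →ₐ[𝕜] R') (c : R') :
    ChartPt 𝕜 A k (DualNumber R') := (dualMap φ c).comp τ

@[simp] theorem ChartPt.tmap_foot (τ : ChartPt 𝕜 A k (DualNumber R)) (φ : R →ₐ[𝕜] R') (c : R') :
    (τ.tmap φ c).foot = φ.comp τ.foot := by
  refine AlgHom.ext fun f => ?_
  simp [ChartPt.foot_apply, ChartPt.tmap]

@[simp] theorem ChartPt.tmap_diff (τ : ChartPt 𝕜 A k (DualNumber R)) (φ : R →ₐ[𝕜] R') (c : R')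
    (f : ChartRing A k) : (τ.tmap φ c).diff f = c * φ (τ.diff f) := by
  simp [ChartPt.diff_def, ChartPt.tmap]

theorem ChartPt.tmap_proj (τ : ChartPt 𝕜 A (k + 1) (DualNumber R)) (φ : R →ₐ[𝕜] R') (c : R') :
    (τ.tmap φ c).proj = τ.proj.tmap φ c := rfl

theorem ChartPt.foot_proj (τ : ChartPt 𝕜 A (k + 1) (DualNumber R)) : τ.proj.foot = τ.foot.proj :=
  rfl

theorem ChartPt.comp_proj (φ : R →ₐ[𝕜] R') (q : ChartPt 𝕜 A (k + 1) R) :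
    ChartPt.proj (φ.comp q) = φ.comp q.proj := rfl

/-- The focal equations are linear in the vector and natural in the base ring. -/
theorem IsFocal.tmap {x : Fin 2 → A} {p : Word k} {τ : ChartPt 𝕜 A k (DualNumber R)}
    (h : IsFocal x k p τ) (φ : R →ₐ[𝕜] R') (c : R') : IsFocal x k p (τ.tmap φ c) := by
  induction k with
  | zero => exact isFocal_zero x p _
  | succ k ih =>
    rw [isFocal_succ] at h ⊢
    refine ⟨ih h.1, ?_⟩
    rw [ChartPt.tmap_proj, ChartPt.tmap_diff, ChartPt.tmap_diff, h.2, ChartPt.tmap_foot, map_mul,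
      AlgHom.comp_apply]
    ring

/-- Together with `IsFocal.unique`: the focal bundle is free of rank 2, and the differentials of the
active coordinates trivialise it. One level up, dr and dn are free, while dd = n dr is forced. -/
theorem exists_isFocal {x : Fin 2 → A}
    (hx : (MvPolynomial.aeval x : MvPolynomial (Fin 2) 𝕜 →ₐ[𝕜] A).toRingHom.Etale)
    (p : Word k) (z : ChartPt 𝕜 A k R) (c : Fin 2 → R) :
    ∃ τ : ChartPt 𝕜 A k (DualNumber R), τ.foot = z ∧ IsFocal x k p τ ∧
      ∀ i, τ.diff (active x k p i) = c i := by
  induction k generalizing c with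
  | zero =>
    obtain ⟨v, hv, hc⟩ := exists_tangent hx z.base c
    refine ⟨ChartPt.ofBase v, ?_, isFocal_zero _ _ _, fun i => ?_⟩
    · exact ChartPt.ext_zero (AlgHom.ext fun a => by simp [ChartPt.foot_apply, hv])
    · simpa [ChartPt.diff_def, active] using hc i
  | succ k ih =>
    -- Below, dr takes the prescribed value and dd = n dr is what the focal condition demands.
    obtain ⟨σ, hσ, hf, hd⟩ := ih p.trunc z.proj (fun i => if i = p.final then c p.final else
      z (MvPolynomial.X (Fin.last k)) * c p.final)
    have hX : (σ.extend (TrivSqZeroExt.inl (z (MvPolynomial.X (Fin.last k))) +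
        TrivSqZeroExt.inr (c (Fin.rev p.final)))).foot (MvPolynomial.X (Fin.last k)) =
        z (MvPolynomial.X (Fin.last k)) := by simp [ChartPt.foot_apply]
    refine ⟨σ.extend (TrivSqZeroExt.inl (z (MvPolynomial.X (Fin.last k))) +
      TrivSqZeroExt.inr (c (Fin.rev p.final))), ChartPt.ext_succ ?_ hX, ?_, ?_⟩
    · rw [← ChartPt.foot_proj, ChartPt.proj_extend, hσ]
    · rw [isFocal_succ, ChartPt.proj_extend, hX]
      refine ⟨hf, ?_⟩
      rw [hd, hd]; simp [rev_ne]
    · rw [forall_fin_two_iff p.final, active_final, active_rev_final]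
      constructor
      · rw [ChartPt.diff_def, ChartPt.extend_pull, ← ChartPt.diff_def, hd]; simp
      · simp [ChartPt.diff_def]

theorem IsFocal.unique {x : Fin 2 → A}
    (hx : (MvPolynomial.aeval x : MvPolynomial (Fin 2) 𝕜 →ₐ[𝕜] A).toRingHom.Etale)
    {p : Word k} {τ τ' : ChartPt 𝕜 A k (DualNumber R)} (hτ : IsFocal x k p τ)
    (hτ' : IsFocal x k p τ') (hfoot : τ.foot = τ'.foot)
    (hd : ∀ i, τ.diff (active x k p i) = τ'.diff (active x k p i)) : τ = τ' := by
  induction k with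
  | zero =>
    refine ChartPt.ext_zero (tangent_unique hx (fun a => ?_) fun i => ?_)
    · exact AlgHom.congr_fun hfoot (MvPolynomial.C a)
    · simpa [ChartPt.diff_def, active] using hd i
  | succ k ih =>
    rw [isFocal_succ] at hτ hτ'
    rw [forall_fin_two_iff p.final, active_final, active_rev_final] at hd
    have hX : τ.foot (MvPolynomial.X (Fin.last k)) = τ'.foot (MvPolynomial.X (Fin.last k)) := by
      rw [hfoot]
    refine ChartPt.ext_succ (ih hτ.1 hτ'.1 ?_ ?_) ?_
    · rw [ChartPt.foot_proj, ChartPt.foot_proj, hfoot]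
    · rw [forall_fin_two_iff p.final, hτ.2, hτ'.2, hX]
      have : τ.proj.diff (active x k p.trunc p.final) = τ'.proj.diff (active x k p.trunc p.final) :=
        hd.1
      exact ⟨this, by rw [this]⟩
    · ext
      · exact hX
      · exact hd.2

end ChartPoints

/-! ### Equality of points of the monster space -/

section SamePoint

variable {𝕜 : Type u} [Field 𝕜] {A : Type v} [CommRing A] [Algebra 𝕜 A]
  {R : Type w} [CommRing R] [Algebra 𝕜 R] {R' : Type w} [CommRing R'] [Algebra 𝕜 R'] {k : ℕ}
  {x : Fin 2 → A}

theorem samePoint_zero {p p' : Word 0} {q q' : ChartPt 𝕜 A 0 R} :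
    SamePoint x 0 R p q p' q' ↔ q = q' := by rw [SamePoint]

theorem samePoint_succ {p p' : Word (k + 1)} {q q' : ChartPt 𝕜 A (k + 1) R} :
    SamePoint x (k + 1) R p q p' q' ↔
      SamePoint x k R p.trunc q.proj p'.trunc q'.proj ∧
        ∃ τ ∈ line x p q, ∃ τ' ∈ line x p' q',
          IsUnit (τ.diff (active x k p.trunc p.final)) ∧
          IsUnit (τ'.diff (active x k p'.trunc p'.final)) ∧
          SamePoint x k (DualNumber R) p.trunc τ p'.trunc τ' := by rw [SamePoint]

theorem mem_line {p : Word (k + 1)} {q : ChartPt 𝕜 A (k + 1) R}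
    {τ : ChartPt 𝕜 A k (DualNumber R)} :
    τ ∈ line x p q ↔ τ.foot = q.proj ∧ IsFocal x k p.trunc τ ∧
      τ.diff (active x k p.trunc (Fin.rev p.final)) =
        q (X (Fin.last k)) * τ.diff (active x k p.trunc p.final) := Iff.rfl

theorem tmap_mem_line {R' : Type w'} [CommRing R'] [Algebra 𝕜 R'] {p : Word (k + 1)}
    {q : ChartPt 𝕜 A (k + 1) R} {τ : ChartPt 𝕜 A k (DualNumber R)} (h : τ ∈ line x p q)
    (φ : R →ₐ[𝕜] R') (c : R') : τ.tmap φ c ∈ line x p (φ.comp q) := by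
  obtain ⟨h₁, h₂, h₃⟩ := h
  refine ⟨?_, h₂.tmap φ c, ?_⟩
  · rw [ChartPt.tmap_foot, h₁, ChartPt.comp_proj]
  · rw [ChartPt.tmap_diff, ChartPt.tmap_diff, h₃, map_mul, AlgHom.comp_apply]
    ring

theorem SamePoint.map {p p' : Word k} {q q' : ChartPt 𝕜 A k R} (h : SamePoint x k R p q p' q')
    (φ : R →ₐ[𝕜] R') : SamePoint x k R' p (φ.comp q) p' (φ.comp q') := by
  induction k generalizing R R' with
  | zero => rw [samePoint_zero] at h ⊢; rw [h]
  | succ k ih =>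
    rw [samePoint_succ] at h ⊢
    obtain ⟨h₁, τ, hτ, τ', hτ', hu, hu', hs⟩ := h
    refine ⟨ih h₁ φ, _, tmap_mem_line hτ φ 1, _, tmap_mem_line hτ' φ 1, ?_, ?_, ih hs _⟩
    · rw [ChartPt.tmap_diff, one_mul]; exact hu.map φ
    · rw [ChartPt.tmap_diff, one_mul]; exact hu'.map φ

/-- In a chart the retained differential vanishes on no line, so each line has a generator
normalised by dr = 1; by `line_unique` there is only one. -/
theorem exists_generator
    (hx : (MvPolynomial.aeval x : MvPolynomial (Fin 2) 𝕜 →ₐ[𝕜] A).toRingHom.Etale)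
    (p : Word (k + 1)) (q : ChartPt 𝕜 A (k + 1) R) :
    ∃ τ ∈ line x p q, τ.diff (active x k p.trunc p.final) = 1 := by
  obtain ⟨τ, h₁, h₂, h₃⟩ := exists_isFocal hx p.trunc q.proj
    fun i => if i = p.final then 1 else q (X (Fin.last k))
  refine ⟨τ, ⟨h₁, h₂, ?_⟩, ?_⟩
  · rw [h₃, h₃]; simp [rev_ne]
  · rw [h₃]; simp

theorem line_unique
    (hx : (MvPolynomial.aeval x : MvPolynomial (Fin 2) 𝕜 →ₐ[𝕜] A).toRingHom.Etale)
    {p : Word (k + 1)} {q : ChartPt 𝕜 A (k + 1) R} {τ τ' : ChartPt 𝕜 A k (DualNumber R)}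
    (hτ : τ ∈ line x p q) (hτ' : τ' ∈ line x p q)
    (h : τ.diff (active x k p.trunc p.final) = τ'.diff (active x k p.trunc p.final)) : τ = τ' := by
  refine hτ.2.1.unique hx hτ'.2.1 (hτ.1.trans hτ'.1.symm) ?_
  rw [forall_fin_two_iff p.final]
  exact ⟨h, by rw [hτ.2.2, hτ'.2.2, h]⟩

theorem line_eq_scale
    (hx : (MvPolynomial.aeval x : MvPolynomial (Fin 2) 𝕜 →ₐ[𝕜] A).toRingHom.Etale)
    {p : Word (k + 1)} {q : ChartPt 𝕜 A (k + 1) R} {τ τ' : ChartPt 𝕜 A k (DualNumber R)}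
    (hτ : τ ∈ line x p q) (hτ' : τ' ∈ line x p q)
    (h : IsUnit (τ.diff (active x k p.trunc p.final))) :
    ∃ c, τ' = τ.tmap (AlgHom.id 𝕜 R) c := by
  obtain ⟨u, hu⟩ := h
  refine ⟨τ'.diff (active x k p.trunc p.final) * ↑u⁻¹, line_unique hx hτ' ?_ ?_⟩
  · simpa using tmap_mem_line hτ (AlgHom.id 𝕜 R) (τ'.diff (active x k p.trunc p.final) * ↑u⁻¹)
  · simp [← hu]

theorem samePoint_refl
    (hx : (MvPolynomial.aeval x : MvPolynomial (Fin 2) 𝕜 →ₐ[𝕜] A).toRingHom.Etale)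
    (p : Word k) (q : ChartPt 𝕜 A k R) : SamePoint x k R p q p q := by
  induction k generalizing R with
  | zero => rw [samePoint_zero]
  | succ k ih =>
    rw [samePoint_succ]
    obtain ⟨τ, hτ, h⟩ := exists_generator hx p q
    exact ⟨ih _ _, τ, hτ, τ, hτ, by simp [h], by simp [h], ih _ _⟩

theorem SamePoint.symm {p p' : Word k} {q q' : ChartPt 𝕜 A k R}
    (h : SamePoint x k R p q p' q') : SamePoint x k R p' q' p q := by
  induction k generalizing R with
  | zero => rw [samePoint_zero] at h ⊢; exact h.symm
  | succ k ih =>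
    rw [samePoint_succ] at h ⊢
    obtain ⟨h₁, τ, hτ, τ', hτ', hu, hu', hs⟩ := h
    exact ⟨ih h₁, τ', hτ', τ, hτ, hu', hu, ih hs⟩

/-- A common generator with dr a unit determines the slope n = dd/dr. The induction is over all
rings, since it is applied to the generators as R[ε]-points. -/
theorem SamePoint.eq {p : Word k} {q q' : ChartPt 𝕜 A k R}
    (h : SamePoint x k R p q p q') : q = q' := by
  induction k generalizing R with
  | zero => rwa [samePoint_zero] at h
  | succ k ih =>
    rw [samePoint_succ] at h
    obtain ⟨h₁, τ, hτ, τ', hτ', hu, hu', hs⟩ := h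
    obtain rfl := ih hs
    refine ChartPt.ext_succ (ih h₁) (hu.mul_left_injective ?_)
    exact hτ.2.2.symm.trans hτ'.2.2

theorem SamePoint.trans
    (hx : (MvPolynomial.aeval x : MvPolynomial (Fin 2) 𝕜 →ₐ[𝕜] A).toRingHom.Etale)
    {p p' p'' : Word k} {q q' q'' : ChartPt 𝕜 A k R}
    (h : SamePoint x k R p q p' q') (h' : SamePoint x k R p' q' p'' q'') :
    SamePoint x k R p q p'' q'' := by
  induction k generalizing R with
  | zero => rw [samePoint_zero] at *; exact h.trans h'
  | succ k ih =>
    rw [samePoint_succ] at h h' ⊢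
    obtain ⟨h₁, τ, hτ, τ', hτ', hu, hu', hs⟩ := h
    obtain ⟨h₂, σ, hσ, σ', hσ', hv, hv', ht⟩ := h'
    -- The two generators chosen on the middle line differ by a unit; rescaling the outer generator
    -- by it makes the two identifications composable.
    obtain ⟨c, rfl⟩ := line_eq_scale hx hτ' hσ hu'
    have hc : IsUnit c := by
      rw [ChartPt.tmap_diff] at hv
      exact isUnit_of_mul_isUnit_left hv
    refine ⟨ih h₁ h₂, τ.tmap (AlgHom.id 𝕜 R) c, ?_, σ', hσ', ?_, hv', ih (hs.map _) ht⟩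
    · simpa using tmap_mem_line hτ (AlgHom.id 𝕜 R) c
    · rw [ChartPt.tmap_diff]; exact hc.mul hu

/-- Being the same point is an equivalence relation, so it describes equality in `S(k)`. -/
theorem Space.mk_eq_mk
    (hx : (MvPolynomial.aeval x : MvPolynomial (Fin 2) 𝕜 →ₐ[𝕜] A).toRingHom.Etale)
    {p p' : Word k} {q q' : ChartPt 𝕜 A k 𝕜} :
    Space.mk x p q = Space.mk x p' q' ↔ SamePoint x k 𝕜 p q p' q' := by
  refine ⟨fun h => ?_, fun h => Quot.sound h⟩
  have := Quot.eqvGen_exact h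
  refine (Equivalence.eqvGen_iff ⟨?_, ?_, ?_⟩).1 this
  · exact fun a => samePoint_refl hx _ _
  · exact fun h => h.symm
  · exact fun h h' => h.trans hx h'

theorem Space.mk_injective
    (hx : (MvPolynomial.aeval x : MvPolynomial (Fin 2) 𝕜 →ₐ[𝕜] A).toRingHom.Etale) (p : Word k) :
    Function.Injective (Space.mk (𝕜 := 𝕜) x p) :=
  fun _ _ h => ((Space.mk_eq_mk hx).1 h).eq

theorem Space.exists_mk (P : Space 𝕜 x k) : ∃ p q, P = Space.mk x p q := by
  induction P using Quot.ind with
  | mk a => exact ⟨a.1, a.2, rfl⟩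

theorem Space.proj_mk (p : Word (k + 1)) (q : ChartPt 𝕜 A (k + 1) 𝕜) :
    (Space.mk x p q).proj = Space.mk x p.trunc q.proj := rfl

theorem isClosed_of_forall_inChart {Z : Set (Space 𝕜 x k)}
    (h : ∀ p, ∃ s : Set (ChartRing A k), inChart p Z = {q | ∀ f ∈ s, q f = 0}) : IsClosed Z := by
  refine isClosed_iSup_iff.2 fun p => isClosed_coinduced.2 ?_
  obtain ⟨s, hs⟩ := h p
  refine isClosed_induced_iff.2 ⟨PrimeSpectrum.zeroLocus s, PrimeSpectrum.isClosed_zeroLocus s, ?_⟩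
  ext q
  change s ⊆ RingHom.ker q ↔ q ∈ inChart p Z
  rw [hs]
  rfl

theorem exists_of_isOpen {U : Set (Space 𝕜 x k)} (hU : IsOpen U) {p : Word k}
    {q : ChartPt 𝕜 A k 𝕜} (hq : q ∈ inChart p U) :
    ∃ f : ChartRing A k, q f ≠ 0 ∧ ∀ q' : ChartPt 𝕜 A k 𝕜, q' f ≠ 0 → q' ∈ inChart p U := by
  have h := isOpen_coinduced.1 (isOpen_iSup_iff.1 hU p)
  obtain ⟨V, hV, hVU⟩ := isOpen_induced_iff.1 h
  have hqV : (⟨RingHom.ker q, RingHom.ker_isPrime q⟩ : PrimeSpectrum (ChartRing A k)) ∈ V := by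
    have : q ∈ inChart p U := hq
    exact (Set.ext_iff.1 hVU q).2 this
  obtain ⟨_, ⟨f, rfl⟩, hf, hfV⟩ :=
    PrimeSpectrum.isTopologicalBasis_basic_opens.exists_subset_of_mem_open hqV hV
  refine ⟨f, hf, fun q' hq' => ?_⟩
  change q' ∈ Space.mk x p ⁻¹' U
  exact (Set.ext_iff.1 hVU q').1 (hfV hq')

end SamePoint

/-! ### Reducedness and the Nullstellensatz -/

section Reducedness

open scoped TensorProduct

/-- Flatness embeds B into Frac(D) ⊗ B, which is étale over a field and hence reduced. -/
theorem isReduced_of_etale (D B : Type*) [CommRing D] [IsDomain D] [CommRing B] [Algebra D B]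
    [Algebra.Etale D B] : IsReduced B := by
  have : IsReduced (FractionRing D ⊗[D] B) :=
    Algebra.FormallyUnramified.isReduced_of_field (FractionRing D) _
  have : Module.Flat D B := inferInstance
  exact isReduced_of_injective (Algebra.TensorProduct.includeRight : B →ₐ[D] FractionRing D ⊗[D] B)
    (Algebra.TensorProduct.includeRight_injective (IsFractionRing.injective D (FractionRing D)))

theorem isReduced_quotient_of_etale (D B : Type*) [CommRing D] [CommRing B] [Algebra D B]
    [Algebra.Etale D B] (I : Ideal D) [I.IsPrime] :
    IsReduced (B ⧸ I.map (algebraMap D B)) := by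
  have : IsReduced ((D ⧸ I) ⊗[D] B) := isReduced_of_etale (D ⧸ I) _
  exact isReduced_of_injective (Algebra.TensorProduct.quotIdealMapEquivQuotTensor B I)
    (AlgEquiv.injective _)

variable {𝕜 : Type u} [Field 𝕜] {A : Type v} [CommRing A] [Algebra 𝕜 A]

theorem exists_point_of_not_isNilpotent [IsAlgClosed 𝕜] [Algebra.FiniteType 𝕜 A] {f : A}
    (hf : ¬ IsNilpotent f) : ∃ q : A →ₐ[𝕜] 𝕜, q f ≠ 0 := by
  have : IsJacobsonRing A := isJacobsonRing_of_finiteType (A := 𝕜)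
  have h : f ∉ (nilradical A).jacobson := by
    rw [IsJacobsonRing.out this (I := nilradical A) (Ideal.radical_isRadical _)]
    exact hf
  rw [Ideal.jacobson, Submodule.mem_sInf] at h
  push Not at h
  obtain ⟨m, ⟨-, hm⟩, hfm⟩ := h
  let : Field (A ⧸ m) := Ideal.Quotient.field m
  have : Module.Finite 𝕜 (A ⧸ m) := finite_of_finite_type_of_isJacobsonRing 𝕜 (A ⧸ m)
  let e := AlgEquiv.ofBijective (Algebra.ofId 𝕜 (A ⧸ m))
    IsAlgClosed.algebraMap_bijective_of_isIntegral
  refine ⟨e.symm.toAlgHom.comp (Ideal.Quotient.mkₐ 𝕜 m), fun h => hfm ?_⟩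
  have : e.symm (Ideal.Quotient.mk m f) = 0 := h
  rw [map_eq_zero_iff _ e.symm.injective] at this
  exact Ideal.Quotient.eq_zero_iff_mem.1 this

theorem eq_zero_of_forall_point [IsAlgClosed 𝕜] [Algebra.FiniteType 𝕜 A] [IsReduced A] {f : A}
    (hf : ∀ q : A →ₐ[𝕜] 𝕜, q f = 0) : f = 0 := by
  by_contra h
  obtain ⟨q, hq⟩ := exists_point_of_not_isNilpotent (𝕜 := 𝕜) (f := f)
    (fun hn => h hn.eq_zero)
  exact hq (hf q)

/-- The Nullstellensatz for a radical ideal. -/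
theorem mem_of_forall_point [IsAlgClosed 𝕜] [Algebra.FiniteType 𝕜 A] {I : Ideal A}
    (hI : I.IsRadical) {f : A} (hf : ∀ q : A →ₐ[𝕜] 𝕜, (∀ g ∈ I, q g = 0) → q f = 0) : f ∈ I := by
  have : IsReduced (A ⧸ I) := (Ideal.isRadical_iff_quotient_reduced I).1 hI
  rw [← Ideal.Quotient.eq_zero_iff_mem]
  refine eq_zero_of_forall_point (𝕜 := 𝕜) fun q => ?_
  exact hf (q.comp (Ideal.Quotient.mkₐ 𝕜 I)) fun g hg => by
    change q (Ideal.Quotient.mk I g) = 0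
    rw [Ideal.Quotient.eq_zero_iff_mem.2 hg, map_zero]

variable {x : Fin 2 → A}

theorem finiteType_of_etale
    (hx : (MvPolynomial.aeval x : MvPolynomial (Fin 2) 𝕜 →ₐ[𝕜] A).toRingHom.Etale) :
    Algebra.FiniteType 𝕜 A := by
  let : Algebra (MvPolynomial (Fin 2) 𝕜) A :=
    (MvPolynomial.aeval x : MvPolynomial (Fin 2) 𝕜 →ₐ[𝕜] A).toRingHom.toAlgebra
  have : Algebra.Etale (MvPolynomial (Fin 2) 𝕜) A := hx
  have : IsScalarTower 𝕜 (MvPolynomial (Fin 2) 𝕜) A := IsScalarTower.of_algebraMap_eq fun r =>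
    ((MvPolynomial.aeval x : MvPolynomial (Fin 2) 𝕜 →ₐ[𝕜] A).commutes r).symm
  exact Algebra.FiniteType.trans (S := MvPolynomial (Fin 2) 𝕜) inferInstance inferInstance

theorem isReduced_of_coords
    (hx : (MvPolynomial.aeval x : MvPolynomial (Fin 2) 𝕜 →ₐ[𝕜] A).toRingHom.Etale) :
    IsReduced A := by
  let : Algebra (MvPolynomial (Fin 2) 𝕜) A :=
    (MvPolynomial.aeval x : MvPolynomial (Fin 2) 𝕜 →ₐ[𝕜] A).toRingHom.toAlgebra
  have : Algebra.Etale (MvPolynomial (Fin 2) 𝕜) A := hx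
  exact isReduced_of_etale (MvPolynomial (Fin 2) 𝕜) A

/-- The polynomial has degree one in the second variable, and its coefficients, the first variable
and the unit −t, are coprime. -/
theorem isPrime_span_mul_sub {t : 𝕜} (ht : t ≠ 0) :
    (Ideal.span {X 0 * X 1 - C t} : Ideal (MvPolynomial (Fin 2) 𝕜)).IsPrime := by
  have h0 : (C (-t) : MvPolynomial (Fin 2) 𝕜) ≠ 0 := by simpa using ht
  have hirr : Irreducible (X 0 * X 1 + C (-t) : MvPolynomial (Fin 2) 𝕜) := by
    refine MvPolynomial.irreducible_mul_X_add _ _ 1 (MvPolynomial.X_ne_zero 0) (by simp) (by simp) ?_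
    intro d _ hd
    exact isUnit_of_dvd_unit hd ((isUnit_iff_ne_zero.2 (neg_ne_zero.2 ht)).map C)
  have h : (X 0 * X 1 - C t : MvPolynomial (Fin 2) 𝕜) = X 0 * X 1 + C (-t) := by
    simp [sub_eq_add_neg]
  rw [h, Ideal.span_singleton_prime hirr.ne_zero]
  exact hirr.prime

theorem isReduced_hyperbola
    (hx : (MvPolynomial.aeval x : MvPolynomial (Fin 2) 𝕜 →ₐ[𝕜] A).toRingHom.Etale)
    {t : 𝕜} (ht : t ≠ 0) :
    IsReduced (A ⧸ Ideal.span {x 0 * x 1 - algebraMap 𝕜 A t}) := by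
  let f : MvPolynomial (Fin 2) 𝕜 →ₐ[𝕜] A := MvPolynomial.aeval x
  let : Algebra (MvPolynomial (Fin 2) 𝕜) A := f.toRingHom.toAlgebra
  have : Algebra.Etale (MvPolynomial (Fin 2) 𝕜) A := hx
  have hp := isPrime_span_mul_sub ht
  have := isReduced_quotient_of_etale (MvPolynomial (Fin 2) 𝕜) A (Ideal.span {X 0 * X 1 - C t})
  have e : (Ideal.span {X 0 * X 1 - C t}).map (algebraMap (MvPolynomial (Fin 2) 𝕜) A) =
      Ideal.span {x 0 * x 1 - algebraMap 𝕜 A t} := by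
    rw [Ideal.map_span, Set.image_singleton]
    congr 2
    change f _ = _
    simp [f]
  rwa [e] at this

/-- The coordinates generate the maximal ideal of their only common zero. -/
theorem ker_eq_span [IsAlgClosed 𝕜]
    (hx : (MvPolynomial.aeval x : MvPolynomial (Fin 2) 𝕜 →ₐ[𝕜] A).toRingHom.Etale)
    {o : A →ₐ[𝕜] 𝕜} (ho : ∀ b : A →ₐ[𝕜] 𝕜, (∀ i, b (x i) = 0) ↔ b = o) {a : A} (ha : o a = 0) :
    a ∈ Ideal.span (Set.range x) := by
  let f : MvPolynomial (Fin 2) 𝕜 →ₐ[𝕜] A := MvPolynomial.aeval x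
  let : Algebra (MvPolynomial (Fin 2) 𝕜) A := f.toRingHom.toAlgebra
  have : Algebra.Etale (MvPolynomial (Fin 2) 𝕜) A := hx
  have := finiteType_of_etale hx
  let m : Ideal (MvPolynomial (Fin 2) 𝕜) := RingHom.ker (MvPolynomial.aeval (fun _ => (0 : 𝕜)) :
    MvPolynomial (Fin 2) 𝕜 →ₐ[𝕜] 𝕜)
  have hm : m.IsPrime := RingHom.ker_isPrime _
  have hm' : m = Ideal.span (Set.range X) := by
    refine le_antisymm (fun g hg => ?_) (Ideal.span_le.2 ?_)
    · have key (g : MvPolynomial (Fin 2) 𝕜) :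
          g - C (MvPolynomial.aeval (fun _ => (0 : 𝕜)) g) ∈ Ideal.span (Set.range X) := by
        induction g using MvPolynomial.induction_on with
        | C a => simp
        | add p q hp hq => simpa [add_sub_add_comm] using add_mem hp hq
        | mul_X p i hp => simpa using Ideal.mul_mem_left _ p (Ideal.subset_span (Set.mem_range_self i))
      have h0 : MvPolynomial.aeval (fun _ => (0 : 𝕜)) g = 0 := hg
      simpa [h0] using key g
    · rintro _ ⟨i, rfl⟩
      simp [m]
  have e : m.map (algebraMap (MvPolynomial (Fin 2) 𝕜) A) = Ideal.span (Set.range x) := by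
    rw [hm', Ideal.map_span, ← Set.range_comp]
    congr 2
    ext i
    change f _ = _
    simp [f]
  -- The fibre of the étale map over the origin is reduced, so (x₁, x₂) is radical and is determined
  -- by its only zero `o`.
  have hr := isReduced_quotient_of_etale (MvPolynomial (Fin 2) 𝕜) A m
  rw [e] at hr
  refine mem_of_forall_point (𝕜 := 𝕜) ((Ideal.isRadical_iff_quotient_reduced _).2 hr) fun q hq => ?_
  rw [(ho q).1 fun i => hq _ (Ideal.subset_span ⟨i, rfl⟩), ha]

/-- One of the coordinates is not a multiple of the other. -/
theorem coord_not_mem_span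
    (hx : (MvPolynomial.aeval x : MvPolynomial (Fin 2) 𝕜 →ₐ[𝕜] A).toRingHom.Etale)
    {o : A →ₐ[𝕜] 𝕜} (ho : ∀ i, o (x i) = 0) {i j : Fin 2} (hij : i ≠ j) :
    x i ∉ Ideal.span {x j} := by
  intro h
  obtain ⟨a, ha⟩ := Ideal.mem_span_singleton'.1 h
  -- A tangent vector at `o` with dxᵢ = 1 and dxⱼ = 0 kills every multiple of xⱼ, as xⱼ also
  -- vanishes at `o`.
  obtain ⟨v, hv, hc⟩ := exists_tangent hx o fun l => if l = i then 1 else 0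
  have h1 := congrArg TrivSqZeroExt.snd (congrArg v ha)
  rw [map_mul, TrivSqZeroExt.snd_mul, hc, hc, hv, hv, ho] at h1
  simp [hij.symm] at h1

theorem coord_ne
    (hx : (MvPolynomial.aeval x : MvPolynomial (Fin 2) 𝕜 →ₐ[𝕜] A).toRingHom.Etale)
    {o : A →ₐ[𝕜] 𝕜} (ho : ∀ i, o (x i) = 0) {i j : Fin 2} (hij : i ≠ j) : x i ≠ x j := fun h =>
  coord_not_mem_span hx ho hij (h ▸ Ideal.subset_span rfl)

end Reducedness

/-! ### Torus weights of the active coordinates -/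

section Weights

/-- The absolute values of the weights of the active coordinates under the torus action
`(x₁, x₂) ↦ (c x₁, c⁻¹ x₂)`. -/
def weight : (k : ℕ) → Word k → Fin 2 → ℕ
  | 0, _, _ => 1
  | k + 1, p, i =>
      if i = p.final then weight k p.trunc i else weight k p.trunc 0 + weight k p.trunc 1

theorem weight_pos {k : ℕ} (p : Word k) (i : Fin 2) : 0 < weight k p i := by
  induction k generalizing i with
  | zero => simp [weight]
  | succ k ih =>
    rw [weight]
    split_ifs
    · exact ih _ _
    · exact Nat.add_pos_left (ih _ _) _

theorem weight_final {k : ℕ} (p : Word (k + 1)) :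
    weight (k + 1) p p.final = weight k p.trunc p.final := by simp [weight]

/-- The weight of n = dd/dr is the difference of the signed weights of d and r, which have opposite
signs; hence the absolute values add. -/
theorem weight_rev_final {k : ℕ} (p : Word (k + 1)) :
    weight (k + 1) p (Fin.rev p.final) =
      weight k p.trunc p.final + weight k p.trunc (Fin.rev p.final) := by
  rw [weight, if_neg (rev_ne _)]
  generalize p.final = s
  revert s
  rw [Fin.forall_fin_two]
  exact ⟨rfl, add_comm _ _⟩

/-- α is the weight of the retained coordinate and β that of the deactivated one. If the letter
repeats, r stays and the previous n (weight α + β) is deactivated; if it changes, these two exchange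
roles. -/
theorem nodeCoeff_succ {k : ℕ} (p : Word (k + 1)) :
    nodeCoeff (k + 1) p = (weight k p.trunc p.final, weight k p.trunc (Fin.rev p.final)) := by
  induction k with
  | zero => simp [nodeCoeff, weight]
  | succ k ih =>
    rw [nodeCoeff, ih]
    rcases eq_or_eq_rev p.final p.trunc.final with h | h
    · simp only [h, if_true, weight_final, weight_rev_final]
    · simp only [h, if_neg (rev_ne _), Fin.rev_rev, weight_final, weight_rev_final]

end Weights

/-! ### Prolonged hyperbolas as graphs over the base -/

section Hyperbola

variable {A : Type v} [CommRing A] {k : ℕ}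

theorem nodeBinomial_succ (x : Fin 2 → A) (p : Word (k + 1)) :
    nodeBinomial x (k + 1) p =
      (weight k p.trunc p.final : ChartRing A (k + 1)) *
        (X (Fin.last k) * pull k (active x k p.trunc p.final)) +
      (weight k p.trunc (Fin.rev p.final) : ChartRing A (k + 1)) *
        pull k (active x k p.trunc (Fin.rev p.final)) := by
  rw [nodeBinomial, nodeCoeff_succ]

/-- The node binomials of positive level. -/
def posBinomials (x : Fin 2 → A) : (k : ℕ) → Word k → Set (ChartRing A k)
  | 0, _ => ∅
  | k + 1, p => insert (nodeBinomial x (k + 1) p) (pull k '' posBinomials x k p.trunc)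

/-- Separates the equation x₁x₂ = 0 of the central fibre from the binomials that cut out the total
space. -/
theorem nodeBinomials_eq (x : Fin 2 → A) (p : Word k) :
    nodeBinomials x k p = insert (C (x 0 * x 1)) (posBinomials x k p) := by
  induction k with
  | zero => simp [nodeBinomials, nodeBinomial, posBinomials]
  | succ k ih =>
    rw [nodeBinomials, posBinomials, ih, Set.image_insert_eq, pull_C, Set.insert_comm]

variable {𝕜 : Type u} [Field 𝕜] [Algebra 𝕜 A]
  {R : Type w} [CommRing R] [Algebra 𝕜 R] {R' : Type w'} [CommRing R'] [Algebra 𝕜 R']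
  {x : Fin 2 → A}

/-- The point `q` lies on the prolongation of a hyperbola `x₁ x₂ = t` with `t` invertible. -/
def OnHyperbola (x : Fin 2 → A) (p : Word k) (q : ChartPt 𝕜 A k R) : Prop :=
  IsUnit (q (C (x 0 * x 1))) ∧ ∀ f ∈ posBinomials x k p, q f = 0

theorem onHyperbola_zero {p : Word 0} {q : ChartPt 𝕜 A 0 R} :
    OnHyperbola x p q ↔ IsUnit (q (C (x 0 * x 1))) := by simp [OnHyperbola, posBinomials]

theorem onHyperbola_succ {p : Word (k + 1)} {q : ChartPt 𝕜 A (k + 1) R} :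
    OnHyperbola x p q ↔ OnHyperbola x p.trunc q.proj ∧
      (weight k p.trunc p.final : R) *
        (q (X (Fin.last k)) * q.proj (active x k p.trunc p.final)) +
      (weight k p.trunc (Fin.rev p.final) : R) *
        q.proj (active x k p.trunc (Fin.rev p.final)) = 0 := by
  rw [OnHyperbola, OnHyperbola, posBinomials, Set.forall_mem_insert, Set.forall_mem_image,
    nodeBinomial_succ]
  simp only [ChartPt.proj_apply, pull_C, map_add, map_mul, map_natCast]
  tauto

theorem OnHyperbola.map {p : Word k} {q : ChartPt 𝕜 A k R} (h : OnHyperbola x p q)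
    (φ : R →ₐ[𝕜] R') : OnHyperbola x p (φ.comp q) :=
  ⟨h.1.map φ, fun f hf => by rw [AlgHom.comp_apply, h.2 f hf, map_zero]⟩

theorem isUnit_weight (𝕜 : Type u) [Field 𝕜] [CharZero 𝕜] (R : Type w) [CommRing R] [Algebra 𝕜 R] (p : Word k)
    (i : Fin 2) : IsUnit (weight k p i : R) := by
  have : IsUnit (weight k p i : 𝕜) :=
    isUnit_iff_ne_zero.2 (Nat.cast_ne_zero.2 (weight_pos p i).ne')
  simpa using this.map (algebraMap 𝕜 R)

/-- From w(r)·n·r = −w(d)·d with d and the weights invertible, n is invertible. -/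
theorem OnHyperbola.isUnit_active [CharZero 𝕜] {p : Word k} {q : ChartPt 𝕜 A k R}
    (h : OnHyperbola x p q) (i : Fin 2) : IsUnit (q (active x k p i)) := by
  induction k generalizing i with
  | zero =>
    have h1 := h.1
    rw [C.map_mul, map_mul, IsUnit.mul_iff] at h1
    revert i
    rw [Fin.forall_fin_two]
    exact h1
  | succ k ih =>
    rw [onHyperbola_succ] at h
    revert i
    rw [forall_fin_two_iff p.final, active_final, active_rev_final]
    refine ⟨ih h.1 _, ?_⟩
    have h1 : IsUnit (-((weight k p.trunc (Fin.rev p.final) : R) *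
        q.proj (active x k p.trunc (Fin.rev p.final)))) :=
      ((isUnit_weight 𝕜 R _ _).mul (ih h.1 _)).neg
    rw [← eq_neg_of_add_eq_zero_left h.2] at h1
    exact isUnit_of_mul_isUnit_left (isUnit_of_mul_isUnit_right h1)

/-- Since w(r)·r is a unit, each node binomial can be solved for its new coordinate;
`exists_onHyperbola` is the existence half. -/
theorem OnHyperbola.unique [CharZero 𝕜] {p : Word k} {q q' : ChartPt 𝕜 A k R}
    (h : OnHyperbola x p q) (h' : OnHyperbola x p q') (hb : q.base = q'.base) : q = q' := by
  induction k with
  | zero => exact ChartPt.ext_zero hb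
  | succ k ih =>
    rw [onHyperbola_succ] at h h'
    have hproj : q.proj = q'.proj := by
      refine ih h.1 h'.1 (AlgHom.ext fun a => ?_)
      simpa [ChartPt.proj_apply] using AlgHom.congr_fun hb a
    refine ChartPt.ext_succ hproj ?_
    have hu := (isUnit_weight 𝕜 R p.trunc p.final).mul (h'.1.isUnit_active p.final)
    refine hu.mul_left_injective ?_
    have h1 := h.2
    rw [hproj] at h1
    change q _ * _ = q' _ * _
    linear_combination h1 - h'.2

theorem exists_onHyperbola [CharZero 𝕜] (p : Word k) (b : A →ₐ[𝕜] R)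
    (hb : IsUnit (b (x 0 * x 1))) :
    ∃ q : ChartPt 𝕜 A k R, q.base = b ∧ OnHyperbola x p q := by
  induction k with
  | zero =>
    refine ⟨ChartPt.ofBase b, AlgHom.ext fun a => by simp, onHyperbola_zero.2 ?_⟩
    rwa [ChartPt.ofBase_C]
  | succ k ih =>
    obtain ⟨z, hzb, hz⟩ := ih p.trunc
    obtain ⟨c, hc⟩ := (isUnit_weight 𝕜 R p.trunc p.final).mul (hz.isUnit_active p.final)
    refine ⟨z.extend (-(↑c⁻¹ * ((weight k p.trunc (Fin.rev p.final) : R) *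
      z (active x k p.trunc (Fin.rev p.final))))), ?_, ?_⟩
    · rw [← hzb]
      refine AlgHom.ext fun a => ?_
      rw [ChartPt.base_apply, ChartPt.base_apply, ← pull_C, ChartPt.extend_pull]
    · rw [onHyperbola_succ, ChartPt.proj_extend, ChartPt.extend_last]
      refine ⟨hz, ?_⟩
      linear_combination (-(↑c⁻¹ * ((weight k p.trunc (Fin.rev p.final) : R) *
        z (active x k p.trunc (Fin.rev p.final))))) * (-hc) -
        ((weight k p.trunc (Fin.rev p.final) : R) *
          z (active x k p.trunc (Fin.rev p.final))) * c.inv_mul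

/-- The signs of the weights. -/
def sgn (i : Fin 2) : ℤ := if i = 0 then 1 else -1

theorem sgn_rev (i : Fin 2) : sgn (Fin.rev i) = -sgn i := by revert i; decide

theorem sgn_sq (i : Fin 2) : sgn i * sgn i = 1 := by revert i; decide

theorem isUnit_sgn (R : Type w) [CommRing R] (i : Fin 2) : IsUnit (sgn i : R) :=
  IsUnit.of_mul_eq_one (sgn i : R) (by exact_mod_cast congrArg (Int.cast (R := R)) (sgn_sq i))

/-- The logarithmic tangent vector of a hyperbola acts diagonally on the active coordinates and
is focal. -/
theorem OnHyperbola.isFocal [CharZero 𝕜] {p : Word k} {τ : ChartPt 𝕜 A k (DualNumber R)}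
    (h : OnHyperbola x p τ)
    (hx : ∀ i, (τ (C (x i))).snd = sgn i * (τ (C (x i))).fst) :
    IsFocal x k p τ ∧ ∀ i, τ.diff (active x k p i) =
      sgn i * weight k p i * τ.foot (active x k p i) := by
  induction k with
  | zero => exact ⟨isFocal_zero _ _ _, fun i => by
      simpa [weight, active, ChartPt.diff_def, ChartPt.foot_apply] using hx i⟩
  | succ k ih =>
    rw [onHyperbola_succ] at h
    obtain ⟨hf, hd⟩ := ih h.1 (by simpa [ChartPt.proj_apply] using hx)
    have hw := isUnit_weight 𝕜 R p.trunc p.final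
    have hr : IsUnit (τ.proj.foot (active x k p.trunc p.final)) :=
      (h.1.isUnit_active p.final).map (TrivSqZeroExt.fstHom 𝕜 R R)
    -- `h0` is the node binomial at the foot and `h1` its derivative along `τ`. The first gives the
    -- focal equation; combining the two and cancelling w(r)·r gives the eigenvalue of the new
    -- coordinate.
    have h0 := congrArg TrivSqZeroExt.fst h.2
    have h1 := congrArg TrivSqZeroExt.snd h.2
    simp only [TrivSqZeroExt.fst_add, TrivSqZeroExt.fst_mul, TrivSqZeroExt.fst_natCast,
      TrivSqZeroExt.fst_zero, TrivSqZeroExt.snd_add, TrivSqZeroExt.snd_mul,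
      TrivSqZeroExt.snd_natCast, TrivSqZeroExt.snd_zero, smul_zero, add_zero,
      smul_eq_mul, MulOpposite.smul_eq_mul_unop, MulOpposite.unop_op,
      ← ChartPt.foot_apply, ← ChartPt.diff_def, hd, sgn_rev, Int.cast_neg] at h0 h1
    refine ⟨isFocal_succ.2 ⟨hf, ?_⟩, ?_⟩
    · rw [hd, hd, sgn_rev]
      push_cast
      linear_combination (-(sgn p.final : R)) * h0
    · rw [forall_fin_two_iff p.final, active_final, active_rev_final, weight_final,
        weight_rev_final, sgn_rev]
      refine ⟨hd p.final, (hw.mul hr).mul_left_injective ?_⟩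
      push_cast
      linear_combination h1 + (sgn p.final : R) * weight k p.trunc (Fin.rev p.final) * h0

/-- This is x₁∂₁ − x₂∂₂, which annihilates x₁x₂. -/
theorem exists_log_tangent
    (hx : (MvPolynomial.aeval x : MvPolynomial (Fin 2) 𝕜 →ₐ[𝕜] A).toRingHom.Etale)
    (b : A →ₐ[𝕜] R) : ∃ v : A →ₐ[𝕜] DualNumber R, (∀ a, (v a).fst = b a) ∧
      (∀ i, (v (x i)).snd = sgn i * b (x i)) ∧
      v (x 0 * x 1) = TrivSqZeroExt.inl (b (x 0 * x 1)) := by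
  obtain ⟨v, hv, hc⟩ := exists_tangent hx b fun i => sgn i * b (x i)
  refine ⟨v, hv, hc, ?_⟩
  ext
  · rw [hv]; simp
  · rw [map_mul, TrivSqZeroExt.snd_mul, hc, hc, hv, hv]
    simp [sgn]

/-- The logarithmic tangent vector at a point of a prolonged hyperbola. -/
theorem exists_log_tangent_lift [CharZero 𝕜]
    {p : Word k} {z : ChartPt 𝕜 A k R} (hz : OnHyperbola x p z) {v : A →ₐ[𝕜] DualNumber R}
    (hv : ∀ a, (v a).fst = z.base a) (hc : ∀ i, (v (x i)).snd = sgn i * z.base (x i)) :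
    ∃ τ : ChartPt 𝕜 A k (DualNumber R), τ.base = v ∧ OnHyperbola x p τ ∧ τ.foot = z ∧
      IsFocal x k p τ ∧
      ∀ i, τ.diff (active x k p i) = sgn i * weight k p i * z (active x k p i) := by
  obtain ⟨τ, hτb, hτ⟩ := exists_onHyperbola p v (x := x)
    (by rw [TrivSqZeroExt.isUnit_iff_isUnit_fst, hv]; exact hz.1)
  have hfoot : τ.foot = z := by
    refine (hτ.map (TrivSqZeroExt.fstHom 𝕜 R R)).unique hz (AlgHom.ext fun a => ?_)
    rw [← hv, ← hτb]; rfl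
  have hdiag := hτ.isFocal fun i => by
    rw [← ChartPt.base_apply, hτb, hc, hv]
  exact ⟨τ, hτb, hτ, hfoot, hdiag.1, fun i => by rw [hdiag.2, hfoot]⟩

/-- For a diagonal vector the slope equation dd = n dr is, up to sign, the node binomial. -/
theorem OnHyperbola.mem_line {p : Word (k + 1)} {q : ChartPt 𝕜 A (k + 1) R}
    (h : OnHyperbola x p q) {τ : ChartPt 𝕜 A k (DualNumber R)} (hfoot : τ.foot = q.proj)
    (hf : IsFocal x k p.trunc τ)
    (hd : ∀ i, τ.diff (active x k p.trunc i) =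
      sgn i * weight k p.trunc i * q.proj (active x k p.trunc i)) : τ ∈ line x p q := by
  refine ⟨hfoot, hf, ?_⟩
  have h2 := (onHyperbola_succ.1 h).2
  rw [hd, hd, sgn_rev]
  push_cast
  linear_combination (-(sgn p.final : R)) * h2

/-- Points of prolonged hyperbolas over the same point of `U` agree. -/
theorem OnHyperbola.samePoint [CharZero 𝕜]
    (hx : (MvPolynomial.aeval x : MvPolynomial (Fin 2) 𝕜 →ₐ[𝕜] A).toRingHom.Etale)
    {p p' : Word k} {q q' : ChartPt 𝕜 A k R} (h : OnHyperbola x p q) (h' : OnHyperbola x p' q')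
    (hb : q.base = q'.base) : SamePoint x k R p q p' q' := by
  induction k generalizing R with
  | zero => rw [samePoint_zero]; exact ChartPt.ext_zero hb
  | succ k ih =>
    have h1 := (onHyperbola_succ.1 h).1
    have h1' := (onHyperbola_succ.1 h').1
    have hb1 : q.proj.base = q'.proj.base := AlgHom.ext fun a => by
      simpa [ChartPt.proj_apply] using AlgHom.congr_fun hb a
    -- One logarithmic vector on `U` lifts to both charts as an R[ε]-point of a prolonged hyperbola,
    -- so the induction hypothesis over R[ε] identifies the generators of the two lines.
    obtain ⟨v, hv, hc, -⟩ := exists_log_tangent hx q.proj.base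
    obtain ⟨τ, hτb, hτ, hfoot, hf, hd⟩ := exists_log_tangent_lift h1 hv hc
    obtain ⟨τ', hτb', hτ', hfoot', hf', hd'⟩ :=
      exists_log_tangent_lift h1' (by rwa [← hb1]) (by rwa [← hb1])
    have hu (p : Word k) (z : ChartPt 𝕜 A k R) (hz : OnHyperbola x p z) (i : Fin 2) :
        IsUnit (sgn i * weight k p i * z (active x k p i)) :=
      ((isUnit_sgn R _).mul (isUnit_weight 𝕜 R _ _)).mul (hz.isUnit_active i)
    rw [samePoint_succ]
    exact ⟨ih h1 h1' hb1, τ, h.mem_line hfoot hf hd, τ', h'.mem_line hfoot' hf' hd',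
      hd p.final ▸ hu _ _ h1 _, hd' p'.final ▸ hu _ _ h1' _, ih hτ hτ' (hτb.trans hτb'.symm)⟩

end Hyperbola

/-! ### Prolonging hyperbolas; the ideal of the family -/

section HyperbolaProlongation

variable {𝕜 : Type u} [Field 𝕜] {A : Type v} [CommRing A] [Algebra 𝕜 A] {x : Fin 2 → A} {k : ℕ}

theorem mem_inChart {p : Word k} {Z : Set (Space 𝕜 x k)} {q : ChartPt 𝕜 A k 𝕜} :
    q ∈ inChart p Z ↔ Space.mk x p q ∈ Z := Iff.rfl

theorem mem_idealOf {p : Word k} {Z : Set (Space 𝕜 x k)} {f : ChartRing A k} :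
    f ∈ idealOf p Z ↔ ∀ q ∈ inChart p Z, q f = 0 := by
  simp only [idealOf, Ideal.mem_iInf, RingHom.mem_ker]

theorem mem_tangentSpace {p : Word k} {Z : Set (Space 𝕜 x k)} {q : ChartPt 𝕜 A k 𝕜}
    {τ : ChartPt 𝕜 A k (DualNumber 𝕜)} :
    τ ∈ tangentSpace p Z q ↔ τ.foot = q ∧ ∀ f ∈ idealOf p Z, τ f = 0 := Iff.rfl

theorem line_injective
    (hx : (MvPolynomial.aeval x : MvPolynomial (Fin 2) 𝕜 →ₐ[𝕜] A).toRingHom.Etale)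
    {p : Word (k + 1)} {q q' : ChartPt 𝕜 A (k + 1) 𝕜} (h : line x p q = line x p q') : q = q' := by
  obtain ⟨τ, hτ, hd⟩ := exists_generator hx p q
  have hτ' : τ ∈ line x p q' := h ▸ hτ
  refine ChartPt.ext_succ (hτ.1.symm.trans hτ'.1) ?_
  have := hτ.2.2.symm.trans hτ'.2.2
  rwa [hd, mul_one, mul_one] at this

/-- The prolongation to level `k` of the hyperbola `x₁ x₂ = t`. -/
def hyperbola (x : Fin 2 → A) (k : ℕ) (t : 𝕜) : Set (Space 𝕜 x k) :=
  {P | ∃ p q, P = Space.mk x p q ∧ OnHyperbola x p q ∧ q (C (x 0 * x 1)) = t}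

/-- The chart `p` contains a hyperbola point over the same base point. It represents the same point
of the space, and within one chart representatives are unique. -/
theorem OnHyperbola.congr [CharZero 𝕜]
    (hx : (MvPolynomial.aeval x : MvPolynomial (Fin 2) 𝕜 →ₐ[𝕜] A).toRingHom.Etale)
    {p p' : Word k} {q q' : ChartPt 𝕜 A k 𝕜} (h : OnHyperbola x p' q')
    (hs : SamePoint x k 𝕜 p q p' q') :
    OnHyperbola x p q ∧ q.base = q'.base := by
  obtain ⟨q'', hb, h''⟩ := exists_onHyperbola p q'.base (by simpa using h.1)
  obtain rfl := (hs.trans hx (h.samePoint hx h'' hb.symm)).eq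
  exact ⟨h'', hb⟩

theorem mem_inChart_hyperbola [CharZero 𝕜]
    (hx : (MvPolynomial.aeval x : MvPolynomial (Fin 2) 𝕜 →ₐ[𝕜] A).toRingHom.Etale)
    {p : Word k} {q : ChartPt 𝕜 A k 𝕜} {t : 𝕜} :
    q ∈ inChart p (hyperbola x k t) ↔ OnHyperbola x p q ∧ q (C (x 0 * x 1)) = t := by
  refine ⟨?_, fun h => ⟨p, q, rfl, h⟩⟩
  rintro ⟨p', q', hP, h', ht⟩
  obtain ⟨h, hb⟩ := h'.congr hx ((Space.mk_eq_mk hx).1 hP)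
  exact ⟨h, by rw [← ht]; exact AlgHom.congr_fun hb _⟩

theorem isClosed_hyperbola [CharZero 𝕜]
    (hx : (MvPolynomial.aeval x : MvPolynomial (Fin 2) 𝕜 →ₐ[𝕜] A).toRingHom.Etale)
    {t : 𝕜} (ht : t ≠ 0) : IsClosed (hyperbola x k t) := by
  refine isClosed_of_forall_inChart fun p =>
    ⟨insert (C (x 0 * x 1 - algebraMap 𝕜 A t)) (posBinomials x k p), ?_⟩
  ext q
  have h1 : q (C (algebraMap 𝕜 A t)) = t := q.commutes t
  rw [mem_inChart_hyperbola hx, OnHyperbola]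
  simp only [Set.mem_ofPred_eq, Set.forall_mem_insert, map_sub, h1, sub_eq_zero]
  constructor
  · rintro ⟨⟨-, h⟩, h'⟩; exact ⟨h', h⟩
  · rintro ⟨h', h⟩; exact ⟨⟨h' ▸ isUnit_iff_ne_zero.2 ht, h⟩, h'⟩

/-- A logarithmic tangent vector of the hyperbola is tangent to the reduced prolongation. -/
theorem OnHyperbola.eq_zero_of_mem_idealOf [CharZero 𝕜] [IsAlgClosed 𝕜]
    (hx : (MvPolynomial.aeval x : MvPolynomial (Fin 2) 𝕜 →ₐ[𝕜] A).toRingHom.Etale)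
    {t : 𝕜} (ht : t ≠ 0) {p : Word k} {R : Type w} [CommRing R] [Algebra 𝕜 R]
    {τ : ChartPt 𝕜 A k R} (hτ : OnHyperbola x p τ)
    (hτt : τ (C (x 0 * x 1)) = algebraMap 𝕜 R t) {f : ChartRing A k}
    (hf : f ∈ idealOf p (hyperbola x k t)) : τ f = 0 := by
  have := finiteType_of_etale hx
  have := isReduced_hyperbola hx ht
  let I := Ideal.span {x 0 * x 1 - algebraMap 𝕜 A t}
  have hI : Ideal.Quotient.mkₐ 𝕜 I (x 0 * x 1) = algebraMap 𝕜 (A ⧸ I) t :=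
    Ideal.Quotient.eq.2 (Ideal.subset_span rfl)
  -- The tautological point `g` over the ring of the affine hyperbola kills `f`, because that ring
  -- is reduced and its closed points give points of the curve. Every `τ` as in the statement, even
  -- over a nonreduced ring, factors through `g`.
  have htu (B : Type _) [CommRing B] [Algebra 𝕜 B] : IsUnit (algebraMap 𝕜 B t) :=
    (isUnit_iff_ne_zero.2 ht).map _
  obtain ⟨g, hgb, hg⟩ := exists_onHyperbola p (Ideal.Quotient.mkₐ 𝕜 I) (x := x) (hI ▸ htu _)
  have hgf : g f = 0 := by
    refine eq_zero_of_forall_point (𝕜 := 𝕜) (A := A ⧸ I) fun r => ?_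
    refine mem_idealOf.1 hf (r.comp g) ((mem_inChart_hyperbola hx).2 ⟨hg.map r, ?_⟩)
    have h1 : g (C (x 0 * x 1)) = algebraMap 𝕜 (A ⧸ I) t := by
      rw [← hI, ← hgb, ChartPt.base_apply]
    rw [AlgHom.comp_apply, h1, AlgHom.commutes]
    rfl
  let ψ : (A ⧸ I) →ₐ[𝕜] R := Ideal.Quotient.liftₐ I τ.base fun a ha => by
    obtain ⟨c, rfl⟩ := Ideal.mem_span_singleton'.1 ha
    rw [map_mul, map_sub, ChartPt.base_apply τ (x 0 * x 1), hτt, AlgHom.commutes, sub_self,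
      mul_zero]
  have : ψ.comp g = τ := by
    refine (hg.map ψ).unique hτ (AlgHom.ext fun a => ?_)
    change ψ (g.base a) = τ.base a
    rw [hgb]; rfl
  rw [← this, AlgHom.comp_apply, hgf, map_zero]

/-- A tangent vector of the curve is itself an R[ε]-point of the prolonged hyperbola, hence
determined by its image in `U`; there, tangency to x₁x₂ = t makes it a multiple of the logarithmic
vector. -/
theorem tangentSpace_hyperbola [CharZero 𝕜] [IsAlgClosed 𝕜]
    (hx : (MvPolynomial.aeval x : MvPolynomial (Fin 2) 𝕜 →ₐ[𝕜] A).toRingHom.Etale)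
    {t : 𝕜} (ht : t ≠ 0) {p : Word (k + 1)} {q : ChartPt 𝕜 A (k + 1) 𝕜}
    (hq : OnHyperbola x p q) (hqt : q (C (x 0 * x 1)) = t) :
    tangentSpace p.trunc (hyperbola x k t) q.proj = line x p q := by
  have hz := (onHyperbola_succ.1 hq).1
  have hzt : q.proj (C (x 0 * x 1)) = t := by rwa [ChartPt.proj_apply, pull_C]
  obtain ⟨v, hv, hc, hv01⟩ := exists_log_tangent hx q.proj.base
  obtain ⟨τ₀, hb₀, h₀, hfoot₀, hf₀, hd₀⟩ := exists_log_tangent_lift hz hv hc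
  have hl₀ := hq.mem_line hfoot₀ hf₀ hd₀
  have ht₀ : τ₀ (C (x 0 * x 1)) = algebraMap 𝕜 (DualNumber 𝕜) t := by
    rw [← ChartPt.base_apply, hb₀, hv01, ChartPt.base_apply, hzt]; rfl
  refine Set.Subset.antisymm (fun τ hτ => ?_) (fun τ hτ => ?_)
  · obtain ⟨hfoot, hτ⟩ := hτ
    have hτt : τ (C (x 0 * x 1)) = algebraMap 𝕜 (DualNumber 𝕜) t := by
      have := hτ (C (x 0 * x 1 - algebraMap 𝕜 A t)) (mem_idealOf.2 fun r hr => by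
        rw [map_sub, map_sub, ((mem_inChart_hyperbola hx).1 hr).2, sub_eq_zero]
        exact (r.commutes t).symm)
      rw [map_sub, map_sub, sub_eq_zero] at this
      exact this.trans (τ.commutes t)
    have hτh : OnHyperbola x p.trunc τ := by
      refine ⟨hτt ▸ (isUnit_iff_ne_zero.2 ht).map _, fun f hf => hτ f (mem_idealOf.2 fun r hr => ?_)⟩
      exact ((mem_inChart_hyperbola hx).1 hr).1.2 f hf
    have hfst (a : A) : (τ (C a)).fst = q.proj (C a) := by rw [← hfoot]; rfl
    have h01 : q.proj (C (x 0)) * (τ (C (x 1))).snd + q.proj (C (x 1)) * (τ (C (x 0))).snd = 0 := by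
      have := congrArg TrivSqZeroExt.snd hτt
      rw [C.map_mul, map_mul, TrivSqZeroExt.snd_mul, hfst, hfst] at this
      have h0 : (algebraMap 𝕜 (DualNumber 𝕜) t).snd = 0 := rfl
      simpa [h0, mul_comm] using this
    have hx0 : q.proj (C (x 0)) ≠ 0 := fun h => ht (by rw [← hzt, C.map_mul, map_mul, h, zero_mul])
    have hτ₀ : τ = τ₀.tmap (AlgHom.id 𝕜 𝕜) ((τ (C (x 0))).snd / q.proj (C (x 0))) := by
      refine hτh.unique (h₀.map _) (tangent_unique hx (fun a => ?_) ?_)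
      · change _ = (dualMap _ _ (τ₀.base a)).fst
        rw [hb₀, fst_dualMap, hv]
        exact hfst a
      · have h (i : Fin 2) : ((τ₀.tmap (AlgHom.id 𝕜 𝕜)
            ((τ (C (x 0))).snd / q.proj (C (x 0)))).base (x i)).snd =
            ((τ (C (x 0))).snd / q.proj (C (x 0))) * (sgn i * q.proj (C (x i))) := by
          change (dualMap _ _ (τ₀.base (x i))).snd = _
          rw [hb₀, snd_dualMap, hc]
          rfl
        rw [Fin.forall_fin_two, h, h]
        simp only [ChartPt.base_apply, sgn]
        constructor
        · simp [hx0]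
        · simp
          field_simp
          linear_combination h01
    rw [hτ₀]
    simpa using tmap_mem_line hl₀ (AlgHom.id 𝕜 𝕜) _
  · have hu : IsUnit (τ₀.diff (active x k p.trunc p.final)) := by
      rw [hd₀]
      exact ((isUnit_sgn 𝕜 _).mul (isUnit_weight 𝕜 𝕜 _ _)).mul (hz.isUnit_active _)
    obtain ⟨c, rfl⟩ := line_eq_scale hx hl₀ hτ hu
    refine ⟨hτ.1, fun f hf => ?_⟩
    rw [ChartPt.tmap, AlgHom.comp_apply, h₀.eq_zero_of_mem_idealOf hx ht ht₀ hf, map_zero]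

/-- Every point of the curve is nonsingular, its tangent line is the unique solution of the next
node binomial, and the set of these lines is already closed. -/
theorem prolong_hyperbola [CharZero 𝕜] [IsAlgClosed 𝕜]
    (hx : (MvPolynomial.aeval x : MvPolynomial (Fin 2) 𝕜 →ₐ[𝕜] A).toRingHom.Etale)
    {t : 𝕜} (ht : t ≠ 0) : prolong (hyperbola x k t) = hyperbola x (k + 1) t := by
  rw [prolong]
  convert! (isClosed_hyperbola hx ht).closure_eq using 2
  ext P
  constructor
  · rintro ⟨p, q, rfl, hZ, hT⟩
    obtain ⟨hz, hzt⟩ := (mem_inChart_hyperbola hx).1 hZ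
    obtain ⟨q', hb, hq'⟩ := exists_onHyperbola p q.proj.base (by simpa using hz.1)
    have hzq : q'.proj = q.proj := by
      refine (onHyperbola_succ.1 hq').1.unique hz (AlgHom.ext fun a => ?_)
      rw [← hb]; simp [ChartPt.proj_apply]
    have hq't : q' (C (x 0 * x 1)) = t := by
      rw [← hzt, ← hzq, ChartPt.proj_apply, pull_C]
    have h1 := tangentSpace_hyperbola hx ht hq' hq't
    rw [hzq, hT] at h1
    obtain rfl := line_injective hx h1
    exact ⟨p, q, rfl, hq', hq't⟩
  · rintro ⟨p, q, rfl, hq, hqt⟩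
    refine ⟨p, q, rfl, ?_, tangentSpace_hyperbola hx ht hq hqt⟩
    exact ⟨p.trunc, q.proj, rfl, (onHyperbola_succ.1 hq).1, by rwa [ChartPt.proj_apply, pull_C]⟩

theorem zeroLocus_eq_hyperbola {t : 𝕜} (ht : t ≠ 0) :
    zeroLocus x (x 0 * x 1 - algebraMap 𝕜 A t) = hyperbola x 0 t := by
  have key (q : ChartPt 𝕜 A 0 𝕜) : q (C (x 0 * x 1 - algebraMap 𝕜 A t)) = 0 ↔
      q (C (x 0 * x 1)) = t := by
    have h1 : q (C (algebraMap 𝕜 A t)) = t := q.commutes t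
    rw [map_sub, map_sub, h1, sub_eq_zero]
  ext P
  constructor
  · rintro ⟨q, rfl, hq⟩
    rw [key] at hq
    exact ⟨_, q, rfl, onHyperbola_zero.2 (hq ▸ isUnit_iff_ne_zero.2 ht), hq⟩
  · rintro ⟨p, q, rfl, -, hq⟩
    exact ⟨q, by rw [Subsingleton.elim p ![]], (key q).2 hq⟩

theorem iterProlong_hyperbola [CharZero 𝕜] [IsAlgClosed 𝕜]
    (hx : (MvPolynomial.aeval x : MvPolynomial (Fin 2) 𝕜 →ₐ[𝕜] A).toRingHom.Etale)
    {t : 𝕜} (ht : t ≠ 0) (k : ℕ) :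
    iterProlong (zeroLocus x (x 0 * x 1 - algebraMap 𝕜 A t)) k = hyperbola x k t := by
  induction k with
  | zero => exact zeroLocus_eq_hyperbola ht
  | succ k ih => rw [iterProlong, ih, prolong_hyperbola hx ht]

/-- Each point of the family determines its parameter as t = x₁x₂, so t can be eliminated. -/
theorem mem_familyIdeal [CharZero 𝕜] [IsAlgClosed 𝕜]
    (hx : (MvPolynomial.aeval x : MvPolynomial (Fin 2) 𝕜 →ₐ[𝕜] A).toRingHom.Etale)
    {p : Word k} {F : Polynomial (ChartRing A k)} :
    F ∈ familyIdeal 𝕜 x p ↔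
      ∀ q : ChartPt 𝕜 A k 𝕜, OnHyperbola x p q → q (F.eval (C (x 0 * x 1))) = 0 := by
  simp only [familyIdeal, Ideal.mem_iInf, RingHom.mem_ker, Polynomial.coe_eval₂RingHom]
  constructor
  · intro h q hq
    have ht : q (C (x 0 * x 1)) ≠ 0 := hq.1.ne_zero
    have := h _ ht q (by rw [iterProlong_hyperbola hx ht, mem_inChart_hyperbola hx]; exact ⟨hq, rfl⟩)
    rw [← this]
    exact (Polynomial.eval₂_at_apply q.toRingHom (C (x 0 * x 1))).symm
  · intro h t ht q hq
    rw [iterProlong_hyperbola hx ht, mem_inChart_hyperbola hx] at hq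
    rw [← h q hq.1, ← hq.2]
    exact Polynomial.eval₂_at_apply q.toRingHom (C (x 0 * x 1))

end HyperbolaProlongation

/-! ### The chart ring as polynomials in the last coordinate -/

section LastVariable

variable {A : Type v} [CommRing A] {k : ℕ}

/-- Setting the last coordinate equal to `0`. -/
noncomputable def evalLastZero (k : ℕ) : ChartRing A (k + 1) →ₐ[A] ChartRing A k :=
  MvPolynomial.aeval (Fin.snoc (α := fun _ => ChartRing A k) X 0)

@[simp] theorem evalLastZero_last : evalLastZero k (X (Fin.last k) : ChartRing A (k + 1)) = 0 := by
  simp [evalLastZero]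

@[simp] theorem evalLastZero_pull (f : ChartRing A k) : evalLastZero k (pull k f) = f := by
  have : (evalLastZero k).comp (pull k) = AlgHom.id A (ChartRing A k) := by
    ext j; simp [evalLastZero]
  exact AlgHom.congr_fun this f

theorem sub_pull_evalLastZero_mem (f : ChartRing A (k + 1)) :
    f - pull k (evalLastZero k f) ∈ Ideal.span {(X (Fin.last k) : ChartRing A (k + 1))} := by
  rw [← Ideal.Quotient.eq_zero_iff_mem, map_sub, sub_eq_zero]
  have : Ideal.Quotient.mkₐ A (Ideal.span {(X (Fin.last k) : ChartRing A (k + 1))}) =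
      (Ideal.Quotient.mkₐ A _).comp ((pull k).comp (evalLastZero k)) := by
    ext j
    refine Fin.lastCases ?_ (fun j => ?_) j
    · simp
    · simp [evalLastZero]
  exact AlgHom.congr_fun this f

/-- Polynomials in the last coordinate as functions on the chart. -/
noncomputable def ofPoly (k : ℕ) : Polynomial (ChartRing A k) →+* ChartRing A (k + 1) :=
  Polynomial.eval₂RingHom (pull k).toRingHom (X (Fin.last k))

@[simp] theorem ofPoly_C (f : ChartRing A k) : ofPoly k (Polynomial.C f) = pull k f :=
  Polynomial.eval₂_C _ _

@[simp] theorem ofPoly_X : ofPoly k (Polynomial.X : Polynomial (ChartRing A k)) = X (Fin.last k) :=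
  Polynomial.eval₂_X _ _

/-- Functions on the chart as polynomials in the last coordinate. -/
noncomputable def toPoly (k : ℕ) : ChartRing A (k + 1) →ₐ[A] Polynomial (ChartRing A k) :=
  MvPolynomial.aeval (Fin.snoc (α := fun _ => Polynomial (ChartRing A k))
    (fun j => Polynomial.C (X j)) Polynomial.X)

@[simp] theorem toPoly_last :
    toPoly k (X (Fin.last k) : ChartRing A (k + 1)) = Polynomial.X := by simp [toPoly]

@[simp] theorem toPoly_pull (f : ChartRing A k) : toPoly k (pull k f) = Polynomial.C f := by
  have : (toPoly k).comp (pull k) = (Polynomial.CAlgHom : ChartRing A k →ₐ[A] _) := by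
    ext j; simp [toPoly]
  exact AlgHom.congr_fun this f

@[simp] theorem ofPoly_toPoly (f : ChartRing A (k + 1)) : ofPoly k (toPoly k f) = f := by
  have : (ofPoly k).comp (toPoly k).toRingHom = RingHom.id (ChartRing A (k + 1)) := by
    refine MvPolynomial.ringHom_ext (fun a => ?_) fun j => ?_
    · change ofPoly k (toPoly k (C a)) = C a
      rw [← pull_C, toPoly_pull, ofPoly_C]
    · change ofPoly k (toPoly k (X j)) = X j
      refine Fin.lastCases ?_ (fun j => ?_) j
      · rw [toPoly_last, ofPoly_X]
      · rw [← pull_X, toPoly_pull, ofPoly_C]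
  exact RingHom.congr_fun this f

end LastVariable

/-! ### Regular sequences and the ideal of the total space -/

section Kernel

variable {𝕜 : Type u} [Field 𝕜] {A : Type v} [CommRing A] [Algebra 𝕜 A] {k : ℕ} {x : Fin 2 → A}

theorem natCast_weight_mul_inv [CharZero 𝕜] (B : Type w) [CommRing B] [Algebra 𝕜 B] (p : Word k)
    (i : Fin 2) : algebraMap 𝕜 B (weight k p i : 𝕜)⁻¹ * (weight k p i : B) = 1 := by
  have : (weight k p i : 𝕜) ≠ 0 := Nat.cast_ne_zero.2 (weight_pos p i).ne'
  rw [← map_natCast (algebraMap 𝕜 B), ← map_mul, inv_mul_cancel₀ this, map_one]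

theorem pull_mem_span_pos {p : Word (k + 1)} {f : ChartRing A k}
    (hf : f ∈ Ideal.span (posBinomials x k p.trunc)) :
    pull k f ∈ Ideal.span (posBinomials x (k + 1) p) := by
  have := Ideal.mem_map_of_mem (pull k) hf
  rw [Ideal.map_span] at this
  exact Ideal.span_mono (Set.subset_insert _ _) this

/-- The two active coordinates form a regular sequence, in either order, modulo the node
binomials. -/
theorem active_mul_mem_iff (𝕜 : Type u) [Field 𝕜] [CharZero 𝕜] [Algebra 𝕜 A]
    (hirr : ∀ i, (Ideal.span {x i}).IsPrime)
    (hne : ∀ i, x (Fin.rev i) ∉ Ideal.span {x i}) (p : Word k) (i : Fin 2) {f : ChartRing A k}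
    (hf : active x k p (Fin.rev i) * f ∈
      Ideal.span (insert (active x k p i) (posBinomials x k p))) :
    f ∈ Ideal.span (insert (active x k p i) (posBinomials x k p)) := by
  induction k generalizing i with
  | zero =>
    obtain ⟨a, rfl⟩ : ∃ a, f = C a := ⟨_, MvPolynomial.eq_C_of_isEmpty f⟩
    have h := Ideal.mem_map_of_mem (MvPolynomial.constantCoeff : ChartRing A 0 →+* A) hf
    rw [Ideal.map_span] at h
    simp only [posBinomials, active, insert_empty_eq, Set.image_singleton, map_mul,
      MvPolynomial.constantCoeff_C] at h
    have h1 := ((hirr i).mem_or_mem h).resolve_left (hne i)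
    have := Ideal.mem_map_of_mem (C : A →+* ChartRing A 0) h1
    rw [Ideal.map_span, Set.image_singleton] at this
    simpa [posBinomials, active] using this
  | succ k ih =>
    obtain ⟨s, hs⟩ : ∃ s, s = p.final := ⟨_, rfl⟩
    have hnb := nodeBinomial_succ x p
    have hactive := active_final x p
    have hactive' := active_rev_final x p
    rw [← hs] at hnb hactive hactive'
    rcases eq_or_eq_rev i s with h | h <;> rw [h] at hf ⊢
    -- Modulo r the node binomial becomes w(d)·d. The ideal is thus extended from J = (r, d, earlier
    -- binomials) one level below, and the polynomial variable n is regular modulo an extended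
    -- ideal.
    · rw [hactive, hactive'] at hf
      rw [hactive]
      set J := Ideal.span (insert (active x k p.trunc (Fin.rev s))
        (insert (active x k p.trunc s) (posBinomials x k p.trunc))) with hJ
      have hle : Ideal.span (insert (pull k (active x k p.trunc s)) (posBinomials x (k + 1) p)) ≤
          (J.map Polynomial.C).comap (toPoly k) := by
        rw [Ideal.span_le, posBinomials, Set.insert_subset_iff, Set.insert_subset_iff,
          Set.image_subset_iff]
        have h1 : Polynomial.C (active x k p.trunc s) ∈ J.map Polynomial.C :=
          Ideal.mem_map_of_mem _ (Ideal.subset_span (by simp))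
        have h2 : Polynomial.C (active x k p.trunc (Fin.rev s)) ∈ J.map Polynomial.C :=
          Ideal.mem_map_of_mem _ (Ideal.subset_span (by simp))
        refine ⟨?_, ?_, fun g hg => ?_⟩
        · simpa using h1
        · simp only [SetLike.mem_coe, Ideal.mem_comap, hnb, map_add, map_mul, map_natCast,
            toPoly_pull]
          exact add_mem (Ideal.mul_mem_left _ _ (Ideal.mul_mem_left _ _ h1))
            (Ideal.mul_mem_left _ _ h2)
        · simp only [Set.mem_preimage, SetLike.mem_coe, Ideal.mem_comap, toPoly_pull]
          exact Ideal.mem_map_of_mem _ (Ideal.subset_span (by simp [hg]))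
      have hd : pull k (active x k p.trunc (Fin.rev s)) ∈
          Ideal.span (insert (pull k (active x k p.trunc s)) (posBinomials x (k + 1) p)) := by
        have h1 : nodeBinomial x (k + 1) p ∈
            Ideal.span (insert (pull k (active x k p.trunc s)) (posBinomials x (k + 1) p)) :=
          Ideal.subset_span (by simp [posBinomials])
        have h2 : pull k (active x k p.trunc s) ∈
            Ideal.span (insert (pull k (active x k p.trunc s)) (posBinomials x (k + 1) p)) :=
          Ideal.subset_span (by simp)
        have h3 := natCast_weight_mul_inv (𝕜 := 𝕜) (ChartRing A (k + 1)) p.trunc (Fin.rev s)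
        have h4 := Ideal.mul_mem_left _ (algebraMap 𝕜 (ChartRing A (k + 1))
          (weight k p.trunc (Fin.rev s) : 𝕜)⁻¹) (sub_mem h1 (Ideal.mul_mem_left _
            ((weight k p.trunc s : ChartRing A (k + 1)) * X (Fin.last k)) h2))
        convert h4 using 1
        rw [hnb]
        linear_combination (-pull k (active x k p.trunc (Fin.rev s))) * h3
      have hge : J.map Polynomial.C ≤ (Ideal.span (insert (pull k (active x k p.trunc s))
          (posBinomials x (k + 1) p))).comap (ofPoly k) := by
        rw [Ideal.map_le_iff_le_comap, hJ, Ideal.span_le, Set.insert_subset_iff,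
          Set.insert_subset_iff]
        refine ⟨?_, ?_, fun g hg => ?_⟩
        · simpa using hd
        · simpa using Ideal.subset_span (Set.mem_insert _ _)
        · simp only [SetLike.mem_coe, Ideal.mem_comap, ofPoly_C]
          exact Ideal.span_mono (Set.subset_insert _ _) (pull_mem_span_pos (Ideal.subset_span hg))
      have h1 := hle hf
      rw [Ideal.mem_comap, map_mul, toPoly_last, Ideal.mem_map_C_iff] at h1
      have h2 : toPoly k f ∈ J.map Polynomial.C := by
        rw [Ideal.mem_map_C_iff]
        intro n
        simpa [Polynomial.coeff_X_mul] using h1 (n + 1)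
      simpa using hge h2
    -- Modulo n the node binomial again becomes w(d)·d, so setting n = 0 reduces the claim to r
    -- being regular modulo d and the earlier binomials.
    · rw [Fin.rev_rev, hactive, hactive'] at hf
      rw [hactive']
      set K := Ideal.span (insert (X (Fin.last k)) (posBinomials x (k + 1) p)) with hK
      have hn : (X (Fin.last k) : ChartRing A (k + 1)) ∈ K := Ideal.subset_span (by simp)
      have hle : K ≤ (Ideal.span (insert (active x k p.trunc (Fin.rev s))
          (posBinomials x k p.trunc))).comap (evalLastZero k) := by
        rw [hK, Ideal.span_le, posBinomials, Set.insert_subset_iff, Set.insert_subset_iff,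
          Set.image_subset_iff]
        refine ⟨by simp, ?_, fun g hg => ?_⟩
        · simp only [SetLike.mem_coe, Ideal.mem_comap, hnb, map_add, map_mul, map_natCast,
            evalLastZero_pull, evalLastZero_last, zero_mul, mul_zero, zero_add]
          exact Ideal.mul_mem_left _ _ (Ideal.subset_span (by simp))
        · simp only [Set.mem_preimage, SetLike.mem_coe, Ideal.mem_comap, evalLastZero_pull]
          exact Ideal.subset_span (by simp [hg])
      have h1 := hle hf
      rw [Ideal.mem_comap, map_mul, evalLastZero_pull] at h1
      have h2 := ih p.trunc (Fin.rev s) (by rwa [Fin.rev_rev])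
      have hge : Ideal.span (insert (active x k p.trunc (Fin.rev s))
          (posBinomials x k p.trunc)) ≤ K.comap (pull k) := by
        rw [Ideal.span_le, Set.insert_subset_iff]
        refine ⟨?_, fun g hg => ?_⟩
        · have h1 : nodeBinomial x (k + 1) p ∈ K := Ideal.subset_span (by simp [posBinomials])
          have h3 := natCast_weight_mul_inv (𝕜 := 𝕜) (ChartRing A (k + 1)) p.trunc (Fin.rev s)
          have h4 := Ideal.mul_mem_left _ (algebraMap 𝕜 (ChartRing A (k + 1))
            (weight k p.trunc (Fin.rev s) : 𝕜)⁻¹) (sub_mem h1 (Ideal.mul_mem_left _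
              ((weight k p.trunc s : ChartRing A (k + 1)) * pull k (active x k p.trunc s)) hn))
          rw [SetLike.mem_coe, Ideal.mem_comap]
          convert h4 using 1
          rw [hnb]
          linear_combination (-pull k (active x k p.trunc (Fin.rev s))) * h3
        · exact Ideal.span_mono (Set.subset_insert _ _) (pull_mem_span_pos (Ideal.subset_span hg))
      have h3 : pull k (evalLastZero k f) ∈ K := hge h2
      have h4 := sub_pull_evalLastZero_mem f
      have h5 : Ideal.span {X (Fin.last k)} ≤ K := by rwa [Ideal.span_singleton_le_iff_mem]
      simpa using add_mem (h5 h4) h3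

/-- With n = D/H, the expression Hᵐ F(n) is the sum of the Fⱼ Dʲ Hᵐ⁻ʲ, and only the term j = m lacks
a factor H. -/
theorem exists_clear_denominators {R : Type w} [CommRing R] [Algebra 𝕜 R]
    (q : ChartPt 𝕜 A (k + 1) R) {H D : ChartRing A k}
    (h : q.proj H * q (X (Fin.last k)) = q.proj D) (m : ℕ) (F : Polynomial (ChartRing A k))
    (hF : F.natDegree ≤ m) :
    ∃ g, q.proj H ^ m * q (ofPoly k F) = q.proj (D ^ m * F.coeff m + H * g) := by
  induction m generalizing F with
  | zero =>
    refine ⟨0, ?_⟩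
    rw [Polynomial.eq_C_of_natDegree_le_zero hF]
    simp [ChartPt.proj_apply]
  | succ m ih =>
    obtain ⟨g, hg⟩ := ih F.divX (by rw [Polynomial.natDegree_divX_eq_natDegree_tsub_one]; omega)
    refine ⟨H ^ m * F.coeff 0 + D * g, ?_⟩
    have h1 : q (ofPoly k F) =
        q (ofPoly k F.divX) * q (X (Fin.last k)) + q.proj (F.coeff 0) := by
      conv_lhs => rw [← F.divX_mul_X_add]
      simp [ChartPt.proj_apply]
    rw [Polynomial.coeff_divX] at hg
    simp only [map_add, map_mul, map_pow] at hg ⊢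
    rw [h1]
    linear_combination (q.proj H * q (X (Fin.last k))) * hg +
      (q.proj D ^ m * q.proj (F.coeff (m + 1)) + q.proj H * q.proj g) * h

/-- The node binomials of positive level generate the ideal of the closure of the union of the
prolonged hyperbolas. -/
theorem mem_span_pos_of_eq_zero [CharZero 𝕜] (hirr : ∀ i, (Ideal.span {x i}).IsPrime)
    (hne : ∀ i, x (Fin.rev i) ∉ Ideal.span {x i}) {R : Type w} [CommRing R] [Algebra 𝕜 R]
    {p : Word k} {q : ChartPt 𝕜 A k R} (hq : OnHyperbola x p q)
    (hb : Function.Injective q.base) {f : ChartRing A k} (hf : q f = 0) :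
    f ∈ Ideal.span (posBinomials x k p) := by
  induction k with
  | zero =>
    obtain ⟨a, rfl⟩ : ∃ a, f = C a := ⟨_, MvPolynomial.eq_C_of_isEmpty f⟩
    rw [← ChartPt.base_apply, map_eq_zero_iff _ hb] at hf
    simp [hf]
  | succ k ih =>
    have hq1 := (onHyperbola_succ.1 hq).1
    have hq2 := (onHyperbola_succ.1 hq).2
    have hb1 : Function.Injective q.proj.base := by
      rwa [show q.proj.base = q.base from AlgHom.ext fun a => by simp [ChartPt.proj_apply]]
    set s := p.final with hs
    set r := active x k p.trunc s with hr
    set d := active x k p.trunc (Fin.rev s) with hd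
    set a := weight k p.trunc s with ha
    set b := weight k p.trunc (Fin.rev s) with hb'
    have hrel : q.proj ((a : ChartRing A k) * r) * q (X (Fin.last k)) =
        q.proj (-((b : ChartRing A k) * d)) := by
      simp only [map_neg, map_mul, map_natCast]
      linear_combination hq2
    -- Induction on the degree in n: the leading coefficient lies in (r, earlier binomials), so it
    -- can be removed by subtracting an element of the ideal.
    have key (m : ℕ) : ∀ F : Polynomial (ChartRing A k), F.natDegree ≤ m → q (ofPoly k F) = 0 →
        ofPoly k F ∈ Ideal.span (posBinomials x (k + 1) p) := by
      induction m with
      | zero =>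
        intro F hF h0
        rw [Polynomial.eq_C_of_natDegree_le_zero hF, ofPoly_C] at h0 ⊢
        exact pull_mem_span_pos (ih hq1 hb1 h0)
      | succ m ihm =>
        intro F hF h0
        obtain ⟨g, hg⟩ := exists_clear_denominators q hrel (m + 1) F hF
        rw [h0, mul_zero] at hg
        have h1 := ih hq1 hb1 hg.symm
        have hbinv := natCast_weight_mul_inv (𝕜 := 𝕜) (ChartRing A k) p.trunc (Fin.rev s)
        -- Clearing denominators puts dᵐ⁺¹ times the leading coefficient into (r, earlier
        -- binomials), up to an invertible constant; regularity of d modulo that ideal strips the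
        -- power.
        have hpow (n : ℕ) (c : ChartRing A k) (hc : d ^ n * c ∈
            Ideal.span (insert r (posBinomials x k p.trunc))) :
            c ∈ Ideal.span (insert r (posBinomials x k p.trunc)) := by
          induction n with
          | zero => simpa using hc
          | succ n ihn =>
            refine ihn (active_mul_mem_iff 𝕜 hirr hne p.trunc s ?_)
            rwa [← mul_assoc, ← pow_succ']
        have hc : F.coeff (m + 1) ∈ Ideal.span (insert r (posBinomials x k p.trunc)) := by
          refine hpow (m + 1) _ ?_
          have h2 := Ideal.span_mono (Set.subset_insert r _) h1
          have h3 : r ∈ Ideal.span (insert r (posBinomials x k p.trunc)) :=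
            Ideal.subset_span (Set.mem_insert _ _)
          have h4 := Ideal.mul_mem_left _
            ((-(algebraMap 𝕜 (ChartRing A k) (b : 𝕜)⁻¹)) ^ (m + 1))
            (sub_mem h2 (Ideal.mul_mem_left _ ((a : ChartRing A k) * g) h3))
          have h5 : (-(algebraMap 𝕜 (ChartRing A k) (b : 𝕜)⁻¹)) ^ (m + 1) *
              (-((b : ChartRing A k) * d)) ^ (m + 1) = d ^ (m + 1) := by
            rw [← mul_pow]
            congr 1
            linear_combination d * hbinv
          convert h4 using 1
          linear_combination (-F.coeff (m + 1)) * h5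
        obtain ⟨g', κ, hκ, hcκ⟩ := Ideal.mem_span_insert.1 hc
        obtain ⟨e, he⟩ : ∃ e : ChartRing A k, e * (a : ChartRing A k) = 1 :=
          ⟨_, natCast_weight_mul_inv (𝕜 := 𝕜) (ChartRing A k) p.trunc s⟩
        -- `G` lies in the ideal and has the same coefficient g'r + κ in degree m + 1 as `F`; the
        -- factor `e` inverts the coefficient `a` of n·r in the binomial.
        set G : Polynomial (ChartRing A k) := Polynomial.C κ * Polynomial.X ^ (m + 1) +
          Polynomial.C (e * g') * (Polynomial.X ^ m *
            (Polynomial.C ((a : ChartRing A k) * r) * Polynomial.X +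
              Polynomial.C ((b : ChartRing A k) * d))) with hG
        have hGI : ofPoly k G ∈ Ideal.span (posBinomials x (k + 1) p) := by
          have h6 : nodeBinomial x (k + 1) p ∈ Ideal.span (posBinomials x (k + 1) p) :=
            Ideal.subset_span (by simp [posBinomials])
          rw [hG, map_add]
          refine add_mem ?_ ?_
          · rw [map_mul, ofPoly_C]
            exact Ideal.mul_mem_right _ _ (pull_mem_span_pos hκ)
          · rw [map_mul (ofPoly k), map_mul (ofPoly k)]
            refine Ideal.mul_mem_left _ _ (Ideal.mul_mem_left _ _ ?_)
            convert h6 using 1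
            rw [nodeBinomial_succ]
            simp only [map_add, map_mul, ofPoly_C, ofPoly_X, map_natCast]
            ring
        have hG0 : q (ofPoly k G) = 0 := by
          have h7 : Ideal.span (posBinomials x (k + 1) p) ≤ RingHom.ker q :=
            Ideal.span_le.2 hq.2
          exact h7 hGI
        have hdeg : (F - G).natDegree ≤ m := by
          have hGd : G.natDegree ≤ m + 1 := by
            rw [hG]
            compute_degree
          have hle : (F - G).natDegree ≤ m + 1 := (Polynomial.natDegree_sub_le_of_le hF hGd).trans
            (by simp)
          have hcoeff : (F - G).coeff (m + 1) = 0 := by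
            rw [Polynomial.coeff_sub, hcκ, hG]
            simp only [Polynomial.coeff_add, Polynomial.coeff_C_mul, Polynomial.coeff_X_pow,
              if_true, mul_add, Polynomial.coeff_X_pow_mul',
              Polynomial.coeff_C]
            simp
            linear_combination (-g' * r) * he
          by_contra hlt
          have : (F - G).natDegree = m + 1 := by omega
          have h8 : (F - G).leadingCoeff = 0 := by rw [Polynomial.leadingCoeff, this, hcoeff]
          rw [Polynomial.leadingCoeff_eq_zero] at h8
          rw [h8] at this
          simp at this
        have h9 := ihm (F - G) hdeg (by rw [map_sub, map_sub, h0, hG0, sub_zero])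
        simpa using add_mem h9 hGI
    have := key _ (toPoly k f) le_rfl (by rwa [ofPoly_toPoly])
    rwa [ofPoly_toPoly] at this

end Kernel

/-! ### Flatness and the central ideal -/

section Family

variable {𝕜 : Type u} [Field 𝕜] {A : Type v} [CommRing A] [Algebra 𝕜 A] {k : ℕ} {x : Fin 2 → A}

/-- Nonzero polynomials in the coordinates are nonzerodivisors. -/
theorem eq_zero_of_aeval_mul_eq_zero
    (hx : (MvPolynomial.aeval x : MvPolynomial (Fin 2) 𝕜 →ₐ[𝕜] A).toRingHom.Etale)
    {g : MvPolynomial (Fin 2) 𝕜} (hg : g ≠ 0) {a : A} (h : MvPolynomial.aeval x g * a = 0) :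
    a = 0 := by
  let : Algebra (MvPolynomial (Fin 2) 𝕜) A :=
    (MvPolynomial.aeval x : MvPolynomial (Fin 2) 𝕜 →ₐ[𝕜] A).toRingHom.toAlgebra
  have : Algebra.Etale (MvPolynomial (Fin 2) 𝕜) A := hx
  have h1 : g • a = 0 := h
  -- Étale algebras are flat, and flat modules over a domain are torsion-free.
  exact (smul_eq_zero_iff_right hg).1 h1

theorem mul_mem_nonZeroDivisors
    (hx : (MvPolynomial.aeval x : MvPolynomial (Fin 2) 𝕜 →ₐ[𝕜] A).toRingHom.Etale) :
    x 0 * x 1 ∈ nonZeroDivisors A := by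
  refine mem_nonZeroDivisors_iff_left.2 fun a ha => ?_
  refine eq_zero_of_aeval_mul_eq_zero hx (g := X 0 * X 1) ?_ (by simpa using ha)
  exact mul_ne_zero (MvPolynomial.X_ne_zero 0) (MvPolynomial.X_ne_zero 1)

theorem eq_zero_of_polynomial_mul_eq_zero
    (hx : (MvPolynomial.aeval x : MvPolynomial (Fin 2) 𝕜 →ₐ[𝕜] A).toRingHom.Etale)
    {g : Polynomial 𝕜} (hg : g ≠ 0) {a : A} (h : Polynomial.aeval (x 0 * x 1) g * a = 0) :
    a = 0 := by
  let f : Polynomial 𝕜 →ₐ[𝕜] MvPolynomial (Fin 2) 𝕜 := Polynomial.aeval (X 0 * X 1)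
  let r : MvPolynomial (Fin 2) 𝕜 →ₐ[𝕜] Polynomial 𝕜 := MvPolynomial.aeval ![Polynomial.X, 1]
  -- Putting the second variable equal to 1 is a retraction of t ↦ X₀X₁, so nonzero polynomials in t
  -- stay nonzero.
  have hrf : r.comp f = AlgHom.id 𝕜 _ := by ext; simp [r, f]
  have hf : f g ≠ 0 := fun h0 => hg (by
    have := AlgHom.congr_fun hrf g
    rw [AlgHom.comp_apply, h0, map_zero] at this
    exact this.symm)
  have hxf : (MvPolynomial.aeval x).comp f = Polynomial.aeval (x 0 * x 1) := by ext; simp [f]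
  refine eq_zero_of_aeval_mul_eq_zero hx hf ?_
  rw [← h, ← hxf]; rfl

/-- The generic point of the prolonged hyperbolas. -/
theorem exists_generic [CharZero 𝕜]
    (hx : (MvPolynomial.aeval x : MvPolynomial (Fin 2) 𝕜 →ₐ[𝕜] A).toRingHom.Etale) (p : Word k) :
    ∃ q : ChartPt 𝕜 A k (Localization.Away (x 0 * x 1)), OnHyperbola x p q ∧
      (∀ a, q.base a = algebraMap A _ a) ∧ Function.Injective q.base := by
  obtain ⟨q, hb, hq⟩ := exists_onHyperbola (x := x) p
    (IsScalarTower.toAlgHom 𝕜 A (Localization.Away (x 0 * x 1)))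
    (IsLocalization.Away.algebraMap_isUnit (S := Localization.Away (x 0 * x 1)) (x 0 * x 1))
  refine ⟨q, hq, fun a => by rw [hb]; rfl, ?_⟩
  rw [hb]
  exact IsLocalization.injective _ (powers_le_nonZeroDivisors_of_mem hx)
where
  powers_le_nonZeroDivisors_of_mem
    (hx : (MvPolynomial.aeval x : MvPolynomial (Fin 2) 𝕜 →ₐ[𝕜] A).toRingHom.Etale) :
    Submonoid.powers (x 0 * x 1) ≤ nonZeroDivisors A :=
  Submonoid.powers_le.2 (mul_mem_nonZeroDivisors hx)

theorem coord_rev_not_mem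
    (hx : (MvPolynomial.aeval x : MvPolynomial (Fin 2) 𝕜 →ₐ[𝕜] A).toRingHom.Etale)
    {o : A →ₐ[𝕜] 𝕜} (ho : ∀ i, o (x i) = 0) (i : Fin 2) : x (Fin.rev i) ∉ Ideal.span {x i} :=
  coord_not_mem_span hx ho (rev_ne i)

/-- A[1/(x₁x₂)] is reduced and of finite type, so vanishing at all closed points of the family is
vanishing at its generic point, whose kernel is known. -/
theorem mem_familyIdeal_iff [CharZero 𝕜] [IsAlgClosed 𝕜]
    (hx : (MvPolynomial.aeval x : MvPolynomial (Fin 2) 𝕜 →ₐ[𝕜] A).toRingHom.Etale)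
    {o : A →ₐ[𝕜] 𝕜} (ho : ∀ i, o (x i) = 0) (hirr : ∀ i, (Ideal.span {x i}).IsPrime)
    {p : Word k} {F : Polynomial (ChartRing A k)} :
    F ∈ familyIdeal 𝕜 x p ↔ F.eval (C (x 0 * x 1)) ∈ Ideal.span (posBinomials x k p) := by
  rw [mem_familyIdeal hx]
  constructor
  · intro h
    have := finiteType_of_etale hx
    have := isReduced_of_coords hx
    have : IsReduced (Localization.Away (x 0 * x 1)) :=
      inferInstanceAs (IsReduced (Localization (Submonoid.powers (x 0 * x 1))))
    have : Algebra.FiniteType A (Localization.Away (x 0 * x 1)) :=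
      IsLocalization.finiteType_of_monoid_fg (Submonoid.powers (x 0 * x 1)) _
    have : Algebra.FiniteType 𝕜 (Localization.Away (x 0 * x 1)) :=
      Algebra.FiniteType.trans (S := A) inferInstance inferInstance
    obtain ⟨q, hq, -, hb⟩ := exists_generic hx p
    refine mem_span_pos_of_eq_zero hirr (coord_rev_not_mem hx ho) hq hb ?_
    exact eq_zero_of_forall_point (𝕜 := 𝕜) fun r => h (r.comp q) (hq.map r)
  · intro h q hq
    exact (Ideal.span_le (I := RingHom.ker q)).2 hq.2 h

/-- F(0) and F(x₁x₂) differ by a multiple of x₁x₂; conversely x₁x₂ is the value at t = 0 of the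
family equation x₁x₂ − t. -/
theorem centralIdeal_eq [CharZero 𝕜] [IsAlgClosed 𝕜]
    (hx : (MvPolynomial.aeval x : MvPolynomial (Fin 2) 𝕜 →ₐ[𝕜] A).toRingHom.Etale)
    {o : A →ₐ[𝕜] 𝕜} (ho : ∀ i, o (x i) = 0) (hirr : ∀ i, (Ideal.span {x i}).IsPrime)
    (p : Word k) : centralIdeal 𝕜 x p = Ideal.span (nodeBinomials x k p) := by
  rw [nodeBinomials_eq, centralIdeal]
  refine le_antisymm (Ideal.map_le_iff_le_comap.2 fun F hF => ?_) (Ideal.span_le.2 ?_)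
  · rw [mem_familyIdeal_iff hx ho hirr] at hF
    obtain ⟨c, hc⟩ := Polynomial.sub_dvd_eval_sub (C (x 0 * x 1)) 0 F
    rw [sub_zero] at hc
    rw [Ideal.mem_comap, Polynomial.coe_evalRingHom, Ideal.mem_span_insert]
    refine ⟨-c, _, hF, ?_⟩
    linear_combination -hc
  · rw [Set.insert_subset_iff]
    refine ⟨?_, fun g hg => ?_⟩
    · have h : Polynomial.C (C (x 0 * x 1)) - Polynomial.X ∈ familyIdeal 𝕜 x p := by
        rw [mem_familyIdeal_iff hx ho hirr]; simp
      simpa using Ideal.mem_map_of_mem (Polynomial.evalRingHom 0) h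
    · have h : Polynomial.C g ∈ familyIdeal 𝕜 x p := by
        rw [mem_familyIdeal_iff hx ho hirr, Polynomial.eval_C]; exact Ideal.subset_span hg
      simpa using Ideal.mem_map_of_mem (Polynomial.evalRingHom 0) h

theorem flat_of_forall_mul_eq_zero {R S : Type*} [CommRing R] [IsDedekindDomain R]
    [CommRing S] (f : R →+* S) (h : ∀ r s, r ≠ 0 → f r * s = 0 → s = 0) : f.Flat := by
  let : Algebra R S := f.toAlgebra
  change Module.Flat R S
  rw [IsDedekindDomain.flat_iff_torsion_eq_bot, eq_bot_iff]
  rintro s ⟨⟨r, hr⟩, hrs⟩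
  exact h r s (nonZeroDivisors.ne_zero hr) hrs

/-- The coordinate ring of the family embeds into A[1/(x₁x₂)], where g(t) acts as g(x₁x₂), a
nonzerodivisor for g ≠ 0. -/
theorem flat_familyMap [CharZero 𝕜] [IsAlgClosed 𝕜]
    (hx : (MvPolynomial.aeval x : MvPolynomial (Fin 2) 𝕜 →ₐ[𝕜] A).toRingHom.Etale)
    {o : A →ₐ[𝕜] 𝕜} (ho : ∀ i, o (x i) = 0) (hirr : ∀ i, (Ideal.span {x i}).IsPrime)
    (p : Word k) : RingHom.Flat (R := Polynomial 𝕜)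
      (S := Polynomial (ChartRing A k) ⧸ familyIdeal 𝕜 x p) (familyMap 𝕜 x p) := by
  refine flat_of_forall_mul_eq_zero (R := Polynomial 𝕜)
    (S := Polynomial (ChartRing A k) ⧸ familyIdeal 𝕜 x p) (familyMap 𝕜 x p) fun g F hg0 hgF => ?_
  obtain ⟨F, rfl⟩ := Ideal.Quotient.mk_surjective F
  have h : Polynomial.mapRingHom (algebraMap 𝕜 (ChartRing A k)) g * F ∈ familyIdeal 𝕜 x p := by
    rw [← Ideal.Quotient.eq_zero_iff_mem, map_mul]
    exact hgF
  rw [Ideal.Quotient.eq_zero_iff_mem, mem_familyIdeal_iff hx ho hirr]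
  rw [mem_familyIdeal_iff hx ho hirr, Polynomial.eval_mul] at h
  have hev : (Polynomial.mapRingHom (algebraMap 𝕜 (ChartRing A k)) g).eval (C (x 0 * x 1)) =
      C (Polynomial.aeval (x 0 * x 1) g) := by
    rw [Polynomial.coe_mapRingHom, Polynomial.eval_map, ← Polynomial.aeval_def,
      ← MvPolynomial.algebraMap_eq, Polynomial.aeval_algebraMap_apply]
  rw [hev] at h
  obtain ⟨q, hq, hqb, hb⟩ := exists_generic hx p
  have h0 : q (C (Polynomial.aeval (x 0 * x 1) g) * F.eval (C (x 0 * x 1))) = 0 :=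
    (Ideal.span_le (I := RingHom.ker q)).2 hq.2 h
  refine mem_span_pos_of_eq_zero hirr (coord_rev_not_mem hx ho) hq hb ?_
  rw [map_mul, ← ChartPt.base_apply, hqb] at h0
  obtain ⟨a, s, hs⟩ := IsLocalization.exists_mk'_eq (Submonoid.powers (x 0 * x 1))
    (q (F.eval (C (x 0 * x 1))))
  rw [← hs, ← IsLocalization.mk'_one (M := Submonoid.powers (x 0 * x 1))
    (Localization.Away (x 0 * x 1)), ← IsLocalization.mk'_mul, IsLocalization.mk'_eq_zero_iff] at h0
  obtain ⟨c, hc⟩ := h0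
  have hc0 := (exists_generic.powers_le_nonZeroDivisors_of_mem hx) c.2
  have := (mem_nonZeroDivisors_iff.1 hc0).1 _ hc
  rw [← hs, eq_zero_of_polynomial_mul_eq_zero hx hg0 this, IsLocalization.mk'_zero]

end Family

/-! ### Ideals of the coordinate axes -/

section Coordinates

variable {A : Type v} [CommRing A] {k : ℕ} {x : Fin 2 → A}

theorem pull_ne_last [Nontrivial A] (f : ChartRing A k) : pull k f ≠ X (Fin.last k) := by
  intro h
  have h1 := congrArg (evalLastZero k) h
  rw [evalLastZero_pull, evalLastZero_last] at h1
  rw [h1, map_zero] at h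
  exact MvPolynomial.X_ne_zero _ h.symm

theorem coords_succ (x : Fin 2 → A) (k : ℕ) :
    coords x (k + 1) = insert (X (Fin.last k)) (pull k '' coords x k) := by
  ext f
  simp only [coords, Set.mem_union, Set.mem_range, Set.mem_insert_iff, Set.mem_image]
  constructor
  · rintro (⟨i, rfl⟩ | ⟨j, rfl⟩)
    · exact Or.inr ⟨_, Or.inl ⟨i, rfl⟩, pull_C _⟩
    · refine Fin.lastCases (Or.inl rfl) (fun j => ?_) j
      exact Or.inr ⟨_, Or.inr ⟨j, rfl⟩, pull_X _⟩
  · rintro (rfl | ⟨_, ⟨i, rfl⟩ | ⟨j, rfl⟩, rfl⟩)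
    · exact Or.inr ⟨_, rfl⟩
    · exact Or.inl ⟨i, (pull_C _).symm⟩
    · exact Or.inr ⟨_, (pull_X _).symm⟩

theorem coords_zero (x : Fin 2 → A) : coords x 0 = Set.range fun i => C (x i) := by
  simp [coords]

theorem active_zero (x : Fin 2 → A) (p : Word 0) (i : Fin 2) : active x 0 p i = C (x i) := rfl

theorem active_mem_coords (p : Word k) (i : Fin 2) : active x k p i ∈ coords x k := by
  induction k generalizing i with
  | zero => rw [coords_zero]; exact ⟨i, rfl⟩
  | succ k ih =>
    rw [coords_succ]
    revert i
    rw [forall_fin_two_iff p.final, active_final, active_rev_final]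
    exact ⟨Or.inr ⟨_, ih _ _, rfl⟩, Or.inl rfl⟩

theorem active_rev_ne [Nontrivial A] (hne : ∀ i, x (Fin.rev i) ≠ x i) (p : Word k) (i : Fin 2) :
    active x k p (Fin.rev i) ≠ active x k p i := by
  cases k with
  | zero => rw [active_zero, active_zero]; exact fun h => hne i (MvPolynomial.C_injective _ _ h)
  | succ k =>
    revert i
    rw [forall_fin_two_iff p.final, Fin.rev_rev, active_final, active_rev_final]
    exact ⟨(pull_ne_last _).symm, pull_ne_last _⟩

theorem coords_diff_final [Nontrivial A] (p : Word (k + 1)) :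
    coords x (k + 1) \ {active x (k + 1) p p.final} =
      insert (X (Fin.last k)) (pull k '' (coords x k \ {active x k p.trunc p.final})) := by
  rw [active_final, coords_succ, Set.insert_sdiff_of_notMem _ (fun h => pull_ne_last _ h.symm),
    Set.image_sdiff pull_injective, Set.image_singleton]

theorem coords_diff_rev_final [Nontrivial A] (p : Word (k + 1)) :
    coords x (k + 1) \ {active x (k + 1) p (Fin.rev p.final)} = pull k '' coords x k := by
  rw [active_rev_final, coords_succ, Set.insert_sdiff_self_of_notMem]
  rintro ⟨f, -, hf⟩
  exact pull_ne_last f hf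

theorem coords_diff_zero (hne : ∀ i, x (Fin.rev i) ≠ x i) (p : Word 0) (i : Fin 2) :
    coords x 0 \ {active x 0 p i} = {C (x (Fin.rev i))} := by
  have h : (Set.range fun i => (C (x i) : ChartRing A 0)) = {C (x i), C (x (Fin.rev i))} := by
    ext f
    simp only [Set.mem_range, Set.mem_insert_iff, Set.mem_singleton_iff]
    constructor
    · rintro ⟨j, rfl⟩
      rcases eq_or_eq_rev j i with rfl | rfl <;> simp
    · rintro (rfl | rfl) <;> simp
  rw [coords_zero, active_zero, h, Set.insert_sdiff_self_of_notMem]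
  intro h'
  exact hne i (MvPolynomial.C_injective _ _ (Set.mem_singleton_iff.1 h').symm)

/-- With `span_pull_image`, this turns primality of an axis ideal into primality one level down: the
retained axis is the axis below with n = 0, and the new axis is a line over the origin. -/
theorem span_insert_last (s : Set (ChartRing A k)) :
    Ideal.span (insert (X (Fin.last k)) (pull k '' s)) =
      (Ideal.span s).comap (evalLastZero k) := by
  refine le_antisymm (Ideal.span_le.2 ?_) fun f hf => ?_
  · rw [Set.insert_subset_iff, Set.image_subset_iff]
    refine ⟨by simp, fun g hg => ?_⟩
    simpa using Ideal.subset_span hg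
  · have h1 := Ideal.mem_map_of_mem (pull k) (Ideal.mem_comap.1 hf)
    rw [Ideal.map_span] at h1
    have h2 := Ideal.span_mono (Set.subset_insert (X (Fin.last k)) _) h1
    have h3 := Ideal.span_mono (Set.singleton_subset_iff.2 (Set.mem_insert _ (pull k '' s)))
      (sub_pull_evalLastZero_mem f)
    simpa using add_mem h3 h2

theorem span_pull_image (s : Set (ChartRing A k)) :
    Ideal.span (pull k '' s) = ((Ideal.span s).map Polynomial.C).comap (toPoly k) := by
  refine le_antisymm (Ideal.span_le.2 ?_) fun f hf => ?_
  · rw [Set.image_subset_iff]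
    intro g hg
    simpa using Ideal.mem_map_of_mem Polynomial.C (Ideal.subset_span hg)
  · have h : (Ideal.span s).map Polynomial.C ≤ (Ideal.span (pull k '' s)).comap (ofPoly k) := by
      rw [Ideal.map_le_iff_le_comap, Ideal.span_le]
      intro g hg
      simpa using Ideal.subset_span (Set.mem_image_of_mem (pull k) hg)
    simpa using h hf

variable {𝕜 : Type u} [Field 𝕜] [Algebra 𝕜 A]

theorem isPrime_span_coords [IsAlgClosed 𝕜]
    (hx : (MvPolynomial.aeval x : MvPolynomial (Fin 2) 𝕜 →ₐ[𝕜] A).toRingHom.Etale)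
    {o : A →ₐ[𝕜] 𝕜} (ho : ∀ b : A →ₐ[𝕜] 𝕜, (∀ i, b (x i) = 0) ↔ b = o) (k : ℕ) :
    (Ideal.span (coords x k)).IsPrime := by
  induction k with
  | zero =>
    have : Ideal.span (coords x 0) = (RingHom.ker o).comap MvPolynomial.constantCoeff := by
      rw [coords_zero]
      refine le_antisymm (Ideal.span_le.2 ?_) fun f hf => ?_
      · rintro _ ⟨i, rfl⟩
        simpa using (ho o).2 rfl i
      · obtain ⟨a, rfl⟩ : ∃ a, f = C a := ⟨_, MvPolynomial.eq_C_of_isEmpty f⟩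
        have h := Ideal.mem_map_of_mem (C : A →+* ChartRing A 0)
          (ker_eq_span hx ho (a := a) (by simpa using hf))
        rwa [Ideal.map_span, ← Set.range_comp] at h
    rw [this]
    have := RingHom.ker_isPrime o
    exact Ideal.IsPrime.comap _
  | succ k ih =>
    rw [coords_succ, span_insert_last]
    exact Ideal.IsPrime.comap _

theorem isPrime_span_coords_diff [IsAlgClosed 𝕜]
    (hx : (MvPolynomial.aeval x : MvPolynomial (Fin 2) 𝕜 →ₐ[𝕜] A).toRingHom.Etale)
    {o : A →ₐ[𝕜] 𝕜} (ho : ∀ b : A →ₐ[𝕜] 𝕜, (∀ i, b (x i) = 0) ↔ b = o)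
    (hirr : ∀ i, (Ideal.span {x i}).IsPrime) (p : Word k) (i : Fin 2) :
    (Ideal.span (coords x k \ {active x k p i})).IsPrime ∧
      active x k p i ∉ Ideal.span (coords x k \ {active x k p i}) := by
  have : Nontrivial A := o.toRingHom.domain_nontrivial
  have ho' := (ho o).2 rfl
  induction k generalizing i with
  | zero =>
    rw [coords_diff_zero (fun i => coord_ne hx ho' (rev_ne i))]
    have : Ideal.span {(C (x (Fin.rev i)) : ChartRing A 0)} =
        (Ideal.span {x (Fin.rev i)}).comap MvPolynomial.constantCoeff := by
      refine le_antisymm (Ideal.span_le.2 ?_) fun f hf => ?_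
      · rintro _ rfl
        simp
      · obtain ⟨a, rfl⟩ : ∃ a, f = C a := ⟨_, MvPolynomial.eq_C_of_isEmpty f⟩
        have h := Ideal.mem_map_of_mem (C : A →+* ChartRing A 0)
          (show a ∈ Ideal.span {x (Fin.rev i)} by simpa using hf)
        rwa [Ideal.map_span, Set.image_singleton] at h
    rw [this]
    have := hirr (Fin.rev i)
    refine ⟨Ideal.IsPrime.comap _, ?_⟩
    rw [active_zero, Ideal.mem_comap, MvPolynomial.constantCoeff_C]
    exact coord_not_mem_span hx ho' (rev_ne i).symm
  | succ k ih =>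
    rcases eq_or_eq_rev i p.final with rfl | rfl
    · obtain ⟨h1, h2⟩ := ih p.trunc p.final
      rw [coords_diff_final, span_insert_last, active_final]
      exact ⟨Ideal.IsPrime.comap _, by rwa [Ideal.mem_comap, evalLastZero_pull]⟩
    · have := isPrime_span_coords hx ho k
      rw [coords_diff_rev_final, span_pull_image, active_rev_final]
      have := Ideal.isPrime_map_C_of_isPrime (P := Ideal.span (coords x k))
      refine ⟨Ideal.IsPrime.comap _, ?_⟩
      rw [Ideal.mem_comap, toPoly_last, Ideal.mem_map_C_iff]
      intro h
      have h1 := h 1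
      rw [Polynomial.coeff_X_one] at h1
      exact (isPrime_span_coords hx ho k).ne_top ((Ideal.eq_top_iff_one _).2 h1)

end Coordinates

/-! ### Axes: focal tangents, prolongation and gluing -/

section Axes

variable {𝕜 : Type u} [Field 𝕜] {A : Type v} [CommRing A] [Algebra 𝕜 A] {k : ℕ} {x : Fin 2 → A}
  {R : Type w} [CommRing R] [Algebra 𝕜 R]

/-- The axis of the active coordinate with index `i`. -/
def axis (x : Fin 2 → A) (p : Word k) (i : Fin 2) : Set (ChartPt 𝕜 A k R) :=
  {q | ∀ c ∈ coords x k \ {active x k p i}, q c = 0}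

/-- The point `q` is the origin of its chart. -/
def IsOrigin (x : Fin 2 → A) (q : ChartPt 𝕜 A k R) : Prop :=
  ∀ c ∈ coords x k, q c = 0

theorem IsOrigin.mem_axis {q : ChartPt 𝕜 A k R} (h : IsOrigin x q) (p : Word k) (i : Fin 2) :
    q ∈ axis x p i := fun c hc => h c hc.1

theorem isOrigin_iff {p : Word k} {i : Fin 2} {q : ChartPt 𝕜 A k R} :
    IsOrigin x q ↔ q ∈ axis x p i ∧ q (active x k p i) = 0 := by
  refine ⟨fun h => ⟨h.mem_axis p i, h _ (active_mem_coords p i)⟩, fun h c hc => ?_⟩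
  by_cases hci : c = active x k p i
  · rw [hci, h.2]
  · exact h.1 c ⟨hc, hci⟩

theorem mem_axis_final [Nontrivial A] {p : Word (k + 1)} {q : ChartPt 𝕜 A (k + 1) R} :
    q ∈ axis x p p.final ↔ q.proj ∈ axis x p.trunc p.final ∧ q (X (Fin.last k)) = 0 := by
  rw [axis, Set.mem_ofPred_eq, coords_diff_final, Set.forall_mem_insert, Set.forall_mem_image,
    and_comm]
  rfl

theorem mem_axis_rev_final [Nontrivial A] {p : Word (k + 1)} {q : ChartPt 𝕜 A (k + 1) R} :
    q ∈ axis x p (Fin.rev p.final) ↔ IsOrigin x q.proj := by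
  rw [axis, Set.mem_ofPred_eq, coords_diff_rev_final, Set.forall_mem_image]
  rfl

theorem active_rev_eq_zero [Nontrivial A] (hne : ∀ i, x (Fin.rev i) ≠ x i) {p : Word k}
    {i : Fin 2} {q : ChartPt 𝕜 A k R} (h : q ∈ axis x p i) :
    q (active x k p (Fin.rev i)) = 0 :=
  h _ ⟨active_mem_coords p _, active_rev_ne hne p i⟩

theorem isOrigin_iff_mem_axis_rev [Nontrivial A] (hne : ∀ i, x (Fin.rev i) ≠ x i) {p : Word k}
    {i : Fin 2} {q : ChartPt 𝕜 A k R} :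
    IsOrigin x q ↔ q ∈ axis x p i ∧ q ∈ axis x p (Fin.rev i) := by
  refine ⟨fun h => ⟨h.mem_axis _ _, h.mem_axis _ _⟩, fun h => ?_⟩
  exact isOrigin_iff.2 ⟨h.1, by simpa using active_rev_eq_zero hne h.2⟩

/-- The common zeros of the node binomials are the two axes. -/
theorem forall_nodeBinomials_iff [CharZero 𝕜] [Nontrivial A] (hne : ∀ i, x (Fin.rev i) ≠ x i)
    {p : Word k} {q : ChartPt 𝕜 A k 𝕜} :
    (∀ f ∈ nodeBinomials x k p, q f = 0) ↔ ∃ i, q ∈ axis x p i := by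
  induction k with
  | zero =>
    have h (i : Fin 2) : q ∈ axis x p i ↔ q (C (x (Fin.rev i))) = 0 := by
      rw [axis, Set.mem_ofPred_eq, coords_diff_zero hne]
      simp
    simp only [h, nodeBinomials, nodeBinomial, Set.mem_singleton_iff, forall_eq, map_mul,
      mul_eq_zero]
    rw [Fin.exists_fin_two, or_comm]
    rfl
  | succ k ih =>
    rw [nodeBinomials, Set.forall_mem_insert, Set.forall_mem_image]
    change _ ∧ (∀ ⦃f⦄, f ∈ nodeBinomials x k p.trunc → q.proj f = 0) ↔ _
    rw [ih]
    have hex (P : Fin 2 → Prop) (s : Fin 2) : (∃ i, P i) ↔ P s ∨ P (Fin.rev s) :=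
      ⟨fun ⟨i, hi⟩ => by rcases eq_or_eq_rev i s with rfl | rfl; exacts [Or.inl hi, Or.inr hi],
        fun h => h.elim (fun h => ⟨_, h⟩) fun h => ⟨_, h⟩⟩
    rw [hex _ p.final, hex _ p.final, mem_axis_final, mem_axis_rev_final, nodeBinomial_succ]
    simp only [map_add, map_mul, map_natCast, ← ChartPt.proj_apply]
    have hw (i : Fin 2) : (weight k p.trunc i : 𝕜) ≠ 0 :=
      Nat.cast_ne_zero.2 (weight_pos _ _).ne'
    constructor
    -- Over the axis d = 0 the binomial reads w(r)·n·r = 0, so n = 0 or the point lies over the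
    -- origin; over the axis r = 0 it forces d = 0.
    · rintro ⟨h, h1 | h1⟩
      · have h2 := active_rev_eq_zero hne h1
        rw [h2, mul_zero, add_zero, mul_eq_zero, or_iff_right (hw _), mul_eq_zero] at h
        rcases h with h | h
        · exact Or.inl ⟨h1, h⟩
        · exact Or.inr (isOrigin_iff.2 ⟨h1, h⟩)
      · have h2 := active_rev_eq_zero hne h1
        rw [Fin.rev_rev] at h2
        rw [h2, mul_zero, mul_zero, zero_add, mul_eq_zero, or_iff_right (hw _)] at h
        exact Or.inr (isOrigin_iff.2 ⟨h1, h⟩)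
    · rintro (⟨h1, h⟩ | h)
      · refine ⟨?_, Or.inl h1⟩
        rw [active_rev_eq_zero hne h1, h]
        ring
      · refine ⟨?_, Or.inl (h.mem_axis _ _)⟩
        rw [h _ (active_mem_coords p.trunc p.final), h _ (active_mem_coords p.trunc _)]
        ring

theorem isFocal_of_mem_axis [Nontrivial A] (hne : ∀ i, x (Fin.rev i) ≠ x i) {p : Word k}
    {i : Fin 2} {τ : ChartPt 𝕜 A k (DualNumber R)} (h : τ ∈ axis x p i) : IsFocal x k p τ := by
  induction k generalizing i with
  | zero => exact isFocal_zero _ _ _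
  | succ k ih =>
    rw [isFocal_succ]
    rcases eq_or_eq_rev i p.final with rfl | rfl
    · rw [mem_axis_final] at h
      refine ⟨ih h.1, ?_⟩
      rw [ChartPt.diff_def, active_rev_eq_zero hne h.1, ChartPt.foot_apply, h.2]
      simp
    · rw [mem_axis_rev_final] at h
      refine ⟨ih (h.mem_axis _ 0), ?_⟩
      rw [ChartPt.diff_def, ChartPt.diff_def, h _ (active_mem_coords _ _),
        h _ (active_mem_coords _ _)]
      simp

/-- Descending the tower, the focal equations propagate the vanishing of one active differential to
the differentials of all coordinates off the axis. -/
theorem mem_axis_of_isFocal [Nontrivial A] (hne : ∀ i, x (Fin.rev i) ≠ x i) {p : Word k}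
    {i : Fin 2} {τ : ChartPt 𝕜 A k (DualNumber R)} (h : IsFocal x k p τ)
    (hfoot : τ.foot ∈ axis x p i) (hd : τ.diff (active x k p (Fin.rev i)) = 0) :
    τ ∈ axis x p i := by
  induction k generalizing i with
  | zero =>
    rw [axis, Set.mem_ofPred_eq, coords_diff_zero hne] at hfoot ⊢
    rintro _ rfl
    ext
    · exact hfoot _ rfl
    · exact hd
  | succ k ih =>
    rw [isFocal_succ] at h
    rcases eq_or_eq_rev i p.final with rfl | rfl
    · rw [mem_axis_final] at hfoot ⊢
      rw [active_rev_final] at hd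
      refine ⟨ih h.1 hfoot.1 (by rw [h.2, hfoot.2, zero_mul]), ?_⟩
      ext
      · exact hfoot.2
      · exact hd
    · rw [mem_axis_rev_final] at hfoot ⊢
      rw [Fin.rev_rev, active_final] at hd
      have hd' : τ.proj.diff (active x k p.trunc p.final) = 0 := hd
      refine isOrigin_iff.2 ⟨ih h.1 (i := p.final) (IsOrigin.mem_axis hfoot _ _)
        (by rw [h.2, hd', mul_zero]), ?_⟩
      ext
      · exact hfoot _ (active_mem_coords _ _)
      · exact hd'

theorem idealOf_of_inChart_eq_axis [IsAlgClosed 𝕜]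
    (hx : (MvPolynomial.aeval x : MvPolynomial (Fin 2) 𝕜 →ₐ[𝕜] A).toRingHom.Etale)
    {o : A →ₐ[𝕜] 𝕜} (ho : ∀ b : A →ₐ[𝕜] 𝕜, (∀ i, b (x i) = 0) ↔ b = o)
    (hirr : ∀ i, (Ideal.span {x i}).IsPrime) {p : Word k} {i : Fin 2} {Z : Set (Space 𝕜 x k)}
    (hZ : inChart p Z = axis x p i) :
    idealOf p Z = Ideal.span (coords x k \ {active x k p i}) := by
  have := finiteType_of_etale hx
  have : Algebra.FiniteType 𝕜 (ChartRing A k) :=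
    Algebra.FiniteType.trans (S := A) inferInstance inferInstance
  ext f
  rw [mem_idealOf, hZ]
  constructor
  · intro h
    refine mem_of_forall_point (𝕜 := 𝕜)
      (isPrime_span_coords_diff hx ho hirr p i).1.isRadical fun q hq => h q fun c hc => ?_
    exact hq c (Ideal.subset_span hc)
  · intro h q hq
    exact (Ideal.span_le (I := RingHom.ker q)).2 hq h

/-- The axis ideal is generated by coordinates, so tangent vectors of the reduced axis are its
R[ε]-points, and these can be recognised among focal vectors by one active differential. -/
theorem tangentSpace_of_inChart_eq_axis [IsAlgClosed 𝕜]
    (hx : (MvPolynomial.aeval x : MvPolynomial (Fin 2) 𝕜 →ₐ[𝕜] A).toRingHom.Etale)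
    {o : A →ₐ[𝕜] 𝕜} (ho : ∀ b : A →ₐ[𝕜] 𝕜, (∀ i, b (x i) = 0) ↔ b = o)
    (hirr : ∀ i, (Ideal.span {x i}).IsPrime) {p : Word k} {i : Fin 2} {Z : Set (Space 𝕜 x k)}
    (hZ : inChart p Z = axis x p i) {z : ChartPt 𝕜 A k 𝕜} (hz : z ∈ axis x p i) :
    tangentSpace p Z z =
      {τ | τ.foot = z ∧ IsFocal x k p τ ∧ τ.diff (active x k p (Fin.rev i)) = 0} := by
  have : Nontrivial A := o.toRingHom.domain_nontrivial
  have hne (i : Fin 2) : x (Fin.rev i) ≠ x i := coord_ne hx ((ho o).2 rfl) (rev_ne i)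
  ext τ
  rw [mem_tangentSpace, idealOf_of_inChart_eq_axis hx ho hirr hZ]
  constructor
  · rintro ⟨h1, h2⟩
    have h3 : τ ∈ axis x p i := fun c hc => h2 c (Ideal.subset_span hc)
    refine ⟨h1, isFocal_of_mem_axis hne h3, ?_⟩
    rw [ChartPt.diff_def, active_rev_eq_zero hne h3]
    rfl
  · rintro ⟨h1, h2, h3⟩
    have h4 : τ ∈ axis x p i := mem_axis_of_isFocal hne h2 (h1 ▸ hz) h3
    exact ⟨h1, fun f hf => (Ideal.span_le (I := RingHom.ker τ)).2 h4 hf⟩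

/-- The tangent lines of an axis form an axis one level higher. -/
theorem tangentSpace_eq_line_iff [IsAlgClosed 𝕜]
    (hx : (MvPolynomial.aeval x : MvPolynomial (Fin 2) 𝕜 →ₐ[𝕜] A).toRingHom.Etale)
    {o : A →ₐ[𝕜] 𝕜} (ho : ∀ b : A →ₐ[𝕜] 𝕜, (∀ i, b (x i) = 0) ↔ b = o)
    (hirr : ∀ i, (Ideal.span {x i}).IsPrime) {p : Word (k + 1)} {i : Fin 2}
    {Z : Set (Space 𝕜 x k)} (hZ : inChart p.trunc Z = axis x p.trunc i)
    {q : ChartPt 𝕜 A (k + 1) 𝕜} (hq : q.proj ∈ axis x p.trunc i) :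
    tangentSpace p.trunc Z q.proj = line x p q ↔ p.final = i ∧ q (X (Fin.last k)) = 0 := by
  rw [tangentSpace_of_inChart_eq_axis hx ho hirr hZ hq]
  constructor
  · intro h
    obtain ⟨τ, hτ, hd⟩ := exists_generator hx p q
    have h1 : τ.diff (active x k p.trunc (Fin.rev i)) = 0 := (h.symm ▸ hτ :).2.2
    have hi : i = p.final := by
      refine (eq_or_eq_rev i p.final).resolve_right ?_
      rintro rfl
      rw [Fin.rev_rev, hd] at h1
      exact one_ne_zero h1
    subst hi
    refine ⟨rfl, ?_⟩
    have := hτ.2.2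
    rw [h1, hd, mul_one] at this
    exact this.symm
  · rintro ⟨rfl, hn⟩
    ext τ
    rw [mem_line, hn, zero_mul]
    rfl

/-- Axes of charts with consecutive words are glued along inverse coordinates: the case of a
vertical curve. -/
theorem samePoint_vertical
    (hx : (MvPolynomial.aeval x : MvPolynomial (Fin 2) 𝕜 →ₐ[𝕜] A).toRingHom.Etale)
    {p p' : Word (k + 1)} (ht : p.trunc = p'.trunc) (hf : p'.final = Fin.rev p.final)
    {q q' : ChartPt 𝕜 A (k + 1) R} (hproj : q.proj = q'.proj)
    (h : q (X (Fin.last k)) * q' (X (Fin.last k)) = 1) : SamePoint x (k + 1) R p q p' q' := by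
  obtain ⟨τ, hτ, hd⟩ := exists_generator hx p q
  have h1 : τ.diff (active x k p'.trunc p'.final) = q (X (Fin.last k)) := by
    rw [hf, ← ht, hτ.2.2, hd, mul_one]
  -- One vector generates both lines: in the second chart r and d are exchanged, so the slope
  -- becomes its reciprocal.
  rw [samePoint_succ, ← hproj, ← ht]
  refine ⟨samePoint_refl hx _ _, τ, hτ, τ, ⟨hτ.1.trans hproj, ht ▸ hτ.2.1, ?_⟩, by simp [hd], ?_,
    samePoint_refl hx _ _⟩
  · rw [h1, hf, Fin.rev_rev, ← ht, hd, mul_comm, h]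
  · rw [ht, h1]
    exact IsUnit.of_mul_eq_one _ h

/-- Axes of charts with consecutive words are glued along inverse coordinates: the case of a
prolongation. -/
theorem samePoint_lift [Nontrivial A] (hne : ∀ i, x (Fin.rev i) ≠ x i)
    (hx : (MvPolynomial.aeval x : MvPolynomial (Fin 2) 𝕜 →ₐ[𝕜] A).toRingHom.Etale)
    {p p' : Word (k + 1)} {q q' : ChartPt 𝕜 A (k + 1) R}
    (ih : ∀ (S : Type w) [CommRing S] [Algebra 𝕜 S] (z z' : ChartPt 𝕜 A k S),
      z ∈ axis x p.trunc p.final → z' ∈ axis x p'.trunc p'.final →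
      z (active x k p.trunc p.final) * z' (active x k p'.trunc p'.final) = 1 →
      SamePoint x k S p.trunc z p'.trunc z')
    (hq : q ∈ axis x p p.final) (hq' : q' ∈ axis x p' p'.final)
    (h : q (active x (k + 1) p p.final) * q' (active x (k + 1) p' p'.final) = 1) :
    SamePoint x (k + 1) R p q p' q' := by
  rw [mem_axis_final] at hq hq'
  rw [active_final, active_final, ← ChartPt.proj_apply, ← ChartPt.proj_apply] at h
  obtain ⟨τ, hτ, hd⟩ := exists_generator hx p q
  obtain ⟨τ', hτ', hd'⟩ := exists_generator hx p' q'
  have hu := IsUnit.of_mul_eq_one_right _ h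
  set u := q'.proj (active x k p'.trunc p'.final) with hu_def
  -- If u = 1/v and dv = 1 then du = −u². With this scaling the R[ε]-valued coordinates are again
  -- inverse, so the hypothesis applies to the tangent vectors.
  have hl := tmap_mem_line hτ' (AlgHom.id 𝕜 R) (-(u * u))
  rw [show (AlgHom.id 𝕜 R).comp q' = q' from AlgHom.id_comp q'] at hl
  have ha : τ ∈ axis x p.trunc p.final :=
    mem_axis_of_isFocal hne hτ.2.1 (hτ.1 ▸ hq.1) (by rw [hτ.2.2, hq.2, zero_mul])
  have ha' : τ'.tmap (AlgHom.id 𝕜 R) (-(u * u)) ∈ axis x p'.trunc p'.final :=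
    mem_axis_of_isFocal hne hl.2.1 (hl.1 ▸ hq'.1) (by rw [hl.2.2, hq'.2, zero_mul])
  rw [samePoint_succ]
  refine ⟨ih R _ _ hq.1 hq'.1 h, τ, hτ, _, hl, by simp [hd], ?_, ih _ _ _ ha ha' ?_⟩
  · rw [ChartPt.tmap_diff, hd']
    simpa using hu.mul hu
  · have e1 : (τ (active x k p.trunc p.final)).fst = q.proj (active x k p.trunc p.final) :=
      AlgHom.congr_fun hτ.1 _
    have e2 : (τ (active x k p.trunc p.final)).snd = 1 := hd
    have e3 : (τ'.tmap (AlgHom.id 𝕜 R) (-(u * u)) (active x k p'.trunc p'.final)).fst = u :=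
      AlgHom.congr_fun hl.1 _
    have e4 : (τ'.tmap (AlgHom.id 𝕜 R) (-(u * u)) (active x k p'.trunc p'.final)).snd =
        -(u * u) := by
      have := ChartPt.tmap_diff τ' (AlgHom.id 𝕜 R) (-(u * u)) (active x k p'.trunc p'.final)
      rw [hd', map_one, mul_one] at this
      exact this
    ext
    · rw [TrivSqZeroExt.fst_mul, e1, e3, h]; rfl
    · rw [TrivSqZeroExt.snd_mul, e1, e2, e3, e4]
      simp only [smul_eq_mul, MulOpposite.smul_eq_mul_unop, MulOpposite.unop_op,
        TrivSqZeroExt.snd_one]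
      linear_combination (-u) * h

/-- The axis with index `i` lies over the origin of `U`. -/
def IsInterior : (k : ℕ) → Word k → Fin 2 → Prop
  | 0, _, _ => False
  | k + 1, p, i => i = p.final → IsInterior k p.trunc i

theorem exists_isOrigin {o : A →ₐ[𝕜] 𝕜} (ho : ∀ i, o (x i) = 0) :
    IsOrigin x (MvPolynomial.aevalTower o 0 : ChartPt 𝕜 A k 𝕜) := by
  rintro _ (⟨i, rfl⟩ | ⟨j, rfl⟩)
  · simpa using ho i
  · simp

theorem IsOrigin.eq {o : A →ₐ[𝕜] 𝕜} (ho : ∀ b : A →ₐ[𝕜] 𝕜, (∀ i, b (x i) = 0) ↔ b = o)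
    {q : ChartPt 𝕜 A k 𝕜} (h : IsOrigin x q) : q = MvPolynomial.aevalTower o 0 := by
  have hb : q.base = o := (ho _).1 fun i => h _ (Or.inl ⟨i, rfl⟩)
  refine ChartPt.ext_coords (fun a => ?_) fun j => ?_
  · rw [MvPolynomial.aevalTower_C, ← hb]; rfl
  · rw [MvPolynomial.aevalTower_X]
    exact h _ (Or.inr ⟨j, rfl⟩)

/-- An axis lying over `o` is an affine line with the active coordinate as parameter, also for
points over an arbitrary ring; polynomial values are needed later. -/
theorem exists_mem_axis [Nontrivial A] {o : A →ₐ[𝕜] 𝕜} (ho : ∀ i, o (x i) = 0) {p : Word k}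
    {i : Fin 2} (hi : IsInterior k p i) (c : R) :
    ∃ q : ChartPt 𝕜 A k R, q ∈ axis x p i ∧ q (active x k p i) = c := by
  induction k generalizing i with
  | zero => exact hi.elim
  | succ k ih =>
    rcases eq_or_eq_rev i p.final with rfl | rfl
    · obtain ⟨z, hz, hc⟩ := ih (hi rfl)
      refine ⟨z.extend 0, mem_axis_final.2 ⟨by rwa [ChartPt.proj_extend], by simp⟩, ?_⟩
      rw [active_final, ChartPt.extend_pull, hc]
    · refine ⟨ChartPt.extend ((Algebra.ofId 𝕜 R).comp (MvPolynomial.aevalTower o 0)) c,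
        mem_axis_rev_final.2 fun f hf => ?_, ?_⟩
      · rw [ChartPt.proj_extend, AlgHom.comp_apply, exists_isOrigin ho f hf, map_zero]
      · rw [active_rev_final, ChartPt.extend_last]

theorem axis_unique [Nontrivial A]
    {o : A →ₐ[𝕜] 𝕜} (ho : ∀ b : A →ₐ[𝕜] 𝕜, (∀ i, b (x i) = 0) ↔ b = o) {p : Word k}
    {i : Fin 2} (hi : IsInterior k p i) {q q' : ChartPt 𝕜 A k 𝕜} (hq : q ∈ axis x p i)
    (hq' : q' ∈ axis x p i) (h : q (active x k p i) = q' (active x k p i)) : q = q' := by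
  induction k generalizing i with
  | zero => exact hi.elim
  | succ k ih =>
    rcases eq_or_eq_rev i p.final with rfl | rfl
    · rw [mem_axis_final] at hq hq'
      rw [active_final] at h
      exact ChartPt.ext_succ (ih (hi rfl) hq.1 hq'.1 h) (hq.2.trans hq'.2.symm)
    · rw [mem_axis_rev_final] at hq hq'
      rw [active_rev_final] at h
      exact ChartPt.ext_succ ((hq.eq ho).trans (hq'.eq ho).symm) h

end Axes

/-! ### Binary words and the numbering of the twigs -/

section Words

variable {k : ℕ}

theorem Word.ext_succ {p p' : Word (k + 1)} (h : p.trunc = p'.trunc) (hf : p.final = p'.final) :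
    p = p' := by
  funext j
  exact Fin.lastCases hf (fun j => congrFun h j) j

/-- The word of length `k` with number `n` in the lexicographic order. -/
def chainWord : (k : ℕ) → ℕ → Word k
  | 0, _ => ![]
  | k + 1, n => Fin.snoc (α := fun _ => Fin 2) (chainWord k (n / 2)) (Fin.ofNat 2 n)

@[simp] theorem trunc_chainWord (n : ℕ) :
    (chainWord (k + 1) n).trunc = chainWord k (n / 2) := by
  funext j
  simp [Word.trunc, chainWord]

@[simp] theorem final_chainWord (n : ℕ) : (chainWord (k + 1) n).final = Fin.ofNat 2 n := by
  simp [Word.final, chainWord]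

theorem chainWord_injOn {a b : ℕ} (ha : a < 2 ^ k) (hb : b < 2 ^ k)
    (h : chainWord k a = chainWord k b) : a = b := by
  induction k generalizing a b with
  | zero => simp at ha hb; omega
  | succ k ih =>
    have h1 := ih (a := a / 2) (b := b / 2) (by omega) (by omega)
      (by simpa using congrArg Word.trunc h)
    have h2 := congrArg (fun p => (Word.final p).val) h
    simp only [final_chainWord, Fin.val_ofNat] at h2
    omega

theorem exists_chainWord (p : Word k) : ∃ n < 2 ^ k, p = chainWord k n := by
  induction k with
  | zero => exact ⟨0, by simp, Subsingleton.elim _ _⟩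
  | succ k ih =>
    obtain ⟨n, hn, h⟩ := ih p.trunc
    have hf := p.final.isLt
    refine ⟨2 * n + p.final, by omega, Word.ext_succ ?_ ?_⟩
    · rw [trunc_chainWord, h]
      congr 1
      omega
    · rw [final_chainWord]
      ext
      simp only [Fin.val_ofNat]
      omega

theorem chainWord_lt {a b : ℕ} (hb : b < 2 ^ k) (h : a < b) :
    toLex (chainWord k a) < toLex (chainWord k b) := by
  induction k generalizing a b with
  | zero => simp at hb; omega
  | succ k ih =>
    by_cases hab : a / 2 < b / 2
    · obtain ⟨i, hi, hlt⟩ := ih (by omega) hab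
      refine ⟨i.castSucc, fun j hj => ?_, ?_⟩
      · have hjk : j ≠ Fin.last k := fun h => by
          rw [h] at hj; exact absurd hj (not_lt.2 (Fin.le_last _))
        obtain ⟨j, rfl⟩ := Fin.exists_castSucc_eq.2 hjk
        have := hi j (by simpa using hj)
        simpa [chainWord] using this
      · simpa [chainWord] using hlt
    · have hab' : a / 2 = b / 2 := by omega
      refine ⟨Fin.last k, fun j hj => ?_, ?_⟩
      · obtain ⟨j, rfl⟩ := Fin.exists_castSucc_eq.2 hj.ne
        simp [chainWord, hab']
      · have h1 : (Fin.ofNat 2 a : Fin 2) < Fin.ofNat 2 b := by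
          rw [Fin.lt_def, Fin.val_ofNat, Fin.val_ofNat]
          omega
        simpa [chainWord] using h1

/-- The words of length `k` in lexicographic order. -/
noncomputable def chainOrderIso (k : ℕ) : Fin (2 ^ k) ≃o Lex (Word k) :=
  StrictMono.orderIsoOfSurjective (fun i => toLex (chainWord k i))
    (fun _ b h => chainWord_lt b.isLt h) fun p => by
      obtain ⟨n, hn, h⟩ := exists_chainWord (ofLex p)
      exact ⟨⟨n, hn⟩, congrArg toLex h.symm⟩

@[simp] theorem ofLex_chainOrderIso (i : Fin (2 ^ k)) :
    ofLex (chainOrderIso k i) = chainWord k i := rfl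

/-- The chart of the word `p` contains the twig with number `j` as the axis with index `i`. -/
def Carries (k j : ℕ) (p : Word k) (i : Fin 2) : Prop :=
  ∃ n < 2 ^ k, p = chainWord k n ∧ n + i = j

theorem Carries.index_unique {j : ℕ} {p : Word k} {i i' : Fin 2} (h : Carries k j p i)
    (h' : Carries k j p i') : i = i' := by
  obtain ⟨n, hn, rfl, h⟩ := h
  obtain ⟨n', hn', hp, h'⟩ := h'
  have := chainWord_injOn hn hn' hp
  omega

theorem Carries.word_unique {j : ℕ} {p p' : Word k} {i : Fin 2} (h : Carries k j p i)
    (h' : Carries k j p' i) : p = p' := by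
  obtain ⟨n, hn, rfl, h⟩ := h
  obtain ⟨n', hn', rfl, h'⟩ := h'
  congr 1
  omega

theorem Carries.index_of_succ {j : ℕ} {p : Word k} {i i' : Fin 2} (h : Carries k j p i)
    (h' : Carries k (j + 1) p i') : i = 0 := by
  obtain ⟨n, hn, rfl, h⟩ := h
  obtain ⟨n', hn', hp, h'⟩ := h'
  have := chainWord_injOn hn hn' hp
  omega

/-- If n + i = 2j, then n and i have the same parity, so the last letter retains coordinate i, and
⌊n/2⌋ + i = j: even twigs appear as retained axes. -/
theorem carries_even {j : ℕ} {p : Word (k + 1)} {i : Fin 2} :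
    Carries (k + 1) (2 * j) p i ↔ Carries k j p.trunc i ∧ p.final = i := by
  have hi := i.isLt
  constructor
  · rintro ⟨n, hn, rfl, h⟩
    refine ⟨⟨n / 2, by omega, by simp, by omega⟩, ?_⟩
    rw [final_chainWord]
    ext
    simp only [Fin.val_ofNat]
    omega
  · rintro ⟨⟨n, hn, hp, h⟩, hf⟩
    refine ⟨2 * n + i, by omega, Word.ext_succ ?_ ?_, by omega⟩
    · rw [trunc_chainWord, hp]
      congr 1
      omega
    · rw [hf, final_chainWord]
      ext
      simp only [Fin.val_ofNat]
      omega

/-- Here n and i have opposite parity and ⌊n/2⌋ = j: odd twigs are the new axes of the two charts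
above the j-th one. -/
theorem carries_odd {j : ℕ} {p : Word (k + 1)} {i : Fin 2} :
    Carries (k + 1) (2 * j + 1) p i ↔ j < 2 ^ k ∧ p.trunc = chainWord k j ∧ p.final = Fin.rev i := by
  have hi := i.isLt
  have hr : (Fin.rev i : ℕ) + i = 1 := by rw [Fin.val_rev]; omega
  constructor
  · rintro ⟨n, hn, rfl, h⟩
    refine ⟨by omega, ?_, ?_⟩
    · rw [trunc_chainWord]
      congr 1
      omega
    · rw [final_chainWord]
      ext
      simp only [Fin.val_ofNat]
      omega
  · rintro ⟨hj, hp, hf⟩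
    refine ⟨2 * j + Fin.rev i, by omega, Word.ext_succ ?_ ?_, by omega⟩
    · rw [trunc_chainWord, hp]
      congr 1
      omega
    · rw [hf, final_chainWord]
      ext
      simp only [Fin.val_ofNat]
      omega

theorem carries_zero {p : Word 0} {j : ℕ} {i : Fin 2} : Carries 0 j p i ↔ (i : ℕ) = j := by
  constructor
  · rintro ⟨n, hn, -, h⟩
    simp at hn
    omega
  · exact fun h => ⟨0, by simp, Subsingleton.elim _ _, by omega⟩

theorem val_rev_ne (i : Fin 2) : (Fin.rev i : ℕ) ≠ i := fun h => rev_ne i (Fin.ext h)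

/-- A twig seen with both indices cannot descend by halving to level 0, where each twig has only one
index; hence it comes from a vertical curve. -/
theorem Carries.isInterior {j : ℕ} {p p' : Word k} {i : Fin 2} (h : Carries k j p i)
    (h' : Carries k j p' (Fin.rev i)) : IsInterior k p i := by
  induction k generalizing j i with
  | zero =>
    rw [carries_zero] at h h'
    exact (val_rev_ne i (h'.trans h.symm)).elim
  | succ k ih =>
    intro hif
    obtain ⟨m, rfl | rfl⟩ := j.even_or_odd'
    · rw [carries_even] at h h'
      exact ih h.1 h'.1
    · rw [carries_odd] at h
      exact (rev_ne i (by rw [← h.2.2, ← hif])).elim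

end Words

/-! ### The twigs in the charts -/

section Twigs

variable {𝕜 : Type u} [Field 𝕜] {A : Type v} [CommRing A] [Algebra 𝕜 A] {k : ℕ} {x : Fin 2 → A}

/-- Two charts meet along the axes that belong to the same twig, and the coordinates on these axes
are inverse to each other. -/
theorem samePoint_of_carries [Nontrivial A] (hne : ∀ i, x (Fin.rev i) ≠ x i)
    (hx : (MvPolynomial.aeval x : MvPolynomial (Fin 2) 𝕜 →ₐ[𝕜] A).toRingHom.Etale)
    (hO : ∀ (S : Type w) [CommRing S] [Algebra 𝕜 S] (k : ℕ) (z z' : ChartPt 𝕜 A k S),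
      IsOrigin x z → IsOrigin x z' → z = z')
    {R : Type w} [CommRing R] [Algebra 𝕜 R] {j : ℕ} {p p' : Word k} {i : Fin 2}
    (h : Carries k j p i) (h' : Carries k j p' (Fin.rev i)) {q q' : ChartPt 𝕜 A k R}
    (hq : q ∈ axis x p i) (hq' : q' ∈ axis x p' (Fin.rev i))
    (hu : q (active x k p i) * q' (active x k p' (Fin.rev i)) = 1) :
    SamePoint x k R p q p' q' := by
  induction k generalizing R j i with
  | zero =>
    rw [carries_zero] at h h'
    exact (val_rev_ne i (h'.trans h.symm)).elim
  | succ k ih =>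
    -- Even twigs glue as prolongations of twigs glued one level below, odd ones as fibres over a
    -- single point; `hO` says that the two origins below coincide.
    obtain ⟨m, rfl | rfl⟩ := j.even_or_odd'
    · rw [carries_even] at h h'
      obtain ⟨h, rfl⟩ := h
      obtain ⟨h', hf'⟩ := h'
      rw [← hf'] at h' hq' hu
      refine samePoint_lift hne hx (fun S _ _ z z' hz hz' hzz => ?_) hq hq' hu
      rw [hf'] at h' hz' hzz
      exact ih h h' hz hz' hzz
    · rw [carries_odd] at h h'
      obtain ⟨-, ht, hf⟩ := h
      obtain ⟨-, ht', hf'⟩ := h'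
      rw [Fin.rev_rev] at hf'
      have hi : i = Fin.rev p.final := by rw [hf, Fin.rev_rev]
      rw [← hf] at hq' hu
      rw [hi] at hq hu
      have hfr : p.final = Fin.rev p'.final := by rw [hf, hf']
      rw [active_rev_final, hfr, active_rev_final] at hu
      rw [hfr] at hq'
      rw [mem_axis_rev_final] at hq hq'
      exact samePoint_vertical hx (ht.trans ht'.symm) (by rw [hfr, Fin.rev_rev])
        (hO _ _ _ _ hq hq') hu

/-- Converse of `samePoint_vertical`: a common generator has slopes dd/dr and dr/dd in the two
charts. -/
theorem SamePoint.mul_last_eq_one {R : Type w} [CommRing R] [Algebra 𝕜 R] {p p' : Word (k + 1)}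
    {q q' : ChartPt 𝕜 A (k + 1) R} (h : SamePoint x (k + 1) R p q p' q')
    (ht : p.trunc = p'.trunc) (hf : p'.final = Fin.rev p.final) :
    q (X (Fin.last k)) * q' (X (Fin.last k)) = 1 := by
  rw [samePoint_succ] at h
  obtain ⟨-, τ, hτ, τ', hτ', hu, -, hs⟩ := h
  rw [← ht] at hs
  obtain rfl := hs.eq
  have h1 := hτ.2.2
  have h2 := hτ'.2.2
  rw [hf, Fin.rev_rev, ← ht] at h2
  refine hu.mul_left_injective ?_
  change _ * _ = _ * _
  rw [one_mul, mul_comm (q _), mul_assoc, ← h1, ← h2]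

/-- Over a nonreduced ring it is not enough that `o` is the only common zero; the coordinates must
generate the whole ideal of `o`. -/
theorem IsOrigin.eq_of_isOrigin [IsAlgClosed 𝕜]
    (hx : (MvPolynomial.aeval x : MvPolynomial (Fin 2) 𝕜 →ₐ[𝕜] A).toRingHom.Etale)
    {o : A →ₐ[𝕜] 𝕜} (ho : ∀ b : A →ₐ[𝕜] 𝕜, (∀ i, b (x i) = 0) ↔ b = o)
    {R : Type w} [CommRing R] [Algebra 𝕜 R] {z z' : ChartPt 𝕜 A k R} (hz : IsOrigin x z)
    (hz' : IsOrigin x z') : z = z' := by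
  have key (z : ChartPt 𝕜 A k R) (hz : IsOrigin x z) (a : A) :
      z (C a) = algebraMap 𝕜 R (o a) := by
    have h1 : a - algebraMap 𝕜 A (o a) ∈ Ideal.span (Set.range x) :=
      ker_eq_span hx ho (by simp)
    have h2 : Ideal.span (Set.range x) ≤ RingHom.ker z.base := by
      rw [Ideal.span_le]
      rintro _ ⟨i, rfl⟩
      exact hz _ (Or.inl ⟨i, rfl⟩)
    have h3 : z.base (a - algebraMap 𝕜 A (o a)) = 0 := h2 h1
    rw [map_sub, AlgHom.commutes, sub_eq_zero] at h3
    exact h3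
  refine ChartPt.ext_coords (fun a => by rw [key z hz, key z' hz']) fun j => ?_
  rw [hz _ (Or.inr ⟨j, rfl⟩), hz' _ (Or.inr ⟨j, rfl⟩)]

/-- The twigs: interior twigs are vertical curves over the nodes below and their prolongations. -/
def twig (x : Fin 2 → A) (o : A →ₐ[𝕜] 𝕜) : (k : ℕ) → ℕ → Set (Space 𝕜 x k)
  | 0, n => zeroLocus x (if n = 0 then x 1 else x 0)
  | k + 1, n => if n % 2 = 0 then prolong (twig x o k (n / 2))
      else {P | P.proj = node x o (chainWord k (n / 2))}

theorem twig_even (o : A →ₐ[𝕜] 𝕜) (m : ℕ) :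
    twig x o (k + 1) (2 * m) = prolong (twig x o k m) := by
  simp [twig]

theorem twig_odd (o : A →ₐ[𝕜] 𝕜) (m : ℕ) :
    twig x o (k + 1) (2 * m + 1) = {P | P.proj = node x o (chainWord k m)} := by
  have h1 : (2 * m + 1) / 2 = m := by omega
  have h2 : (2 * m + 1) % 2 ≠ 0 := by omega
  rw [twig, if_neg h2, h1]

/-- The twigs as seen in the charts. -/
def TwigCharts (x : Fin 2 → A) (o : A →ₐ[𝕜] 𝕜) (k : ℕ) : Prop :=
  ∀ j ≤ 2 ^ k, ∀ (p : Word k) (q : ChartPt 𝕜 A k 𝕜),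
    Space.mk x p q ∈ twig x o k j ↔ ∃ i, Carries k j p i ∧ q ∈ axis x p i

/-- The n-th node lies on twigs n and n + 1, and only the n-th chart carries both; so a node is
visible in a single chart. -/
theorem TwigCharts.word_eq {o : A →ₐ[𝕜] 𝕜} (H : TwigCharts x o k) {p p' : Word k}
    {z z' : ChartPt 𝕜 A k 𝕜} (hz' : IsOrigin x z')
    (h : Space.mk x p z = Space.mk x p' z') : p = p' := by
  obtain ⟨n, hn, rfl⟩ := exists_chainWord p'
  have h1 := (H n hn.le _ z').2 ⟨0, ⟨n, hn, rfl, rfl⟩, hz'.mem_axis _ _⟩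
  have h2 := (H (n + 1) hn _ z').2 ⟨1, ⟨n, hn, rfl, rfl⟩, hz'.mem_axis _ _⟩
  rw [← h] at h1 h2
  obtain ⟨i, hc, -⟩ := (H n hn.le _ _).1 h1
  obtain ⟨i', hc', -⟩ := (H (n + 1) hn _ _).1 h2
  obtain rfl := hc.index_of_succ hc'
  exact hc.word_unique ⟨n, hn, rfl, rfl⟩

theorem TwigCharts.inChart {o : A →ₐ[𝕜] 𝕜} (H : TwigCharts x o k) {j : ℕ} {p : Word k} {i : Fin 2}
    (h : Carries k j p i) : inChart p (twig x o k j) = axis x p i := by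
  have hj : j ≤ 2 ^ k := by
    obtain ⟨n, hn, -, h⟩ := h
    omega
  ext q
  rw [mem_inChart, H j hj]
  constructor
  · rintro ⟨i', h', hq⟩
    rwa [h.index_unique h']
  · exact fun hq => ⟨i, h, hq⟩

theorem TwigCharts.isClosed {o : A →ₐ[𝕜] 𝕜} (H : TwigCharts x o k) {j : ℕ} (hj : j ≤ 2 ^ k) :
    IsClosed (twig x o k j) := by
  refine isClosed_of_forall_inChart fun p => ?_
  by_cases h : ∃ i, Carries k j p i
  · obtain ⟨i, h⟩ := h
    exact ⟨_, H.inChart h⟩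
  · refine ⟨{1}, ?_⟩
    ext q
    rw [mem_inChart, H j hj]
    simp only [Set.mem_singleton_iff, forall_eq, map_one, Set.mem_ofPred_eq, one_ne_zero, iff_false]
    rintro ⟨i, h', -⟩
    exact h ⟨i, h'⟩

/-- The chart description must be independent of the chart in which a point is seen. For fibres over
nodes this is `TwigCharts.word_eq`; for prolongations it is the gluing of axes by inverse
coordinates. -/
theorem twigCharts [IsAlgClosed 𝕜]
    (hx : (MvPolynomial.aeval x : MvPolynomial (Fin 2) 𝕜 →ₐ[𝕜] A).toRingHom.Etale)
    {o : A →ₐ[𝕜] 𝕜} (ho : ∀ b : A →ₐ[𝕜] 𝕜, (∀ i, b (x i) = 0) ↔ b = o)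
    (hirr : ∀ i, (Ideal.span {x i}).IsPrime) (k : ℕ) : TwigCharts x o k := by
  have : Nontrivial A := o.toRingHom.domain_nontrivial
  have ho' := (ho o).2 rfl
  have hne (i : Fin 2) : x (Fin.rev i) ≠ x i := coord_ne hx ho' (rev_ne i)
  induction k with
  | zero =>
    intro j hj p q
    have h0 (f : A) : Space.mk x p q ∈ zeroLocus x f ↔ q (C f) = 0 := by
      constructor
      · rintro ⟨q', h, h'⟩
        rw [Space.mk_eq_mk hx, samePoint_zero] at h
        rwa [h]
      · exact fun h => ⟨q, by rw [Subsingleton.elim p ![]], h⟩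
    have ha (i : Fin 2) : q ∈ axis x p i ↔ q (C (x (Fin.rev i))) = 0 := by
      rw [axis, Set.mem_ofPred_eq, coords_diff_zero hne]
      simp
    simp only [carries_zero, ha, twig, h0]
    have hj' : j = 0 ∨ j = 1 := by simp at hj; omega
    rw [Fin.exists_fin_two]
    rcases hj' with rfl | rfl <;> simp
  | succ k ih =>
    intro j hj p q
    obtain ⟨m, rfl | rfl⟩ := j.even_or_odd'
    · have hm : m ≤ 2 ^ k := by omega
      have hsame {p p' : Word (k + 1)} {q q' : ChartPt 𝕜 A (k + 1) 𝕜} {i : Fin 2}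
          (h : Space.mk x p q = Space.mk x p' q') (hc : Carries k m p.trunc i)
          (hc' : Carries (k + 1) (2 * m) p' i) (hq' : q' ∈ axis x p' i) :
          Carries (k + 1) (2 * m) p i ∧ q ∈ axis x p i := by
        rw [carries_even] at hc' ⊢
        obtain ⟨hc', rfl⟩ := hc'
        have ht := hc.word_unique hc'
        -- With different last letters the two new coordinates would be inverse to each other, but
        -- one is 0 on a prolonged axis.
        have hf : p.final = p'.final := by
          refine (eq_or_eq_rev p.final p'.final).resolve_right fun hf => ?_
          have := ((Space.mk_eq_mk hx).1 h).mul_last_eq_one ht (by rw [hf, Fin.rev_rev])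
          rw [mem_axis_final] at hq'
          rw [hq'.2, mul_zero] at this
          exact zero_ne_one this
        obtain rfl := Word.ext_succ ht hf
        obtain rfl := Space.mk_injective hx p h
        exact ⟨⟨hc', rfl⟩, hq'⟩
      have hchart {p p' : Word (k + 1)} {q q' : ChartPt 𝕜 A (k + 1) 𝕜} {i' : Fin 2}
          (h : Space.mk x p q = Space.mk x p' q')
          (hc' : Carries (k + 1) (2 * m) p' i') (hq' : q' ∈ axis x p' i') :
          ∃ i, Carries (k + 1) (2 * m) p i ∧ q ∈ axis x p i := by
        have hc0 := hc'
        have hq0 := hq'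
        rw [carries_even] at hc'
        obtain ⟨hc', hf'⟩ := hc'
        rw [← hf', mem_axis_final, hf'] at hq'
        have hproj : Space.mk x p.trunc q.proj = Space.mk x p'.trunc q'.proj :=
          congrArg Space.proj h
        have hmem := (ih m hm _ _).2 ⟨i', hc', hq'.1⟩
        rw [← hproj, ih m hm] at hmem
        obtain ⟨i, hc, hq⟩ := hmem
        rcases eq_or_eq_rev i' i with rfl | rfl
        · exact ⟨i', hsame h hc hc0 hq0⟩
        -- A node below is visible in one chart only, so it cannot occur here. Elsewhere the inverse
        -- coordinate gives the same point in the chart `p₁` over `p.trunc` with last letter i, and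
        -- `hsame` compares `p` with `p₁`.
        · by_cases hz : q'.proj (active x k p'.trunc (Fin.rev i)) = 0
          · have := ih.word_eq (isOrigin_iff.2 ⟨hq'.1, hz⟩) hproj
            rw [this] at hc
            exact (rev_ne i (hc'.index_unique hc)).elim
          · obtain ⟨z, hzi, hzc⟩ := exists_mem_axis ho' (hc.isInterior hc')
              (q'.proj (active x k p'.trunc (Fin.rev i)))⁻¹
            let p₁ : Word (k + 1) := Fin.snoc (α := fun _ => Fin 2) p.trunc i
            have ht₁ : p₁.trunc = p.trunc := by funext j; simp [p₁, Word.trunc]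
            have hf₁ : p₁.final = i := by simp [p₁, Word.final]
            have hc₁ : Carries (k + 1) (2 * m) p₁ i := carries_even.2 ⟨ht₁ ▸ hc, hf₁⟩
            have hq₁ : z.extend 0 ∈ axis x p₁ i := by
              rw [← hf₁, mem_axis_final, ChartPt.proj_extend, hf₁, ht₁]
              exact ⟨hzi, by simp⟩
            have hs : SamePoint x (k + 1) 𝕜 p₁ (z.extend 0) p' q' := by
              refine samePoint_of_carries hne hx
                (fun S _ _ k z z' hz hz' => hz.eq_of_isOrigin hx ho hz') hc₁ hc0 hq₁ hq0 ?_
              have e1 : z.extend 0 (active x (k + 1) p₁ i) =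
                  (q'.proj (active x k p'.trunc (Fin.rev i)))⁻¹ := by
                rw [← hzc]
                conv_lhs => rw [← hf₁, active_final, ChartPt.extend_pull, hf₁, ht₁]
              have e2 : q' (active x (k + 1) p' (Fin.rev i)) =
                  q'.proj (active x k p'.trunc (Fin.rev i)) := by
                conv_lhs => rw [← hf', active_final, hf']
                rfl
              rw [e1, e2, inv_mul_cancel₀ hz]
            exact ⟨i, hsame (h.trans ((Space.mk_eq_mk hx).2 hs).symm) hc hc₁ hq₁⟩
      -- The union of the expected axes is closed and consists exactly of the tangent lines of twig
      -- m; hence it is the prolongation.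
      let T : Set (Space 𝕜 x (k + 1)) := {P | ∃ p q, P = Space.mk x p q ∧
        ∃ i, Carries (k + 1) (2 * m) p i ∧ q ∈ axis x p i}
      have hT (p : Word (k + 1)) (q : ChartPt 𝕜 A (k + 1) 𝕜) : Space.mk x p q ∈ T ↔
          ∃ i, Carries (k + 1) (2 * m) p i ∧ q ∈ axis x p i := by
        constructor
        · rintro ⟨p', q', h, i', hc', hq'⟩
          exact hchart h hc' hq'
        · exact fun h => ⟨p, q, rfl, h⟩
      have hTc : IsClosed T := by
        refine isClosed_of_forall_inChart fun p => ?_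
        by_cases h : ∃ i, Carries (k + 1) (2 * m) p i
        · obtain ⟨i, h⟩ := h
          refine ⟨coords x (k + 1) \ {active x (k + 1) p i}, ?_⟩
          ext q
          rw [mem_inChart, hT]
          constructor
          · rintro ⟨i', h', hq⟩
            rwa [h.index_unique h']
          · exact fun hq => ⟨i, h, hq⟩
        · refine ⟨{1}, ?_⟩
          ext q
          rw [mem_inChart, hT]
          simp only [Set.mem_singleton_iff, forall_eq, map_one, Set.mem_ofPred_eq, one_ne_zero,
            iff_false]
          rintro ⟨i, h', -⟩
          exact h ⟨i, h'⟩
      have hTS : twig x o (k + 1) (2 * m) = T := by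
        rw [twig_even, prolong]
        convert! hTc.closure_eq using 2
        ext P
        constructor
        · rintro ⟨p, q, rfl, hmem, hl⟩
          obtain ⟨i, hc, hq⟩ := (ih m hm _ _).1 hmem
          rw [tangentSpace_eq_line_iff hx ho hirr (ih.inChart hc) hq] at hl
          obtain ⟨rfl, hn⟩ := hl
          exact ⟨p, q, rfl, p.final, carries_even.2 ⟨hc, rfl⟩, mem_axis_final.2 ⟨hq, hn⟩⟩
        · rintro ⟨p, q, rfl, i, hc, hq⟩
          rw [carries_even] at hc
          obtain ⟨hc, rfl⟩ := hc
          rw [mem_axis_final] at hq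
          exact ⟨p, q, rfl, (ih m hm _ _).2 ⟨_, hc, hq.1⟩,
            (tangentSpace_eq_line_iff hx ho hirr (ih.inChart hc) hq.1).2 ⟨rfl, hq.2⟩⟩
      rw [hTS, hT]
    · have hm : m < 2 ^ k := by omega
      rw [twig_odd, Set.mem_ofPred_eq, Space.proj_mk, node]
      have hO := exists_isOrigin (x := x) (k := k) ho'
      simp only [carries_odd]
      constructor
      · intro h
        have ht := ih.word_eq hO h
        rw [ht] at h
        have hq := Space.mk_injective hx _ h
        refine ⟨Fin.rev p.final, ⟨hm, ht, by rw [Fin.rev_rev]⟩, mem_axis_rev_final.2 ?_⟩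
        rw [hq]
        exact hO
      · rintro ⟨i, ⟨-, ht, hf⟩, hq⟩
        rw [← Fin.rev_rev i, ← hf, mem_axis_rev_final] at hq
        rw [ht, hq.eq ho]

end Twigs

/-- If g·b + h with h ∈ (s) lies in the prime (a, s), which does not contain b, then g ∈ (a, s).
This yields the node equation of two crossing axes. -/
theorem span_insert_inf_span_insert {R : Type u} [CommRing R] {s : Set R} {a b : R}
    (hp : (Ideal.span (insert a s)).IsPrime) (hb : b ∉ Ideal.span (insert a s)) :
    Ideal.span (insert b s) ⊓ Ideal.span (insert a s) = Ideal.span (insert (a * b) s) := by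
  have hs (c : R) : Ideal.span s ≤ Ideal.span (insert c s) := Ideal.span_mono (Set.subset_insert c s)
  refine le_antisymm ?_ (le_inf ?_ ?_)
  · rintro f ⟨h1, h2⟩
    obtain ⟨g, h, hh, rfl⟩ := Ideal.mem_span_insert.1 h1
    have h3 : g * b ∈ Ideal.span (insert a s) := (Ideal.add_mem_iff_left _ (hs a hh)).1 h2
    obtain ⟨g', h', hh', rfl⟩ := Ideal.mem_span_insert.1 ((hp.mem_or_mem h3).resolve_right hb)
    exact Ideal.mem_span_insert.2 ⟨g', h' * b + h, add_mem (Ideal.mul_mem_right _ _ hh') hh, by ring⟩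
  · refine Ideal.span_le.2 (Set.insert_subset ?_ ((Set.subset_insert _ _).trans Ideal.subset_span))
    exact Ideal.mul_mem_left _ _ (Ideal.subset_span (Set.mem_insert _ _))
  · refine Ideal.span_le.2 (Set.insert_subset ?_ ((Set.subset_insert _ _).trans Ideal.subset_span))
    exact Ideal.mul_mem_right _ _ (Ideal.subset_span (Set.mem_insert _ _))

/-! ### Components of the central fibre and their intersections -/

section Chain

variable {𝕜 : Type u} [Field 𝕜] {A : Type v} [CommRing A] [Algebra 𝕜 A] {k : ℕ} {x : Fin 2 → A}

theorem twig_first (o : A →ₐ[𝕜] 𝕜) (k : ℕ) :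
    twig x o k 0 = iterProlong (zeroLocus x (x 1)) k := by
  induction k with
  | zero => simp [twig, iterProlong]
  | succ k ih => rw [iterProlong, ← ih, ← twig_even]

theorem twig_last (o : A →ₐ[𝕜] 𝕜) (k : ℕ) :
    twig x o k (2 ^ k) = iterProlong (zeroLocus x (x 0)) k := by
  induction k with
  | zero => simp [twig, iterProlong]
  | succ k ih => rw [iterProlong, ← ih, ← twig_even, pow_succ']

theorem isProlongedVertical_twig (o : A →ₐ[𝕜] 𝕜) {j : ℕ} (h0 : 0 < j) (hj : j < 2 ^ k) :
    IsProlongedVertical (twig x o k j) := by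
  induction k generalizing j with
  | zero => simp at hj; omega
  | succ k ih =>
    obtain ⟨m, rfl | rfl⟩ := j.even_or_odd'
    · rw [twig_even]
      exact (ih (by omega) (by omega)).lift
    · rw [twig_odd]
      exact .vertical _

theorem exists_carries {j : ℕ} (hj : j ≤ 2 ^ k) : ∃ p i, Carries k j p i := by
  rcases hj.lt_or_eq with h | h
  · exact ⟨_, 0, j, h, rfl, rfl⟩
  · have := Nat.two_pow_pos k
    exact ⟨_, 1, j - 1, by omega, rfl, by simp; omega⟩

theorem not_mem_span_of_mem_axis {p : Word k} {i : Fin 2} {f : ChartRing A k}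
    {q : ChartPt 𝕜 A k 𝕜} (hq : q ∈ axis x p i) (hf : q f ≠ 0) :
    f ∉ Ideal.span (coords x k \ {active x k p i}) :=
  fun h => hf ((Ideal.span_le (I := RingHom.ker q)).2 hq h)

theorem forall_centralIdeal_iff [IsAlgClosed 𝕜]
    (hx : (MvPolynomial.aeval x : MvPolynomial (Fin 2) 𝕜 →ₐ[𝕜] A).toRingHom.Etale)
    {o : A →ₐ[𝕜] 𝕜} (ho : ∀ b : A →ₐ[𝕜] 𝕜, (∀ i, b (x i) = 0) ↔ b = o)
    (hirr : ∀ i, (Ideal.span {x i}).IsPrime)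
    [CharZero 𝕜] {p : Word k} {q : ChartPt 𝕜 A k 𝕜} :
    (∀ f ∈ centralIdeal 𝕜 x p, q f = 0) ↔ ∃ i, q ∈ axis x p i := by
  have : Nontrivial A := o.toRingHom.domain_nontrivial
  have ho' := (ho o).2 rfl
  rw [← forall_nodeBinomials_iff fun i => coord_ne hx ho' (rev_ne i), centralIdeal_eq hx ho' hirr p]
  exact ⟨fun h f hf => h f (Ideal.subset_span hf),
    fun h => (Ideal.span_le (I := RingHom.ker q)).2 h⟩

theorem mem_centralFiber_iff_exists_twig [IsAlgClosed 𝕜]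
    (hx : (MvPolynomial.aeval x : MvPolynomial (Fin 2) 𝕜 →ₐ[𝕜] A).toRingHom.Etale)
    {o : A →ₐ[𝕜] 𝕜} (ho : ∀ b : A →ₐ[𝕜] 𝕜, (∀ i, b (x i) = 0) ↔ b = o)
    (hirr : ∀ i, (Ideal.span {x i}).IsPrime)
    [CharZero 𝕜] {P : Space 𝕜 x k} :
    P ∈ centralFiber 𝕜 x k ↔ ∃ j ≤ 2 ^ k, P ∈ twig x o k j := by
  have H := twigCharts hx ho hirr k
  constructor
  · rintro ⟨p, q, rfl, h⟩
    obtain ⟨i, hi⟩ := (forall_centralIdeal_iff hx ho hirr).1 h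
    obtain ⟨n, hn, rfl⟩ := exists_chainWord p
    have hj : n + i ≤ 2 ^ k := by omega
    exact ⟨_, hj, (H _ hj _ _).2 ⟨i, ⟨n, hn, rfl, rfl⟩, hi⟩⟩
  · rintro ⟨j, hj, h⟩
    obtain ⟨p, q, rfl⟩ := Space.exists_mk P
    obtain ⟨i, -, hi⟩ := (H _ hj _ _).1 h
    exact ⟨p, q, rfl, (forall_centralIdeal_iff hx ho hirr).2 ⟨i, hi⟩⟩

/-- Membership asks for the equations in some chart only; the description by twigs shows that they
then hold in every chart containing the point. -/
theorem mk_mem_centralFiber_iff [IsAlgClosed 𝕜]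
    (hx : (MvPolynomial.aeval x : MvPolynomial (Fin 2) 𝕜 →ₐ[𝕜] A).toRingHom.Etale)
    {o : A →ₐ[𝕜] 𝕜} (ho : ∀ b : A →ₐ[𝕜] 𝕜, (∀ i, b (x i) = 0) ↔ b = o)
    (hirr : ∀ i, (Ideal.span {x i}).IsPrime)
    [CharZero 𝕜] {p : Word k} {q : ChartPt 𝕜 A k 𝕜} :
    Space.mk x p q ∈ centralFiber 𝕜 x k ↔ ∃ i, q ∈ axis x p i := by
  have H := twigCharts hx ho hirr k
  rw [mem_centralFiber_iff_exists_twig hx ho hirr]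
  constructor
  · rintro ⟨j, hj, h⟩
    obtain ⟨i, -, hi⟩ := (H _ hj _ _).1 h
    exact ⟨i, hi⟩
  · rintro ⟨i, hi⟩
    obtain ⟨n, hn, rfl⟩ := exists_chainWord p
    have hj : n + i ≤ 2 ^ k := by omega
    exact ⟨_, hj, (H _ hj _ _).2 ⟨i, ⟨n, hn, rfl, rfl⟩, hi⟩⟩

theorem idealOf_centralFiber [IsAlgClosed 𝕜]
    (hx : (MvPolynomial.aeval x : MvPolynomial (Fin 2) 𝕜 →ₐ[𝕜] A).toRingHom.Etale)
    {o : A →ₐ[𝕜] 𝕜} (ho : ∀ b : A →ₐ[𝕜] 𝕜, (∀ i, b (x i) = 0) ↔ b = o)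
    (hirr : ∀ i, (Ideal.span {x i}).IsPrime)
    [CharZero 𝕜] (p : Word k) :
    idealOf p (centralFiber 𝕜 x k) = Ideal.span (insert (active x k p 0 * active x k p 1)
      (coords x k \ {active x k p 0, active x k p 1})) := by
  have : Nontrivial A := o.toRingHom.domain_nontrivial
  have hne (i : Fin 2) : x (Fin.rev i) ≠ x i := coord_ne hx ((ho o).2 rfl) (rev_ne i)
  have H := twigCharts hx ho hirr k
  obtain ⟨n, hn, hp⟩ := exists_chainWord p
  have hI (i : Fin 2) := idealOf_of_inChart_eq_axis hx ho hirr
    (H.inChart (i := i) ⟨n, hn, hp, rfl⟩)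
  have h01 : active x k p 1 ≠ active x k p 0 := active_rev_ne hne p 0
  have h0 : coords x k \ {active x k p 0} =
      insert (active x k p 1) (coords x k \ {active x k p 0, active x k p 1}) := by
    ext c
    have := active_mem_coords (x := x) p 1
    simp only [Set.mem_sdiff, Set.mem_singleton_iff, Set.mem_insert_iff, not_or]
    by_cases hc : c = active x k p 1
    · simp [hc, h01, this]
    · simp [hc]
  have h1 : coords x k \ {active x k p 1} =
      insert (active x k p 0) (coords x k \ {active x k p 0, active x k p 1}) := by
    ext c
    have := active_mem_coords (x := x) p 0
    simp only [Set.mem_sdiff, Set.mem_singleton_iff, Set.mem_insert_iff, not_or]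
    by_cases hc : c = active x k p 0
    · simp [hc, h01.symm, this]
    · simp [hc]
  obtain ⟨hp1, hp2⟩ := isPrime_span_coords_diff hx ho hirr p 1
  rw [h1] at hp1 hp2
  rw [← span_insert_inf_span_insert hp1 hp2, ← h0, ← h1, ← hI, ← hI]
  ext f
  rw [Submodule.mem_inf, mem_idealOf, mem_idealOf, mem_idealOf,
    H.inChart (i := 0) ⟨n, hn, hp, rfl⟩, H.inChart (i := 1) ⟨n, hn, hp, rfl⟩]
  simp only [mem_inChart, mk_mem_centralFiber_iff hx ho hirr, Fin.exists_fin_two, or_imp,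
    forall_and]

theorem exists_mem_axis_ne_zero [IsAlgClosed 𝕜]
    (hx : (MvPolynomial.aeval x : MvPolynomial (Fin 2) 𝕜 →ₐ[𝕜] A).toRingHom.Etale)
    {o : A →ₐ[𝕜] 𝕜} (ho : ∀ b : A →ₐ[𝕜] 𝕜, (∀ i, b (x i) = 0) ↔ b = o)
    (hirr : ∀ i, (Ideal.span {x i}).IsPrime)
    {p : Word k} {i : Fin 2} {f : ChartRing A k}
    (hf : f ∉ Ideal.span (coords x k \ {active x k p i})) :
    ∃ q : ChartPt 𝕜 A k 𝕜, q ∈ axis x p i ∧ q f ≠ 0 := by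
  have := finiteType_of_etale hx
  have : Algebra.FiniteType 𝕜 (ChartRing A k) :=
    Algebra.FiniteType.trans (S := A) inferInstance inferInstance
  by_contra! h
  refine hf (mem_of_forall_point (𝕜 := 𝕜)
    (isPrime_span_coords_diff hx ho hirr p i).1.isRadical fun q hq => h q fun c hc => ?_)
  exact hq c (Ideal.subset_span hc)

theorem isPreirreducible_axis [IsAlgClosed 𝕜]
    (hx : (MvPolynomial.aeval x : MvPolynomial (Fin 2) 𝕜 →ₐ[𝕜] A).toRingHom.Etale)
    {o : A →ₐ[𝕜] 𝕜} (ho : ∀ b : A →ₐ[𝕜] 𝕜, (∀ i, b (x i) = 0) ↔ b = o)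
    (hirr : ∀ i, (Ideal.span {x i}).IsPrime)
    (p : Word k) (i : Fin 2) :
    IsPreirreducible (Space.mk x p '' axis x p i : Set (Space 𝕜 x k)) := by
  rintro U V hU hV ⟨_, ⟨q, hq, rfl⟩, hqU⟩ ⟨_, ⟨q', hq', rfl⟩, hqV⟩
  obtain ⟨f, hf, hfU⟩ := exists_of_isOpen hU hqU
  obtain ⟨g, hg, hgV⟩ := exists_of_isOpen hV hqV
  have hfg : f * g ∉ Ideal.span (coords x k \ {active x k p i}) := fun h =>
    ((isPrime_span_coords_diff hx ho hirr p i).1.mem_or_mem h).elim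
      (not_mem_span_of_mem_axis hq hf) (not_mem_span_of_mem_axis hq' hg)
  obtain ⟨z, hz, hfgz⟩ := exists_mem_axis_ne_zero hx ho hirr hfg
  rw [map_mul] at hfgz
  exact ⟨_, ⟨z, hz, rfl⟩, hfU z (left_ne_zero_of_mul hfgz), hgV z (right_ne_zero_of_mul hfgz)⟩

/-- Any point of the twig missing from one chart is visible in the other, on an irreducible axis;
nearby points with nonzero coordinate pass to the first chart by inversion. -/
theorem closure_axis [IsAlgClosed 𝕜]
    (hx : (MvPolynomial.aeval x : MvPolynomial (Fin 2) 𝕜 →ₐ[𝕜] A).toRingHom.Etale)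
    {o : A →ₐ[𝕜] 𝕜} (ho : ∀ b : A →ₐ[𝕜] 𝕜, (∀ i, b (x i) = 0) ↔ b = o)
    (hirr : ∀ i, (Ideal.span {x i}).IsPrime)
    {j : ℕ} {p : Word k} {i : Fin 2} (hc : Carries k j p i) :
    closure (Space.mk x p '' axis x p i : Set (Space 𝕜 x k)) = twig x o k j := by
  have : Nontrivial A := o.toRingHom.domain_nontrivial
  have hne (i : Fin 2) : x (Fin.rev i) ≠ x i := coord_ne hx ((ho o).2 rfl) (rev_ne i)
  have H := twigCharts hx ho hirr k
  have hj : j ≤ 2 ^ k := by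
    obtain ⟨n, hn, -, h⟩ := hc
    omega
  refine (closure_minimal ?_ (H.isClosed hj)).antisymm fun P hP => mem_closure_iff.2 fun U hU hPU => ?_
  · rintro _ ⟨q, hq, rfl⟩
    exact (H _ hj _ _).2 ⟨i, hc, hq⟩
  · obtain ⟨p', q', rfl⟩ := Space.exists_mk P
    obtain ⟨i', hc', hq'⟩ := (H _ hj _ _).1 hP
    rcases eq_or_eq_rev i' i with rfl | rfl
    · obtain rfl := hc.word_unique hc'
      exact ⟨_, hPU, _, hq', rfl⟩
    · obtain ⟨f, hf, hfU⟩ := exists_of_isOpen hU hPU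
      obtain ⟨hp, ha⟩ := isPrime_span_coords_diff hx ho hirr p' (Fin.rev i)
      -- Primality gives a point of the axis inside the open set whose coordinate is nonzero and so
      -- can be inverted.
      obtain ⟨z', hz', hfz⟩ := exists_mem_axis_ne_zero hx ho hirr fun h =>
        (hp.mem_or_mem h).elim (not_mem_span_of_mem_axis hq' hf) ha
      rw [map_mul] at hfz
      obtain ⟨z, hz, hzc⟩ := exists_mem_axis ((ho o).2 rfl) (hc.isInterior hc')
        (z' (active x k p' (Fin.rev i)))⁻¹
      have hs : SamePoint x k 𝕜 p z p' z' := samePoint_of_carries hne hx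
        (fun S _ _ k z z' hz hz' => hz.eq_of_isOrigin hx ho hz') hc hc' hz hz' (by
          rw [hzc, inv_mul_cancel₀ (right_ne_zero_of_mul hfz)])
      exact ⟨_, hfU z' (left_ne_zero_of_mul hfz), z, hz, (Space.mk_eq_mk hx).2 hs⟩

theorem isIrreducible_twig [IsAlgClosed 𝕜]
    (hx : (MvPolynomial.aeval x : MvPolynomial (Fin 2) 𝕜 →ₐ[𝕜] A).toRingHom.Etale)
    {o : A →ₐ[𝕜] 𝕜} (ho : ∀ b : A →ₐ[𝕜] 𝕜, (∀ i, b (x i) = 0) ↔ b = o)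
    (hirr : ∀ i, (Ideal.span {x i}).IsPrime)
    {j : ℕ} (hj : j ≤ 2 ^ k) : IsIrreducible (twig x o k j) := by
  obtain ⟨p, i, hc⟩ := exists_carries hj
  rw [← closure_axis hx ho hirr hc]
  refine ⟨?_, (isPreirreducible_axis hx ho hirr p i).closure⟩
  exact closure_nonempty_iff.2
    ⟨_, _, (exists_isOrigin ((ho o).2 rfl)).mem_axis p i, rfl⟩

/-- An axis has a point other than the origin, and such a point is not on the other axis of its
chart. -/
theorem eq_of_twig_subset [IsAlgClosed 𝕜]
    (hx : (MvPolynomial.aeval x : MvPolynomial (Fin 2) 𝕜 →ₐ[𝕜] A).toRingHom.Etale)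
    {o : A →ₐ[𝕜] 𝕜} (ho : ∀ b : A →ₐ[𝕜] 𝕜, (∀ i, b (x i) = 0) ↔ b = o)
    (hirr : ∀ i, (Ideal.span {x i}).IsPrime)
    {a b : ℕ} (ha : a ≤ 2 ^ k) (hb : b ≤ 2 ^ k)
    (h : twig x o k a ⊆ twig x o k b) : a = b := by
  have : Nontrivial A := o.toRingHom.domain_nontrivial
  have hne (i : Fin 2) : x (Fin.rev i) ≠ x i := coord_ne hx ((ho o).2 rfl) (rev_ne i)
  have H := twigCharts hx ho hirr k
  obtain ⟨p, i, hc⟩ := exists_carries ha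
  obtain ⟨q, hq, hqa⟩ := exists_mem_axis_ne_zero hx ho hirr
    (isPrime_span_coords_diff hx ho hirr p i).2
  obtain ⟨i', hc', hq'⟩ := (H b hb _ _).1 (h ((H a ha _ _).2 ⟨i, hc, hq⟩))
  rcases eq_or_eq_rev i' i with rfl | rfl
  · obtain ⟨n, hn, rfl, rfl⟩ := hc
    obtain ⟨n', hn', hp, rfl⟩ := hc'
    rw [chainWord_injOn hn hn' hp]
  · exact (hqa ((isOrigin_iff_mem_axis_rev hne).2 ⟨hq, hq'⟩ _ (active_mem_coords p i))).elim

/-- The twigs are a finite cover by closed irreducible sets with no inclusions among them, so they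
are the components. -/
theorem mem_range_twig_iff_maximal [IsAlgClosed 𝕜]
    (hx : (MvPolynomial.aeval x : MvPolynomial (Fin 2) 𝕜 →ₐ[𝕜] A).toRingHom.Etale)
    {o : A →ₐ[𝕜] 𝕜} (ho : ∀ b : A →ₐ[𝕜] 𝕜, (∀ i, b (x i) = 0) ↔ b = o)
    (hirr : ∀ i, (Ideal.span {x i}).IsPrime)
    [CharZero 𝕜] (Z : Set (Space 𝕜 x k)) :
    (∃ j ≤ 2 ^ k, twig x o k j = Z) ↔
      Maximal (fun Y => IsIrreducible Y ∧ Y ⊆ centralFiber 𝕜 x k) Z := by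
  classical
  have H := twigCharts hx ho hirr k
  have hsub {j : ℕ} (hj : j ≤ 2 ^ k) : twig x o k j ⊆ centralFiber 𝕜 x k := fun P hP =>
    (mem_centralFiber_iff_exists_twig hx ho hirr).2 ⟨j, hj, hP⟩
  have hcov {Y : Set (Space 𝕜 x k)} (hY : IsIrreducible Y ∧ Y ⊆ centralFiber 𝕜 x k) :
      ∃ j ≤ 2 ^ k, Y ⊆ twig x o k j := by
    obtain ⟨z, hz, hYz⟩ := isIrreducible_iff_sUnion_isClosed.1 hY.1
      ((Finset.range (2 ^ k + 1)).image (twig x o k)) (by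
        intro z hz
        obtain ⟨j, hj, rfl⟩ := Finset.mem_image.1 hz
        exact H.isClosed (Nat.lt_succ_iff.1 (Finset.mem_range.1 hj))) (by
        intro P hP
        obtain ⟨j, hj, hPj⟩ := (mem_centralFiber_iff_exists_twig hx ho hirr).1 (hY.2 hP)
        exact ⟨_, Finset.mem_coe.2 (Finset.mem_image_of_mem _
          (Finset.mem_range.2 (Nat.lt_succ_iff.2 hj))), hPj⟩)
    obtain ⟨j, hj, rfl⟩ := Finset.mem_image.1 hz
    exact ⟨j, Nat.lt_succ_iff.1 (Finset.mem_range.1 hj), hYz⟩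
  constructor
  · rintro ⟨j, hj, rfl⟩
    refine ⟨⟨isIrreducible_twig hx ho hirr hj, hsub hj⟩, fun Y hY hjY => ?_⟩
    obtain ⟨j', hj', hYj'⟩ := hcov hY
    obtain rfl := eq_of_twig_subset hx ho hirr hj hj' (hjY.trans hYj')
    exact hYj'
  · intro hZ
    obtain ⟨j, hj, hZj⟩ := hcov hZ.1
    exact ⟨j, hj, (hZ.2 ⟨isIrreducible_twig hx ho hirr hj, hsub hj⟩ hZj).antisymm hZj⟩

theorem twig_inter_twig_succ [IsAlgClosed 𝕜]
    (hx : (MvPolynomial.aeval x : MvPolynomial (Fin 2) 𝕜 →ₐ[𝕜] A).toRingHom.Etale)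
    {o : A →ₐ[𝕜] 𝕜} (ho : ∀ b : A →ₐ[𝕜] 𝕜, (∀ i, b (x i) = 0) ↔ b = o)
    (hirr : ∀ i, (Ideal.span {x i}).IsPrime)
    {n : ℕ} (hn : n < 2 ^ k) :
    twig x o k n ∩ twig x o k (n + 1) = {node x o (chainWord k n)} := by
  have : Nontrivial A := o.toRingHom.domain_nontrivial
  have hne (i : Fin 2) : x (Fin.rev i) ≠ x i := coord_ne hx ((ho o).2 rfl) (rev_ne i)
  have H := twigCharts hx ho hirr k
  have hO := exists_isOrigin (x := x) (k := k) ((ho o).2 rfl)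
  refine Set.Subset.antisymm ?_ ?_
  · rintro P ⟨h1, h2⟩
    obtain ⟨p, q, rfl⟩ := Space.exists_mk P
    obtain ⟨i, hc, hq⟩ := (H n hn.le _ _).1 h1
    obtain ⟨i', hc', hq'⟩ := (H (n + 1) hn _ _).1 h2
    obtain rfl := hc.index_of_succ hc'
    obtain rfl := hc.word_unique ⟨n, hn, rfl, rfl⟩
    obtain rfl : i' = 1 := hc'.index_unique ⟨n, hn, rfl, rfl⟩
    rw [((isOrigin_iff_mem_axis_rev hne).2 ⟨hq, hq'⟩).eq ho]
    rfl
  · rintro _ rfl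
    exact ⟨(H n hn.le _ _).2 ⟨0, ⟨n, hn, rfl, rfl⟩, hO.mem_axis _ _⟩,
      (H (n + 1) hn _ _).2 ⟨1, ⟨n, hn, rfl, rfl⟩, hO.mem_axis _ _⟩⟩

theorem disjoint_twig [IsAlgClosed 𝕜]
    (hx : (MvPolynomial.aeval x : MvPolynomial (Fin 2) 𝕜 →ₐ[𝕜] A).toRingHom.Etale)
    {o : A →ₐ[𝕜] 𝕜} (ho : ∀ b : A →ₐ[𝕜] 𝕜, (∀ i, b (x i) = 0) ↔ b = o)
    (hirr : ∀ i, (Ideal.span {x i}).IsPrime)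
    {a b : ℕ} (hb : b ≤ 2 ^ k) (h : a + 1 < b) :
    Disjoint (twig x o k a) (twig x o k b) := by
  have H := twigCharts hx ho hirr k
  rw [Set.disjoint_left]
  intro P h1 h2
  obtain ⟨p, q, rfl⟩ := Space.exists_mk P
  obtain ⟨i, ⟨n, hn, rfl, hi⟩, -⟩ := (H a (by omega) _ _).1 h1
  obtain ⟨i', ⟨n', hn', hp, hi'⟩, -⟩ := (H b hb _ _).1 h2
  have := chainWord_injOn hn hn' hp
  omega

theorem inChart_twig_nonempty_iff [IsAlgClosed 𝕜]
    (hx : (MvPolynomial.aeval x : MvPolynomial (Fin 2) 𝕜 →ₐ[𝕜] A).toRingHom.Etale)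
    {o : A →ₐ[𝕜] 𝕜} (ho : ∀ b : A →ₐ[𝕜] 𝕜, (∀ i, b (x i) = 0) ↔ b = o)
    (hirr : ∀ i, (Ideal.span {x i}).IsPrime)
    {n j : ℕ} (hn : n < 2 ^ k) (hj : j ≤ 2 ^ k) :
    (inChart (chainWord k n) (twig x o k j)).Nonempty ↔ j = n ∨ j = n + 1 := by
  have H := twigCharts hx ho hirr k
  have hO := exists_isOrigin (x := x) (k := k) ((ho o).2 rfl)
  constructor
  · rintro ⟨q, hq⟩
    obtain ⟨i, ⟨n', hn', hp, hi⟩, -⟩ := (H j hj _ _).1 hq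
    have := chainWord_injOn hn hn' hp
    omega
  · rintro (rfl | rfl)
    · exact ⟨_, (H _ hj _ _).2 ⟨0, ⟨_, hn, rfl, rfl⟩, hO.mem_axis _ _⟩⟩
    · exact ⟨_, (H _ hj _ _).2 ⟨1, ⟨_, hn, rfl, rfl⟩, hO.mem_axis _ _⟩⟩

end Chain

/-! ### Affine charts and homogenisation on ℙ¹ -/

section ProjectiveLine

variable {𝕜 : Type u} [Field 𝕜]

theorem eval_smul_of_isHomogeneous {σ : Type*} [Fintype σ] {d : ℕ} {g : MvPolynomial σ 𝕜}
    (hg : g.IsHomogeneous d) (a : 𝕜) (v : σ → 𝕜) :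
    MvPolynomial.eval (a • v) g = a ^ d * MvPolynomial.eval v g := by
  rw [MvPolynomial.eval_eq', MvPolynomial.eval_eq', Finset.mul_sum]
  refine Finset.sum_congr rfl fun e he => ?_
  have h : e.degree = d := by
    rw [Finsupp.degree_eq_weight_one]
    exact hg (MvPolynomial.mem_support_iff.1 he)
  simp only [Pi.smul_apply, smul_eq_mul, mul_pow, Finset.prod_mul_distrib,
    Finset.prod_pow_eq_pow_sum]
  rw [← Finsupp.degree_eq_sum, h]
  ring

theorem exists_isHomogeneous_eval (i : Fin 2) {G : Polynomial 𝕜} {d : ℕ} (hd : G.natDegree ≤ d) :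
    ∃ Q : MvPolynomial (Fin 2) 𝕜, Q.IsHomogeneous d ∧ ∀ v : Fin 2 → 𝕜, v (Fin.rev i) ≠ 0 →
      MvPolynomial.eval v Q = v (Fin.rev i) ^ d * G.eval (v i / v (Fin.rev i)) := by
  refine ⟨∑ n ∈ Finset.range (d + 1), C (G.coeff n) * (X i ^ n * X (Fin.rev i) ^ (d - n)),
    MvPolynomial.IsHomogeneous.sum _ _ _ fun n hn => ?_, fun v hv => ?_⟩
  · have h := ((MvPolynomial.isHomogeneous_X_pow (R := 𝕜) i n).mul
      (MvPolynomial.isHomogeneous_X_pow (R := 𝕜) (Fin.rev i) (d - n))).C_mul (G.coeff n)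
    rwa [Nat.add_sub_cancel' (Nat.lt_succ_iff.1 (Finset.mem_range.1 hn))] at h
  · rw [Polynomial.eval_eq_sum_range' (Nat.lt_succ_iff.2 hd), map_sum, Finset.mul_sum]
    refine Finset.sum_congr rfl fun n hn => ?_
    obtain ⟨m, rfl⟩ := Nat.exists_eq_add_of_le (Nat.lt_succ_iff.1 (Finset.mem_range.1 hn))
    simp only [map_mul, map_pow, MvPolynomial.eval_C, MvPolynomial.eval_X, div_pow,
      Nat.add_sub_cancel_left, pow_add]
    field_simp

/-- The ratio of the homogeneous coordinates of a point of the projective line. -/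
noncomputable def ratio (i : Fin 2) (P : Projectivization 𝕜 (Fin 2 → 𝕜)) : 𝕜 :=
  P.rep i / P.rep (Fin.rev i)

/-- The vector with coordinates `c` and `1`, with `c` at the index `i`. -/
def affineVec (i : Fin 2) (c : 𝕜) : Fin 2 → 𝕜 := fun l => if l = i then c else 1

theorem affineVec_self (i : Fin 2) (c : 𝕜) : affineVec i c i = c := if_pos rfl

theorem affineVec_rev (i : Fin 2) (c : 𝕜) : affineVec i c (Fin.rev i) = 1 := if_neg (rev_ne i)

theorem affineVec_ne_zero (i : Fin 2) (c : 𝕜) : affineVec i c ≠ 0 := fun h => by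
  have := congrFun h (Fin.rev i)
  rw [affineVec_rev] at this
  exact one_ne_zero this

theorem rep_eq_smul_affineVec {i : Fin 2} {P : Projectivization 𝕜 (Fin 2 → 𝕜)}
    (h : P.rep (Fin.rev i) ≠ 0) : P.rep = P.rep (Fin.rev i) • affineVec i (ratio i P) := by
  funext l
  revert l
  rw [forall_fin_two_iff i, Pi.smul_apply, Pi.smul_apply, affineVec_self, affineVec_rev, ratio,
    smul_eq_mul, smul_eq_mul, mul_div_cancel₀ _ h, mul_one]
  exact ⟨rfl, rfl⟩

theorem exists_ratio_eq (i : Fin 2) (c : 𝕜) :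
    ∃ P : Projectivization 𝕜 (Fin 2 → 𝕜), P.rep (Fin.rev i) ≠ 0 ∧ ratio i P = c := by
  obtain ⟨a, ha⟩ := Projectivization.exists_smul_eq_mk_rep 𝕜 _ (affineVec_ne_zero i c)
  have h1 := congrFun ha i
  have h2 := congrFun ha (Fin.rev i)
  rw [Pi.smul_apply, affineVec_self, Units.smul_def, smul_eq_mul] at h1
  rw [Pi.smul_apply, affineVec_rev, Units.smul_def, smul_eq_mul, mul_one] at h2
  refine ⟨_, h2 ▸ a.ne_zero, ?_⟩
  rw [ratio, ← h1, ← h2, mul_div_cancel_left₀ _ a.ne_zero]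

theorem eq_of_ratio_eq {i : Fin 2} {P P' : Projectivization 𝕜 (Fin 2 → 𝕜)}
    (h : P.rep (Fin.rev i) ≠ 0) (h' : P'.rep (Fin.rev i) ≠ 0) (hr : ratio i P = ratio i P') :
    P = P' := by
  have e (P : Projectivization 𝕜 (Fin 2 → 𝕜)) (h : P.rep (Fin.rev i) ≠ 0) :
      P = Projectivization.mk 𝕜 _ (affineVec_ne_zero i (ratio i P)) := by
    conv_lhs => rw [← P.mk_rep]
    exact (Projectivization.mk_eq_mk_iff' _ _ _ _ _).2 ⟨_, (rep_eq_smul_affineVec h).symm⟩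
  rw [e P h, e P' h']
  congr 2

theorem exists_rep_rev_ne_zero (P : Projectivization 𝕜 (Fin 2 → 𝕜)) :
    ∃ i, P.rep (Fin.rev i) ≠ 0 := by
  by_contra! h
  exact P.rep_nonzero (funext fun l => by simpa using h (Fin.rev l))

theorem rep_ne_zero_of_rev {i : Fin 2} {P : Projectivization 𝕜 (Fin 2 → 𝕜)}
    (h : P.rep (Fin.rev i) = 0) : P.rep i ≠ 0 := fun h' =>
  P.rep_nonzero (funext fun l => (forall_fin_two_iff (P := fun l => P.rep l = 0) i).2 ⟨h', h⟩ l)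

end ProjectiveLine

/-! ### Interior twigs are projective lines -/

section Copy

variable {𝕜 : Type u} [Field 𝕜] {A : Type v} [CommRing A] [Algebra 𝕜 A] {k : ℕ} {x : Fin 2 → A}

theorem isCopyOfP1_twig [IsAlgClosed 𝕜]
    (hx : (MvPolynomial.aeval x : MvPolynomial (Fin 2) 𝕜 →ₐ[𝕜] A).toRingHom.Etale)
    {o : A →ₐ[𝕜] 𝕜} (ho : ∀ b : A →ₐ[𝕜] 𝕜, (∀ i, b (x i) = 0) ↔ b = o)
    (hirr : ∀ i, (Ideal.span {x i}).IsPrime) {j : ℕ} (h0 : 0 < j) (hj : j < 2 ^ k) :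
    IsCopyOfP1 (twig x o k j) := by
  have : Nontrivial A := o.toRingHom.domain_nontrivial
  have ho' := (ho o).2 rfl
  have hne (i : Fin 2) : x (Fin.rev i) ≠ x i := coord_ne hx ho' (rev_ne i)
  have H := twigCharts hx ho hirr k
  -- Words j and j − 1 see twig j with index 0 and 1; both exist because 0 < j < 2ᵏ.
  obtain ⟨W, hW⟩ : ∃ W : Fin 2 → Word k, ∀ i, Carries k j (W i) i :=
    ⟨fun i => chainWord k (j - i), fun i => ⟨j - i, by omega, rfl, by omega⟩⟩
  have hint (i : Fin 2) : IsInterior k (W i) i := (hW i).isInterior (hW (Fin.rev i))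
  choose pt hpt hptc using fun (i : Fin 2) (c : 𝕜) => exists_mem_axis ho' (hint i) c
  have hpt_eq {i : Fin 2} {q : ChartPt 𝕜 A k 𝕜} (hq : q ∈ axis x (W i) i) :
      q = pt i (q (active x k (W i) i)) :=
    axis_unique ho (hint i) hq (hpt _ _) (hptc _ _).symm
  have hglue (i : Fin 2) {c c' : 𝕜} (h : c * c' = 1) :
      Space.mk x (W i) (pt i c) = Space.mk x (W (Fin.rev i)) (pt (Fin.rev i) c') :=
    (Space.mk_eq_mk hx).2 (samePoint_of_carries hne hx
      (fun S _ _ k z z' hz hz' => hz.eq_of_isOrigin hx ho hz') (hW i) (hW _) (hpt _ _) (hpt _ _)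
      (by rw [hptc, hptc, h]))
  have horigin (i : Fin 2) : IsOrigin x (pt i 0) := isOrigin_iff.2 ⟨hpt _ _, hptc _ _⟩
  have hmixed {i : Fin 2} {z : ChartPt 𝕜 A k 𝕜}
      (h : Space.mk x (W i) z = Space.mk x (W (Fin.rev i)) (pt (Fin.rev i) 0)) : False := by
    have h1 := H.word_eq (horigin _) h
    have h2 := hW (Fin.rev i)
    rw [← h1] at h2
    exact rev_ne i (h2.index_unique (hW i))
  -- The two affine lines are mapped by the ratio of homogeneous coordinates; by `hglue` the choice
  -- of the line does not matter.
  obtain ⟨φ, hφ⟩ : ∃ φ : Projectivization 𝕜 (Fin 2 → 𝕜) → Space 𝕜 x k,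
      ∀ i P, P.rep (Fin.rev i) ≠ 0 → φ P = Space.mk x (W i) (pt i (ratio i P)) := by
    choose ι hι using exists_rep_rev_ne_zero (𝕜 := 𝕜)
    refine ⟨fun P => Space.mk x (W (ι P)) (pt (ι P) (ratio (ι P) P)), fun i P h => ?_⟩
    have hi := hι P
    change Space.mk x (W (ι P)) (pt (ι P) (ratio (ι P) P)) = _
    generalize ι P = l at hi
    rcases eq_or_eq_rev i l with rfl | rfl
    · rfl
    · rw [Fin.rev_rev] at h
      refine hglue l ?_
      rw [ratio, ratio, Fin.rev_rev]
      field_simp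
  have hφ0 {i : Fin 2} {P : Projectivization 𝕜 (Fin 2 → 𝕜)} (h : P.rep (Fin.rev i) = 0) :
      φ P = Space.mk x (W (Fin.rev i)) (pt (Fin.rev i) 0) := by
    rw [hφ (Fin.rev i) P (by rw [Fin.rev_rev]; exact rep_ne_zero_of_rev h), ratio, h, zero_div]
  have hrep {i : Fin 2} {P : Projectivization 𝕜 (Fin 2 → 𝕜)} {z : ChartPt 𝕜 A k 𝕜}
      (h : φ P = Space.mk x (W i) z) : P.rep (Fin.rev i) ≠ 0 ∧ z = pt i (ratio i P) := by
    have h1 : P.rep (Fin.rev i) ≠ 0 := fun h' => hmixed (h.symm.trans (hφ0 h'))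
    exact ⟨h1, Space.mk_injective hx _ (h.symm.trans (hφ i P h1))⟩
  have hmem {p : Word k} {q : ChartPt 𝕜 A k 𝕜} (h : Space.mk x p q ∈ twig x o k j) :
      ∃ i, p = W i ∧ q ∈ axis x (W i) i := by
    obtain ⟨i, hc, hq⟩ := (H j hj.le _ _).1 h
    obtain rfl := hc.word_unique (hW i)
    exact ⟨i, rfl, hq⟩
  have hφmem (P : Projectivization 𝕜 (Fin 2 → 𝕜)) : φ P ∈ twig x o k j := by
    obtain ⟨i, hi⟩ := exists_rep_rev_ne_zero P
    rw [hφ i P hi]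
    exact (H j hj.le _ _).2 ⟨i, hW i, hpt _ _⟩
  refine ⟨φ, fun P P' h => ?_, Set.Subset.antisymm (Set.range_subset_iff.2 hφmem) ?_, fun f P => ?_⟩
  · obtain ⟨i, hi⟩ := exists_rep_rev_ne_zero P
    rw [hφ i P hi] at h
    obtain ⟨hi', hr⟩ := hrep h.symm
    refine eq_of_ratio_eq hi hi' ?_
    rw [← hptc i (ratio i P), hr, hptc]
  · intro Q hQ
    obtain ⟨p, q, rfl⟩ := Space.exists_mk Q
    obtain ⟨i, rfl, hq⟩ := hmem hQ
    obtain ⟨P, hP, hr⟩ := exists_ratio_eq i (q (active x k (W i) i))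
    exact ⟨P, by rw [hφ i P hP, hr, ← hpt_eq hq]⟩
  · constructor
    · rintro ⟨p, q, g, h, hPq, hqh, hf⟩
      obtain ⟨i, rfl, hq⟩ := hmem (hPq ▸ hφmem P)
      obtain ⟨hPi, hqr⟩ := hrep hPq
      rw [H.inChart (hW i)] at hf
      -- The universal point of the axis: through `ξ` every function on the chart restricts to a
      -- polynomial in the active coordinate.
      obtain ⟨ξ, hξ, hξc⟩ := exists_mem_axis (R := Polynomial 𝕜) ho' (hint i) Polynomial.X
      have hev (c : 𝕜) (F : ChartRing A k) : pt i c F = (ξ F).eval c := by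
        have h1 : (Polynomial.aeval c).comp ξ ∈ axis x (W i) i := fun a ha => by
          rw [AlgHom.comp_apply, hξ a ha, map_zero]
        have h2 := hpt_eq h1
        rw [AlgHom.comp_apply, hξc, Polynomial.aeval_X] at h2
        rw [← h2, AlgHom.comp_apply, Polynomial.coe_aeval_eq_eval]
      obtain ⟨G, hG, hGv⟩ := exists_isHomogeneous_eval i
        (le_max_left (ξ g).natDegree (ξ h).natDegree)
      obtain ⟨E, hE, hEv⟩ := exists_isHomogeneous_eval i
        (le_max_right (ξ g).natDegree (ξ h).natDegree)
      set d := max (ξ g).natDegree (ξ h).natDegree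
      have hX := MvPolynomial.isHomogeneous_X 𝕜 (Fin.rev i)
      -- The extra linear factor makes the denominator vanish at the point outside this chart, where
      -- the given quotient asserts nothing.
      refine ⟨1 + d, X (Fin.rev i) * G, X (Fin.rev i) * E, hX.mul hG, hX.mul hE, ?_, fun P' hP' => ?_⟩
      · rw [map_mul, MvPolynomial.eval_X, hEv _ hPi]
        rw [hqr, hev] at hqh
        exact mul_ne_zero hPi (mul_ne_zero (pow_ne_zero _ hPi) hqh)
      · rw [map_mul, MvPolynomial.eval_X] at hP'
        have hi' := left_ne_zero_of_mul hP'
        have hE' := right_ne_zero_of_mul hP'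
        rw [hEv _ hi'] at hE'
        have hh := right_ne_zero_of_mul hE'
        have := hf (pt i (ratio i P')) (hpt _ _) (by rw [hev]; exact hh)
        rw [Function.comp_apply, hφ i P' hi', this, hev, hev, map_mul, map_mul, MvPolynomial.eval_X,
          hEv _ hi', hGv _ hi', ← mul_assoc, ← mul_assoc]
        exact (mul_div_mul_left _ _ (mul_ne_zero hi' (pow_ne_zero _ hi'))).symm
    · rintro ⟨d, g, h, hg, hh, hPh, hf⟩
      obtain ⟨i, hi⟩ := exists_rep_rev_ne_zero P
      -- Dehomogenisation: one variable becomes the active coordinate, the other 1.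
      let D (F : MvPolynomial (Fin 2) 𝕜) : ChartRing A k :=
        MvPolynomial.aeval (fun l => if l = i then active x k (W i) i else 1) F
      have hD (q : ChartPt 𝕜 A k 𝕜) (F : MvPolynomial (Fin 2) 𝕜) :
          q (D F) = MvPolynomial.eval (affineVec i (q (active x k (W i) i))) F := by
        rw [← MvPolynomial.coe_aeval_eq_eval]
        change (q.comp (MvPolynomial.aeval _)) F = MvPolynomial.aeval _ F
        congr 1
        ext l
        simp only [AlgHom.comp_apply, MvPolynomial.aeval_X, affineVec]
        split_ifs <;> simp
      have hev {F : MvPolynomial (Fin 2) 𝕜} (hF : F.IsHomogeneous d)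
          {P' : Projectivization 𝕜 (Fin 2 → 𝕜)} (hi' : P'.rep (Fin.rev i) ≠ 0) :
          MvPolynomial.eval P'.rep F =
            P'.rep (Fin.rev i) ^ d * pt i (ratio i P') (D F) := by
        rw [hD, hptc, ← eval_smul_of_isHomogeneous hF, ← rep_eq_smul_affineVec hi']
      refine ⟨W i, pt i (ratio i P), D g, D h, hφ i P hi, fun h' => hPh ?_, fun q hq hqh => ?_⟩
      · rw [hev hh hi, h', mul_zero]
      · rw [H.inChart (hW i)] at hq
        obtain ⟨P', hi', hr⟩ := exists_ratio_eq i (q (active x k (W i) i))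
        have hq' : q = pt i (ratio i P') := by rw [hr, ← hpt_eq hq]
        rw [hq'] at hqh ⊢
        have hb := pow_ne_zero d hi'
        have := hf P' (by rw [hev hh hi']; exact mul_ne_zero hb hqh)
        rw [← hφ i P' hi']
        rw [Function.comp_apply, hev hh hi', hev hg hi', mul_div_mul_left _ _ hb] at this
        exact this

end Copy

end Monster

/-! ### The main theorem -/

theorem theorem4p1 {𝕜 : Type*} [Field 𝕜] [IsAlgClosed 𝕜] [CharZero 𝕜]
    {A : Type*} [CommRing A] [Algebra 𝕜 A]
    -- `A` is the coordinate ring of `U`, with local (étale) coordinates `x 0 = x₁`, `x 1 = x₂`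
    (x : Fin 2 → A)
    (hx : (MvPolynomial.aeval x : MvPolynomial (Fin 2) 𝕜 →ₐ[𝕜] A).toRingHom.Etale)
    -- the point `o` is the only common zero of `x₁`, `x₂` in `U`
    (o : A →ₐ[𝕜] 𝕜) (ho : ∀ u : A →ₐ[𝕜] 𝕜, (∀ i, u (x i) = 0) ↔ u = o)
    -- the curves `x₁ = 0` and `x₂ = 0` in `U` are irreducible
    (hirr : ∀ i, (Ideal.span {x i}).IsPrime)
    (k : ℕ) :
    -- `𝒳(k)` is flat over `T`
    (∀ p : Monster.Word k, RingHom.Flat (R := Polynomial 𝕜)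
      (S := Polynomial (Monster.ChartRing A k) ⧸ Monster.familyIdeal 𝕜 x p)
      (Monster.familyMap 𝕜 x p)) ∧
    -- the ideal of `X(k)₀` in each chart
    (∀ p : Monster.Word k,
      Monster.centralIdeal 𝕜 x p = Ideal.span (Monster.nodeBinomials x k p)) ∧
    ∃ (twig : Fin (2 ^ k + 1) → Set (Monster.Space 𝕜 x k))
      (word : Fin (2 ^ k) ≃o Lex (Monster.Word k)),
      -- the twigs are the `2 ^ k + 1` distinct irreducible components of `X(k)₀`
      Function.Injective twig ∧
      (∀ Z : Set (Monster.Space 𝕜 x k), Z ∈ Set.range twig ↔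
        Maximal (fun Y => IsIrreducible Y ∧ Y ⊆ Monster.centralFiber 𝕜 x k) Z) ∧
      (∀ i, IsClosed (twig i)) ∧
      (⋃ i, twig i) = Monster.centralFiber 𝕜 x k ∧
      -- they form a chain, consecutive twigs meet at the nodes in lexicographic order
      (∀ i : Fin (2 ^ k),
        twig i.castSucc ∩ twig i.succ = {Monster.node x o (ofLex (word i))}) ∧
      (∀ i j : Fin (2 ^ k + 1), (i : ℕ) + 1 < (j : ℕ) → Disjoint (twig i) (twig j)) ∧
      -- the end twigs
      twig 0 = Monster.iterProlong (Monster.zeroLocus x (x 1)) k ∧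
      twig (Fin.last (2 ^ k)) = Monster.iterProlong (Monster.zeroLocus x (x 0)) k ∧
      -- the interior twigs
      (∀ i, i ≠ 0 → i ≠ Fin.last (2 ^ k) →
        Monster.IsProlongedVertical (twig i) ∧ Monster.IsCopyOfP1 (twig i)) ∧
      -- in each chart there are two twigs, the axes of the two active coordinates, and
      -- the reduced curve has an ordinary node at the origin
      (∀ i : Fin (2 ^ k),
        (∀ j, (Monster.inChart (ofLex (word i)) (twig j)).Nonempty ↔
          j = i.castSucc ∨ j = i.succ) ∧
        Monster.inChart (ofLex (word i)) (twig i.castSucc) =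
          {q | ∀ c ∈ Monster.coords x k \ {Monster.active x k (ofLex (word i)) 0}, q c = 0} ∧
        Monster.inChart (ofLex (word i)) (twig i.succ) =
          {q | ∀ c ∈ Monster.coords x k \ {Monster.active x k (ofLex (word i)) 1}, q c = 0} ∧
        Monster.idealOf (ofLex (word i)) (twig i.castSucc) =
          Ideal.span (Monster.coords x k \ {Monster.active x k (ofLex (word i)) 0}) ∧
        Monster.idealOf (ofLex (word i)) (twig i.succ) =
          Ideal.span (Monster.coords x k \ {Monster.active x k (ofLex (word i)) 1}) ∧
        Monster.idealOf (ofLex (word i)) (Monster.centralFiber 𝕜 x k) =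
          Ideal.span (insert
            (Monster.active x k (ofLex (word i)) 0 * Monster.active x k (ofLex (word i)) 1)
            (Monster.coords x k \ {Monster.active x k (ofLex (word i)) 0,
              Monster.active x k (ofLex (word i)) 1}))) := by
  have ho' := (ho o).2 rfl
  have H := Monster.twigCharts hx ho hirr k
  have hle (i : Fin (2 ^ k + 1)) : (i : ℕ) ≤ 2 ^ k := Nat.lt_succ_iff.1 i.isLt
  refine ⟨Monster.flat_familyMap hx ho' hirr, Monster.centralIdeal_eq hx ho' hirr,
    fun i => Monster.twig x o k i, Monster.chainOrderIso k, fun i j h => ?_, fun Z => ?_,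
    fun i => H.isClosed (hle i), ?_, fun i => ?_,
    fun i j h => Monster.disjoint_twig hx ho hirr (hle j) h, Monster.twig_first o k, ?_,
    fun i h0 h1 => ?_, fun i => ?_⟩
  · exact Fin.ext (Monster.eq_of_twig_subset hx ho hirr (hle i) (hle j) h.subset)
  · rw [← Monster.mem_range_twig_iff_maximal hx ho hirr]
    exact ⟨fun ⟨i, hi⟩ => ⟨i, hle i, hi⟩, fun ⟨j, hj, h⟩ => ⟨⟨j, Nat.lt_succ_iff.2 hj⟩, h⟩⟩
  · ext P
    rw [Set.mem_iUnion, Monster.mem_centralFiber_iff_exists_twig hx ho hirr]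
    exact ⟨fun ⟨i, hi⟩ => ⟨i, hle i, hi⟩, fun ⟨j, hj, h⟩ => ⟨⟨j, Nat.lt_succ_iff.2 hj⟩, h⟩⟩
  · simpa using Monster.twig_inter_twig_succ hx ho hirr i.isLt
  · simpa using Monster.twig_last o k
  · have h0' : 0 < (i : ℕ) := Nat.pos_of_ne_zero fun h => h0 (Fin.ext h)
    have h1' : (i : ℕ) < 2 ^ k := lt_of_le_of_ne (hle i) fun h => h1 (Fin.ext h)
    exact ⟨Monster.isProlongedVertical_twig o h0' h1',
      Monster.isCopyOfP1_twig hx ho hirr h0' h1'⟩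
  · rw [Monster.ofLex_chainOrderIso]
    have hc (l : Fin 2) : Monster.Carries k (i + l) (Monster.chainWord k i) l :=
      ⟨i, i.isLt, rfl, rfl⟩
    have h0 := H.inChart (hc 0)
    have h1 := H.inChart (hc 1)
    refine ⟨fun j => ?_, h0, h1, Monster.idealOf_of_inChart_eq_axis hx ho hirr h0,
      Monster.idealOf_of_inChart_eq_axis hx ho hirr h1, Monster.idealOf_centralFiber hx ho hirr _⟩
    rw [Monster.inChart_twig_nonempty_iff hx ho hirr i.isLt (hle j), Fin.ext_iff, Fin.ext_iff]
    simp
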